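/- Let $\kappa,d\in\mathbb R$ with $d\neq 0$. Let $M$ be a (smooth, four-dimensional) Lie group whose Lie algebra has a basis $u_1,u_2,u_3,u_4$ with the only non-zero brackets $$[u_1,u_4]=(\kappa+1)u_1,\qquad [u_2,u_4]=\kappa u_2,\qquad [u_3,u_4]=(\kappa-1)u_3,$$ equipped with the left-invariant pseudo-Riemannian metric $$g=-2\,\theta^1\circ\theta^3+\theta^2\circ\theta^2+\theta^3\circ\theta^3+d\,\theta^4\circ\theta^4,$$ where $\theta^1,\dots,\theta^4$ is the dual left-invariant coframe and $\theta^i\circ\theta^j=\frac12(\theta^i\otimes\theta^j+\theta^j\otimes\theta^i)$ (this is the normalized local model of a non-reductive, not locally symmetric homogeneous four-manifold of type $\mathbf{A2}$). Let $F:\Sigma\to M$ be a smooth immersion of a connected smooth $3$-manifold, and let $\alpha,\beta,\gamma,\delta:\Sigma\to\mathbb R$ be smooth functions such that, in terms of the left-invariant frame $(u_i)$, the vector field $\xi=\alpha u_1+\beta u_2+\gamma u_3+\delta u_4$ along $F$ is normal to $\Sigma$ and satisfies $\langle\xi,\xi\rangle=\varepsilon$ with $\varepsilon\in\{1,-1\}$.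 Identify vector fields on $\Sigma$ with their images under $dF$, and let $\nabla$ be the Levi-Civita connection of $g$, $SX=-\nabla_X\xi$ the shape operator, $h(X,Y)=\langle SX,Y\rangle$ the second fundamental form and $\nabla^\Sigma$ the Levi-Civita connection of the induced metric. $\Sigma$ is *parallel* if $\nabla^\Sigma h=0$ and *totally geodesic* if $h=0$. Then $\Sigma$ is parallel if and only if one of the following sets of conditions holds on all of $\Sigma$. 1. $\beta=\gamma=0$, $d\delta^2=\varepsilon$ and $$V_1(\alpha)=V_2(\alpha)=0,\qquad V_3(\varphi)=2(\kappa+1)\alpha\varphi,$$ where $V_1=u_1$, $V_2=u_2$, $V_3=d\delta u_3+\alpha u_4$ and $\varphi=\alpha^2-\varepsilon-V_3(\alpha)$. 2. $\gamma=\delta=0$, $\beta^2=\varepsilon=1$ and, with $V_1=u_1$, $V_2=\alpha u_2+\beta u_3$, $V_3=u_4$, either (a) $V_1(\alpha)=V_3(\alpha)-\alpha=0$ and $V_2(\alpha)=0$, or (b) $\kappa=0$, $V_1(\alpha)=V_3(\alpha)-\alpha=0$, $V_2(V_2(\alpha))=0$ and $V_2(\alpha)\neq0$ everywhere. 3. $\kappa=2$,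 $\gamma=0$, $\beta\neq0$ and $\delta\neq0$ everywhere, $\beta^2+d\delta^2=\varepsilon$ and $$V_1(\beta)=V_2(\beta)=V_3(\beta)=0,\quad V_1(\alpha)=0,\quad V_2(\alpha)+\alpha\beta=0,\quad V_3(\alpha)+\beta\delta=0,$$ where $V_1=u_1$, $V_2=d\delta u_2-\beta u_4$, $V_3=\alpha u_2+\beta u_3$. Moreover: if $\beta=\gamma=0$ and $d\delta^2=\varepsilon$, then (in the notation of (1)) $\Sigma$ is totally geodesic if and only if $V_1(\alpha)=V_2(\alpha)=0$, $\kappa=0$ and $\varphi=0$. In case (2a) $\Sigma$ is always totally geodesic; in case (2b) it is never totally geodesic. In case (3) one has $S=-2\delta\,\mathrm{Id}$ (so $\Sigma$ is totally umbilical), and $\Sigma$ is never totally geodesic. -/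

import Mathlib

open scoped Manifold ContDiff

namespace A2

/-- Vectors of the four-dimensional Lie algebra `𝔪`, written in components with respect to a
basis `u₁, u₂, u₃, u₄` (the indices here run through `0, 1, 2, 3`). -/
abbrev Vec : Type := Fin 4 → ℝ

/-- The non-degenerate inner product `-2 θ¹∘θ³ + θ²∘θ² + θ³∘θ³ + d θ⁴∘θ⁴` on `𝔪`, where
`θ¹∘θ³ = (θ¹⊗θ³ + θ³⊗θ¹)/2`. -/
def inner0 (d : ℝ) (x y : Vec) : ℝ :=
  -(x 0 * y 2 + x 2 * y 0) + x 1 * y 1 + x 2 * y 2 + d * (x 3 * y 3)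

/-- The Lie bracket of `𝔪` in components: `[u₁,u₄] = (κ+1)u₁`, `[u₂,u₄] = κ u₂`,
`[u₃,u₄] = (κ-1)u₃`. -/
def bracket0 (κ : ℝ) (x y : Vec) : Vec :=
  ![(κ + 1) * (x 0 * y 3 - x 3 * y 0), κ * (x 1 * y 3 - x 3 * y 1),
    (κ - 1) * (x 2 * y 3 - x 3 * y 2), 0]

/-- The map `λ : 𝔪 → End(𝔪)` of the Levi-Civita connection of the left-invariant metric:
`lam κ d x y = λ(x) y`. It is pinned down by the Koszul formula `inner0_lam` below. -/
noncomputable def lam (κ d : ℝ) (x y : Vec) : Vec :=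
  ![κ * (x 0 * y 3) + x 2 * y 3 - x 3 * y 0 + x 3 * y 2,
    κ * (x 1 * y 3),
    κ * (x 2 * y 3) + x 3 * y 2,
    (κ * (x 0 * y 2) - κ * (x 1 * y 1) + κ * (x 2 * y 0) - (κ - 1) * (x 2 * y 2)) / d]

/-- The Koszul formula, which determines `lam` because `inner0 d` is non-degenerate for `d ≠ 0`. -/
theorem inner0_lam (κ d : ℝ) (hd : d ≠ 0) (x y z : Vec) :
    inner0 d (lam κ d x y) z = (1 / 2) * (inner0 d (bracket0 κ x y) z
      + inner0 d (bracket0 κ z x) y + inner0 d (bracket0 κ z y) x) := by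
  simp only [inner0, lam, bracket0, Matrix.cons_val]
  field_simp
  ring

/-! The ambient space is a Lie group `G` with Lie algebra `𝔪` and the left-invariant metric that
makes the left-invariant frame given by the basis `u` have the inner products of `inner0 d`. -/

section LieGroup

variable {G : Type*} [TopologicalSpace G] [ChartedSpace (EuclideanSpace ℝ (Fin 4)) G] [Group G]

/-- `u` is a basis of the Lie algebra of `G` in which the brackets are those of `𝔪`. -/
def IsBasisA2 (κ : ℝ) (u : Module.Basis (Fin 4) ℝ (GroupLieAlgebra (𝓡 4) G)) : Prop :=
  ⁅u 0, u 3⁆ = (κ + 1) • u 0 ∧ ⁅u 1, u 3⁆ = κ • u 1 ∧ ⁅u 2, u 3⁆ = (κ - 1) • u 2 ∧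
    ⁅u 0, u 1⁆ = 0 ∧ ⁅u 0, u 2⁆ = 0 ∧ ⁅u 1, u 2⁆ = 0

/-- The Maurer-Cartan form: a tangent vector `w` at `g` is sent to `dL_{g⁻¹} w`. -/
noncomputable def maurerCartan (g : G) (w : TangentSpace (𝓡 4) g) : GroupLieAlgebra (𝓡 4) G :=
  mfderiv (𝓡 4) (𝓡 4) (fun x : G => g⁻¹ * x) g w

/-- The Maurer-Cartan form sends the left-invariant field generated by `v` to `v`. -/
theorem maurerCartan_mulInvariantVectorField [LieGroup (𝓡 4) ∞ G] (g : G)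
    (v : GroupLieAlgebra (𝓡 4) G) :
    maurerCartan g (mulInvariantVectorField v g) = v := by
  have hd : ∀ (a x : G), MDifferentiableAt (𝓡 4) (𝓡 4) (fun b : G => a * b) x := fun a x =>
    (contMDiff_mul_left (I := 𝓡 4) (n := ∞)).contMDiffAt.mdifferentiableAt (by simp)
  have h1 : mfderiv (𝓡 4) (𝓡 4) ((fun x : G => g⁻¹ * x) ∘ (fun x : G => g * x)) 1 v = v := by
    have : (fun x : G => g⁻¹ * x) ∘ (fun x : G => g * x) = id := by ext x; simp
    rw [this, mfderiv_id]; rfl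
  rw [mfderiv_comp_apply (I' := 𝓡 4) (1 : G) (hd g⁻¹ (g * 1)) (hd g 1)] at h1
  have h2 : ∀ x : G, x = g → ∀ w : EuclideanSpace ℝ (Fin 4),
      (mfderiv (𝓡 4) (𝓡 4) (fun x : G => g⁻¹ * x) x : _ → EuclideanSpace ℝ (Fin 4)) w
        = (mfderiv (𝓡 4) (𝓡 4) (fun x : G => g⁻¹ * x) g : _ → EuclideanSpace ℝ (Fin 4)) w := by
    rintro x rfl w; rfl
  exact (h2 (g * 1) (mul_one g) _).symm.trans h1

variable (u : Module.Basis (Fin 4) ℝ (GroupLieAlgebra (𝓡 4) G))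
  {N : Type*} [TopologicalSpace N] [ChartedSpace (EuclideanSpace ℝ (Fin 3)) N] (F : N → G)

/-- The components of `dF(v)`, for `v` tangent to `N` at `p`, with respect to the left-invariant
frame of `G` given by `u`. -/
noncomputable def comp (p : N) (v : TangentSpace (𝓡 3) p) : Vec :=
  u.equivFun (maurerCartan (F p) (mfderiv (𝓡 3) (𝓡 4) F p v))

/-- A (smooth) vector field on `N`, identified with its image under `dF` and written in components
with respect to the left-invariant frame. -/
def IsTangentField (X : N → Vec) : Prop :=
  (∀ k, ContMDiff (𝓡 3) 𝓘(ℝ, ℝ) ∞ (fun p => X p k)) ∧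
    ∀ p, ∃ v : TangentSpace (𝓡 3) p, comp u F p v = X p

/-- The tangent vector `v` of `N` at `p` for which `dF(v)` has components `x`
(unique for an immersion; an irrelevant value if there is none). -/
noncomputable def tangentVec (p : N) (x : Vec) : TangentSpace (𝓡 3) p :=
  Function.invFun (comp u F p) x

/-- The derivative `X(f)` of a function `f` on `N` along a vector field `X` tangent to `N`. -/
noncomputable def derivAlong (X : N → Vec) (f : N → ℝ) : N → ℝ :=
  fun p => (mfderiv (𝓡 3) 𝓘(ℝ, ℝ) f p (tangentVec u F p (X p)) : ℝ)

/-- The Levi-Civita covariant derivative `∇_X Y` of the ambient space, for `X` tangent to `N` and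
`Y` a vector field along `F`: `∇_X Y = ∑ X(y_k) u_k + λ(X) Y`. -/
noncomputable def nabla (κ d : ℝ) (X Y : N → Vec) : N → Vec :=
  fun p => (fun k => derivAlong u F X (fun q => Y q k) p) + lam κ d (X p) (Y p)

/-- The shape operator `S X = -∇_X ξ`. -/
noncomputable def shape (κ d : ℝ) (ξ X : N → Vec) : N → Vec :=
  fun p => -nabla u F κ d X ξ p

/-- The second fundamental form `h(X,Y) = ⟨S X, Y⟩`. -/
noncomputable def secondForm (κ d : ℝ) (ξ X Y : N → Vec) : N → ℝ :=
  fun p => inner0 d (shape u F κ d ξ X p) (Y p)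

/-- The Levi-Civita connection of the induced metric on `N`: the component of `∇_X Y` tangent
to `N`. -/
noncomputable def nablaInduced (κ d : ℝ) (ξ X Y : N → Vec) : N → Vec :=
  fun p => nabla u F κ d X Y p
    - (inner0 d (nabla u F κ d X Y p) (ξ p) / inner0 d (ξ p) (ξ p)) • ξ p

/-- The covariant derivative
`(∇h)(X,Y,Z) = X(h(Y,Z)) - h(∇_X Y, Z) - h(Y, ∇_X Z)`, with the induced connection on `N`. -/
noncomputable def nablaSecondForm (κ d : ℝ) (ξ X Y Z : N → Vec) : N → ℝ :=
  fun p => derivAlong u F X (secondForm u F κ d ξ Y Z) p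
    - secondForm u F κ d ξ (nablaInduced u F κ d ξ X Y) Z p
    - secondForm u F κ d ξ Y (nablaInduced u F κ d ξ X Z) p

/-- The hypersurface is parallel: `∇h = 0`. -/
def IsParallel (κ d : ℝ) (ξ : N → Vec) : Prop :=
  ∀ X Y Z : N → Vec, IsTangentField u F X → IsTangentField u F Y → IsTangentField u F Z →
    ∀ p, nablaSecondForm u F κ d ξ X Y Z p = 0

/-- The hypersurface is totally geodesic: `h = 0`. -/
def IsTotallyGeodesic (κ d : ℝ) (ξ : N → Vec) : Prop :=
  ∀ X Y : N → Vec, IsTangentField u F X → IsTangentField u F Y →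
    ∀ p, secondForm u F κ d ξ X Y p = 0

/-- `ξ` is a smooth normal vector field along `F` with `⟨ξ,ξ⟩ = ε`. -/
structure IsUnitNormal (d ε : ℝ) (ξ : N → Vec) : Prop where
  smooth : ∀ k, ContMDiff (𝓡 3) 𝓘(ℝ, ℝ) ∞ (fun p => ξ p k)
  normal : ∀ p (v : TangentSpace (𝓡 3) p), inner0 d (comp u F p v) (ξ p) = 0
  unit : ∀ p, inner0 d (ξ p) (ξ p) = ε

/-! The tangent frames `V₁, V₂, V₃` of the three families. `V₁ = u₁` is common to all of them. -/

/-- `V₁ = u₁`. -/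
def V₁ : N → Vec := fun _ => ![1, 0, 0, 0]

/-- First family: `V₂ = u₂`. -/
def V₂i : N → Vec := fun _ => ![0, 1, 0, 0]

/-- First family: `V₃ = d δ u₃ + α u₄`. -/
def V₃i (d : ℝ) (α δ : N → ℝ) : N → Vec := fun p => ![0, 0, d * δ p, α p]

/-- Second family: `V₂ = α u₂ + β u₃`. -/
def V₂ii (α β : N → ℝ) : N → Vec := fun p => ![0, α p, β p, 0]

/-- Second family: `V₃ = u₄`. -/
def V₃ii : N → Vec := fun _ => ![0, 0, 0, 1]

/-- Third family: `V₂ = d δ u₂ - β u₄`. -/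
def V₂iii (d : ℝ) (β δ : N → ℝ) : N → Vec := fun p => ![0, d * δ p, 0, -β p]

/-- Third family: `V₃ = α u₂ + β u₃`. -/
def V₃iii (α β : N → ℝ) : N → Vec := fun p => ![0, α p, β p, 0]

/-- First family: `φ = α² - ε - V₃(α)`. -/
noncomputable def phi (d ε : ℝ) (α δ : N → ℝ) : N → ℝ :=
  fun p => α p ^ 2 - ε - derivAlong u F (V₃i d α δ) α p

/-- Algebraic conditions of the first family. -/
def Algebraic1 (d ε : ℝ) (β γ δ : N → ℝ) : Prop :=
  ∀ p, β p = 0 ∧ γ p = 0 ∧ d * δ p ^ 2 = ε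

/-- Algebraic conditions of the second family. -/
def Algebraic2 (ε : ℝ) (β γ δ : N → ℝ) : Prop :=
  ε = 1 ∧ ∀ p, γ p = 0 ∧ δ p = 0 ∧ β p ^ 2 = ε

/-- Algebraic conditions of the third family. -/
def Algebraic3 (κ d ε : ℝ) (β γ δ : N → ℝ) : Prop :=
  κ = 2 ∧ ∀ p, γ p = 0 ∧ β p ≠ 0 ∧ δ p ≠ 0 ∧ β p ^ 2 + d * δ p ^ 2 = ε

/-- First set of conditions. -/
def Case1 (κ d ε : ℝ) (α β γ δ : N → ℝ) : Prop :=
  Algebraic1 d ε β γ δ ∧ ∀ p,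
    derivAlong u F V₁ α p = 0 ∧ derivAlong u F V₂i α p = 0 ∧
    derivAlong u F (V₃i d α δ) (phi u F d ε α δ) p = 2 * (κ + 1) * α p * phi u F d ε α δ p

/-- Second set of conditions, first alternative. -/
def Case2a (ε : ℝ) (α β γ δ : N → ℝ) : Prop :=
  Algebraic2 ε β γ δ ∧ ∀ p,
    derivAlong u F V₁ α p = 0 ∧ derivAlong u F V₃ii α p - α p = 0 ∧
    derivAlong u F (V₂ii α β) α p = 0

/-- Second set of conditions, second alternative. -/
def Case2b (κ ε : ℝ) (α β γ δ : N → ℝ) : Prop :=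
  Algebraic2 ε β γ δ ∧ κ = 0 ∧ ∀ p,
    derivAlong u F V₁ α p = 0 ∧ derivAlong u F V₃ii α p - α p = 0 ∧
    derivAlong u F (V₂ii α β) (derivAlong u F (V₂ii α β) α) p = 0 ∧
    derivAlong u F (V₂ii α β) α p ≠ 0

/-- Third set of conditions. -/
def Case3 (κ d ε : ℝ) (α β γ δ : N → ℝ) : Prop :=
  Algebraic3 κ d ε β γ δ ∧ ∀ p,
    derivAlong u F V₁ β p = 0 ∧ derivAlong u F (V₂iii d β δ) β p = 0 ∧
    derivAlong u F (V₃iii α β) β p = 0 ∧ derivAlong u F V₁ α p = 0 ∧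
    derivAlong u F (V₂iii d β δ) α p + α p * β p = 0 ∧
    derivAlong u F (V₃iii α β) α p + β p * δ p = 0

end LieGroup

end A2

/-!
Let `ω` be the pull-back under `F` of the Maurer–Cartan form, so that the components of `dF(v)` with
respect to the left-invariant frame are `ω(v)`. The Maurer–Cartan equation `dω + ½[ω, ω] = 0`
(`maurerCartan_localForm`) says that the commutator of two tangent fields `X`, `Y` has components
`X(Y) - Y(X) + [X, Y]_𝔪` (`exists_comp_eq_bracket`). Hence the connection `nabla` is torsion-free
along `F`, the second fundamental form `h` is symmetric (`hAt_symm`), and the Codazzi equation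
(`codazzi`) holds with the curvature `curv` of the left-invariant metric.

If `∇h = 0`, the Codazzi equation gives `⟨R(x, y) ξ, z⟩ = 0` for tangent vectors `x`, `y`, `z`. The
curvature is that of constant sectional curvature `-κ²/d` plus two further terms (`inner0_curv`),
and the condition on these forces `γ = 0` (`gamma_eq_zero`) and `κ = 2` wherever `βδ ≠ 0`
(`kappa_eq_two`). With `γ = 0` the field `u₁` is tangent and null, and `h(u₁, ·) = -κδ g(u₁, ·)`.
Where `βδ ≠ 0`, the vanishing of `(∇_X h)(u₁, V₃)`, together with the symmetry of `h`, shows that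
`dδ = 0` (`critical_of_isParallel`). So `β dβ = 0` everywhere, the functions `β²` and
`δ²` are constant on the connected manifold, and there are three families: `β = 0`, or `δ = 0`, or
neither vanishes anywhere (`algebraic_of_isParallel`).

In each family, under the first-order conditions on `α` which symmetry and `critical_of_isParallel`
provide, the second fundamental form is `h = -κδ g + f θ³ ⊗ θ³` with `δ` constant
(`hAt_of_algebraic1`, `hAt_of_algebraic2`, `hAt_of_critical`), where `f` is `-εδφ`, `β V₂(α)` and
`β⁻¹ (V₃(α) + βδ)` respectively. Since `g` is parallel, `∇h` only involves `f` and `df`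
(`nablaSecondForm_of_hAt_eq`). The commutators of the frame determine the derivatives of `f` in the
first two families except in one direction, and `∇h = 0` becomes a single equation for `V₃(φ)` in
the first family, `κ V₂(α) = 0` and `V₂(V₂(α)) = 0` in the second, and `f = 0` in the third. In the
second family with `κ = 0` the function `V₂(α)` satisfies `df = 2 f θ⁴`, so by Grönwall's inequality
it vanishes identically or nowhere (`eq_zero_of_dirDeriv_eq`), which separates the two alternatives.
The assertions on totally geodesic hypersurfaces are read off from the formulas for `h`, and
`shape_of_case3` computes the shape operator of the third family.
-/

namespace A2

/-! ### The Maurer–Cartan form in a chart -/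

section LocalForm

open Filter Topology

variable {G : Type*} [TopologicalSpace G] [ChartedSpace (EuclideanSpace ℝ (Fin 4)) G] [Group G]
  {N : Type*} [TopologicalSpace N] [ChartedSpace (EuclideanSpace ℝ (Fin 3)) N]

/-- The coordinates with respect to the basis `u`, as a continuous linear map on the model space
of `G`, with which the Lie algebra is identified. -/
noncomputable def coordCLM (u : Module.Basis (Fin 4) ℝ (GroupLieAlgebra (𝓡 4) G)) :
    EuclideanSpace ℝ (Fin 4) →L[ℝ] Vec :=
  LinearMap.toContinuousLinearMap
    (show EuclideanSpace ℝ (Fin 4) →ₗ[ℝ] Vec from u.equivFun.toLinearMap)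

/-- The pull-back of the Maurer-Cartan form under `F`, read in the chart at `p`: at `a` it is the
derivative of `b ↦ F(a)⁻¹ F(b)` at `b = a`, whose value at `b = a` is the identity. -/
noncomputable def localForm (u : Module.Basis (Fin 4) ℝ (GroupLieAlgebra (𝓡 4) G)) (F : N → G)
    (p : N) (a : EuclideanSpace ℝ (Fin 3)) : EuclideanSpace ℝ (Fin 3) →L[ℝ] Vec :=
  coordCLM u ∘L fderiv ℝ (fun b => extChartAt (𝓡 4) (1 : G)
    ((F ((extChartAt (𝓡 3) p).symm a))⁻¹ * F ((extChartAt (𝓡 3) p).symm b))) a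

theorem contMDiffAt_extChartAt_symm [IsManifold (𝓡 3) ∞ N] {p : N}
    {a : EuclideanSpace ℝ (Fin 3)} (ha : a ∈ (extChartAt (𝓡 3) p).target) :
    ContMDiffAt 𝓘(ℝ, EuclideanSpace ℝ (Fin 3)) (𝓡 3) ∞ (extChartAt (𝓡 3) p).symm a :=
  (contMDiffOn_extChartAt_symm (n := ∞) p a ha).contMDiffAt
    ((isOpen_extChartAt_target p).mem_nhds ha)

variable [LieGroup (𝓡 4) ∞ G] [IsManifold (𝓡 3) ∞ N]
  (u : Module.Basis (Fin 4) ℝ (GroupLieAlgebra (𝓡 4) G)) {F : N → G}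

/-- `localForm` is the partial derivative in `b`, on the diagonal, of a function that is smooth in
the pair `(a, b)`; hence it is smooth. -/
theorem contDiffAt_localForm (hF : ContMDiff (𝓡 3) (𝓡 4) ∞ F) {p : N}
    {a : EuclideanSpace ℝ (Fin 3)} (ha : a ∈ (extChartAt (𝓡 3) p).target) :
    ContDiffAt ℝ ∞ (localForm u F p) a := by
  set σ := (extChartAt (𝓡 3) p).symm with hσ
  have hFσ : ContMDiffAt 𝓘(ℝ, EuclideanSpace ℝ (Fin 3)) (𝓡 4) ∞ (fun b => F (σ b)) a :=
    hF.contMDiffAt.comp a (contMDiffAt_extChartAt_symm ha)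
  have hH : ContDiffAt ℝ ∞ (Function.uncurry fun a b : EuclideanSpace ℝ (Fin 3) =>
      extChartAt (𝓡 4) (1 : G) ((F (σ a))⁻¹ * F (σ b))) (a, a) := by
    rw [← contMDiffAt_iff_contDiffAt]
    have h1 : ContMDiffAt 𝓘(ℝ, EuclideanSpace ℝ (Fin 3) × EuclideanSpace ℝ (Fin 3)) (𝓡 4) ∞
        (fun z : EuclideanSpace ℝ (Fin 3) × EuclideanSpace ℝ (Fin 3) => F (σ z.1)) (a, a) :=
      ContMDiffAt.comp (a, a) (g := fun b => F (σ b)) hFσ contDiff_fst.contMDiff.contMDiffAt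
    have h2 : ContMDiffAt 𝓘(ℝ, EuclideanSpace ℝ (Fin 3) × EuclideanSpace ℝ (Fin 3)) (𝓡 4) ∞
        (fun z : EuclideanSpace ℝ (Fin 3) × EuclideanSpace ℝ (Fin 3) => F (σ z.2)) (a, a) :=
      ContMDiffAt.comp (a, a) (g := fun b => F (σ b)) hFσ contDiff_snd.contMDiff.contMDiffAt
    have h3 := h1.inv.mul h2
    have h4 : ContMDiffAt (𝓡 4) 𝓘(ℝ, EuclideanSpace ℝ (Fin 4)) ∞ (extChartAt (𝓡 4) (1 : G))
        ((F (σ a))⁻¹ * F (σ a)) := by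
      rw [inv_mul_cancel]; exact contMDiffAt_extChartAt
    exact ContMDiffAt.comp (a, a) h4 h3
  exact contDiffAt_const.clm_comp (hH.fderiv contDiffAt_id (by simp))

/-- `localForm` is the chart expression of `comp`, the pull-back of the Maurer-Cartan form. -/
theorem localForm_apply (hF : ContMDiff (𝓡 3) (𝓡 4) ∞ F) {p : N}
    {a : EuclideanSpace ℝ (Fin 3)} (ha : a ∈ (extChartAt (𝓡 3) p).target)
    (w : EuclideanSpace ℝ (Fin 3)) :
    localForm u F p a w = comp u F ((extChartAt (𝓡 3) p).symm a)
      (mfderiv 𝓘(ℝ, EuclideanSpace ℝ (Fin 3)) (𝓡 3) (extChartAt (𝓡 3) p).symm a w) := by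
  set σ := (extChartAt (𝓡 3) p).symm with hσ
  have hσ' : MDifferentiableAt 𝓘(ℝ, EuclideanSpace ℝ (Fin 3)) (𝓡 3) σ a :=
    (contMDiffAt_extChartAt_symm ha).mdifferentiableAt (by simp)
  have hF' : MDifferentiableAt (𝓡 3) (𝓡 4) F (σ a) := hF.contMDiffAt.mdifferentiableAt (by simp)
  have hL : MDifferentiableAt (𝓡 4) (𝓡 4) (fun x : G => (F (σ a))⁻¹ * x) (F (σ a)) :=
    (contMDiff_mul_left (I := 𝓡 4) (n := ∞)).contMDiffAt.mdifferentiableAt (by simp)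
  have hψ : ∀ g : G, g = 1 → HasMFDerivAt (𝓡 4) 𝓘(ℝ, EuclideanSpace ℝ (Fin 4))
      (extChartAt (𝓡 4) (1 : G)) g (ContinuousLinearMap.id ℝ (EuclideanSpace ℝ (Fin 4))) := by
    rintro g rfl
    have h := (mdifferentiableAt_extChartAt (I := 𝓡 4) (mem_chart_source _ (1 : G))).hasMFDerivAt
    rw [mfderiv_extChartAt_self] at h
    exact h
  have h1 := (hψ ((F (σ a))⁻¹ * F (σ a)) (inv_mul_cancel _)).comp a
    ((hL.hasMFDerivAt.comp a (hF'.hasMFDerivAt.comp a hσ'.hasMFDerivAt)))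
  have h2 := (mfderiv_eq_fderiv (𝕜 := ℝ) (x := a) (f := fun b : EuclideanSpace ℝ (Fin 3) =>
    extChartAt (𝓡 4) (1 : G) ((F (σ a))⁻¹ * F (σ b)))).symm.trans h1.mfderiv
  exact congrArg (fun L : EuclideanSpace ℝ (Fin 3) →L[ℝ] EuclideanSpace ℝ (Fin 4) =>
    coordCLM u (L w)) h2

end LocalForm

/-! ### The Maurer–Cartan equation -/

section MaurerCartan

open Filter Topology VectorField

variable {G : Type*} [TopologicalSpace G] [ChartedSpace (EuclideanSpace ℝ (Fin 4)) G] [Group G]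
  {N : Type*} [TopologicalSpace N] [ChartedSpace (EuclideanSpace ℝ (Fin 3)) N]

theorem mulInvariantVectorField_eq_sum
    (u : Module.Basis (Fin 4) ℝ (GroupLieAlgebra (𝓡 4) G)) (v : GroupLieAlgebra (𝓡 4) G) (g : G) :
    mulInvariantVectorField v g = ∑ k, u.equivFun v k • mulInvariantVectorField (u k) g := by
  conv_lhs => rw [← u.sum_equivFun v]
  simp only [mulInvariantVectorField, map_sum, map_smul]
  rfl

variable [LieGroup (𝓡 4) ∞ G]

theorem lieGroup_minSmoothness : LieGroup (𝓡 4) (minSmoothness ℝ 3) G :=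
  LieGroup.of_le (n := ∞) (by
    rw [minSmoothness_of_isRCLikeNormedField]; exact WithTop.coe_le_coe.2 (le_top (a := (3 : ℕ∞))))

theorem mulInvariantVectorField_maurerCartan (g : G) (w : TangentSpace (𝓡 4) g) :
    mulInvariantVectorField (maurerCartan g w) g = w := by
  have hd : ∀ (a x : G), MDifferentiableAt (𝓡 4) (𝓡 4) (fun b : G => a * b) x := fun a x =>
    (contMDiff_mul_left (I := 𝓡 4) (n := ∞)).contMDiffAt.mdifferentiableAt (by simp)
  have h1 : mfderiv (𝓡 4) (𝓡 4) ((fun x : G => g * x) ∘ (fun x : G => g⁻¹ * x)) g w = w := by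
    have : (fun x : G => g * x) ∘ (fun x : G => g⁻¹ * x) = id := by ext x; simp
    rw [this, mfderiv_id]; rfl
  rw [mfderiv_comp_apply (I' := 𝓡 4) (g : G) (hd g (g⁻¹ * g)) (hd g⁻¹ g)] at h1
  -- `g⁻¹ * g` is only propositionally equal to `1`, so the derivative is transported
  -- along the equality
  have h2 : ∀ x : G, x = 1 → ∀ w : EuclideanSpace ℝ (Fin 4),
      (mfderiv (𝓡 4) (𝓡 4) (fun x : G => g * x) x : _ → EuclideanSpace ℝ (Fin 4)) w
        = (mfderiv (𝓡 4) (𝓡 4) (fun x : G => g * x) 1 : _ → EuclideanSpace ℝ (Fin 4)) w := by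
    rintro x rfl w; rfl
  exact (h2 (g⁻¹ * g) (inv_mul_cancel g) _).symm.trans h1

/-- The structure constants of the basis `u` are those of `bracket0`. -/
theorem equivFun_lie {κ : ℝ} {u : Module.Basis (Fin 4) ℝ (GroupLieAlgebra (𝓡 4) G)}
    (hu : IsBasisA2 κ u) (i j : Fin 4) :
    u.equivFun ⁅u i, u j⁆ = bracket0 κ (Pi.single i 1) (Pi.single j 1) := by
  have := lieGroup_minSmoothness (G := G)
  obtain ⟨h03, h13, h23, h01, h02, h12⟩ := hu
  have hs : ∀ i j, ⁅u j, u i⁆ = -⁅u i, u j⁆ := fun i j => (lie_skew (u j) (u i)).symm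
  have hz : ∀ i, ⁅u i, u i⁆ = 0 := fun i => lie_self (u i)
  fin_cases i <;> fin_cases j <;>
    simp only [Fin.mk_one, Fin.zero_eta, Fin.reduceFinMk, hz, h03, h13, h23, h01, h02, h12,
      hs 0 3, hs 1 3, hs 2 3, hs 0 1, hs 0 2, hs 1 2, map_zero, map_neg, map_smul] <;>
    ext k <;> fin_cases k <;> simp [bracket0, Module.Basis.equivFun_apply]

variable (u : Module.Basis (Fin 4) ℝ (GroupLieAlgebra (𝓡 4) G))

/-- The left-invariant vector field generated by `u k`, read in the chart of `G` at `g`. -/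
noncomputable def chartField (g : G) (k : Fin 4) :
    EuclideanSpace ℝ (Fin 4) → EuclideanSpace ℝ (Fin 4) :=
  mpullbackWithin 𝓘(ℝ, EuclideanSpace ℝ (Fin 4)) (𝓡 4) (extChartAt (𝓡 4) g).symm
    (mulInvariantVectorField (u k)) (Set.range (𝓡 4))

theorem differentiableAt_chartField (g : G) (k : Fin 4) :
    DifferentiableAt ℝ (chartField u g k) (extChartAt (𝓡 4) g g) := by
  have := lieGroup_minSmoothness (G := G)
  have h := (mdifferentiableAt_mulInvariantVectorField (I := 𝓡 4) (u k)
    (g := g)).mdifferentiableWithinAt (s := Set.univ)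
  have h' := h.differentiableWithinAt_mpullbackWithin_vectorField
  rw [← differentiableWithinAt_univ]
  simpa [chartField] using h'

theorem chartField_extChartAt (g : G) (k : Fin 4) {x : G} (hx : x ∈ (extChartAt (𝓡 4) g).source) :
    chartField u g k (extChartAt (𝓡 4) g x) =
      mfderiv (𝓡 4) 𝓘(ℝ, EuclideanSpace ℝ (Fin 4)) (extChartAt (𝓡 4) g) x
        (mulInvariantVectorField (u k) x) := by
  have h1 : chartField u g k (extChartAt (𝓡 4) g x) =
      mfderiv (𝓡 4) 𝓘(ℝ, EuclideanSpace ℝ (Fin 4)) (extChartAt (𝓡 4) g)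
        ((extChartAt (𝓡 4) g).symm (extChartAt (𝓡 4) g x))
        (mulInvariantVectorField (u k) ((extChartAt (𝓡 4) g).symm (extChartAt (𝓡 4) g x))) := by
    have hy := (extChartAt (𝓡 4) g).map_source hx
    exact congrArg (fun L : EuclideanSpace ℝ (Fin 4) →L[ℝ] EuclideanSpace ℝ (Fin 4) =>
      L (mulInvariantVectorField (u k) ((extChartAt (𝓡 4) g).symm (extChartAt (𝓡 4) g x))))
      (ContinuousLinearMap.inverse_eq
        (mfderivWithin_extChartAt_symm_comp_mfderiv_extChartAt hy)
        (mfderiv_extChartAt_comp_mfderivWithin_extChartAt_symm hy))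
  rw [h1]
  have h2 : ∀ y : G, y = x → (mfderiv (𝓡 4) 𝓘(ℝ, EuclideanSpace ℝ (Fin 4)) (extChartAt (𝓡 4) g) y
      (mulInvariantVectorField (u k) y) : EuclideanSpace ℝ (Fin 4)) =
      mfderiv (𝓡 4) 𝓘(ℝ, EuclideanSpace ℝ (Fin 4)) (extChartAt (𝓡 4) g) x
      (mulInvariantVectorField (u k) x) := by rintro y rfl; rfl
  exact h2 _ ((extChartAt (𝓡 4) g).left_inv hx)

/-- At the centre of the chart its derivative is the identity, and the bracket of the fields in the
chart is that of the invariant fields. -/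
theorem lieBracket_chartField (g : G) (i j : Fin 4) :
    lieBracket ℝ (chartField u g i) (chartField u g j) (extChartAt (𝓡 4) g g) =
      (mulInvariantVectorField ⁅u i, u j⁆ g : EuclideanSpace ℝ (Fin 4)) := by
  have := lieGroup_minSmoothness (G := G)
  rw [GroupLieAlgebra.bracket_def, mulInvariantVector_mlieBracket]
  let B : EuclideanSpace ℝ (Fin 4) := lieBracketWithin ℝ (chartField u g i) (chartField u g j)
    ((extChartAt (𝓡 4) g).symm ⁻¹' Set.univ ∩ Set.range (𝓡 4)) (extChartAt (𝓡 4) g g)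
  have hB : B = lieBracket ℝ (chartField u g i) (chartField u g j) (extChartAt (𝓡 4) g g) := by
    simp only [B, Set.preimage_univ, ModelWithCorners.range_eq_univ, Set.univ_inter,
      lieBracketWithin_univ]
  have h : mlieBracket (𝓡 4) (mulInvariantVectorField (u i)) (mulInvariantVectorField (u j)) g =
      (mfderiv (𝓡 4) 𝓘(ℝ, EuclideanSpace ℝ (Fin 4)) (extChartAt (𝓡 4) g) g).inverse B :=
    mlieBracketWithin_apply
  rw [h, mfderiv_extChartAt_self, ← hB]
  exact (congrArg (fun L : EuclideanSpace ℝ (Fin 4) →L[ℝ] EuclideanSpace ℝ (Fin 4) => L _)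
    ContinuousLinearMap.inverse_id).symm

/-- The differential of `F` in charts is the pulled-back Maurer-Cartan form followed by the
left-invariant frame. -/
theorem fderiv_chart_eq_sum [IsManifold (𝓡 3) ∞ N] {F : N → G} (hF : ContMDiff (𝓡 3) (𝓡 4) ∞ F)
    {p : N} {g : G} {a : EuclideanSpace ℝ (Fin 3)} (ha : a ∈ (extChartAt (𝓡 3) p).target)
    (hg : F ((extChartAt (𝓡 3) p).symm a) ∈ (extChartAt (𝓡 4) g).source)
    (w : EuclideanSpace ℝ (Fin 3)) :
    fderiv ℝ (fun b => extChartAt (𝓡 4) g (F ((extChartAt (𝓡 3) p).symm b))) a w =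
      ∑ k, localForm u F p a w k •
        chartField u g k (extChartAt (𝓡 4) g (F ((extChartAt (𝓡 3) p).symm a))) := by
  set σ := (extChartAt (𝓡 3) p).symm with hσ
  have hσ' : MDifferentiableAt 𝓘(ℝ, EuclideanSpace ℝ (Fin 3)) (𝓡 3) σ a :=
    (contMDiffAt_extChartAt_symm ha).mdifferentiableAt (by simp)
  have hF' : MDifferentiableAt (𝓡 3) (𝓡 4) F (σ a) := hF.contMDiffAt.mdifferentiableAt (by simp)
  have hψ : MDifferentiableAt (𝓡 4) 𝓘(ℝ, EuclideanSpace ℝ (Fin 4)) (extChartAt (𝓡 4) g)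
      (F (σ a)) := mdifferentiableAt_extChartAt (by simpa using hg)
  have h1 := hψ.hasMFDerivAt.comp a (hF'.hasMFDerivAt.comp a hσ'.hasMFDerivAt)
  have h2 := (mfderiv_eq_fderiv (𝕜 := ℝ) (x := a) (f := fun b : EuclideanSpace ℝ (Fin 3) =>
    extChartAt (𝓡 4) g (F (σ b)))).symm.trans h1.mfderiv
  set z : TangentSpace (𝓡 4) (F (σ a)) := mfderiv (𝓡 3) (𝓡 4) F (σ a)
    (mfderiv 𝓘(ℝ, EuclideanSpace ℝ (Fin 3)) (𝓡 3) σ a w) with hz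
  have h3 : fderiv ℝ (fun b => extChartAt (𝓡 4) g (F (σ b))) a w =
      mfderiv (𝓡 4) 𝓘(ℝ, EuclideanSpace ℝ (Fin 4)) (extChartAt (𝓡 4) g) (F (σ a)) z :=
    congrArg (fun L : EuclideanSpace ℝ (Fin 3) →L[ℝ] EuclideanSpace ℝ (Fin 4) => L w) h2
  rw [h3]
  have h4 : z = ∑ k, localForm u F p a w k • mulInvariantVectorField (u k) (F (σ a)) := by
    rw [localForm_apply u hF ha w, ← mulInvariantVectorField_maurerCartan (F (σ a)) z,
      mulInvariantVectorField_eq_sum u]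
    rfl
  rw [h4, map_sum]
  refine Finset.sum_congr rfl fun k _ => ?_
  rw [map_smul, chartField_extChartAt u g k hg]
  rfl

theorem chartField_linearIndependent (g : G) (c : Vec)
    (hc : ∑ k, c k • chartField u g k (extChartAt (𝓡 4) g g) = 0) : c = 0 := by
  have h1 : mulInvariantVectorField (u.equivFun.symm c) g = 0 := by
    rw [mulInvariantVectorField_eq_sum u]
    simp only [LinearEquiv.apply_symm_apply]
    refine Eq.trans (Finset.sum_congr rfl fun k _ => ?_) hc
    rw [chartField_extChartAt u g k (mem_extChartAt_source g), mfderiv_extChartAt_self]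
    rfl
  have h2 := maurerCartan_mulInvariantVectorField g (u.equivFun.symm c)
  rw [h1] at h2
  have h3 : u.equivFun.symm c = 0 := by
    rw [← h2]; exact map_zero (mfderiv (𝓡 4) (𝓡 4) (fun x : G => g⁻¹ * x) g)
  exact u.equivFun.symm.map_eq_zero_iff.mp h3

/-- The Maurer-Cartan equation `dω + ½[ω,ω] = 0` for the pulled-back form, at the centre of the
chart. -/
theorem maurerCartan_localForm [IsManifold (𝓡 3) ∞ N] {κ : ℝ} (hu : IsBasisA2 κ u) {F : N → G}
    (hF : ContMDiff (𝓡 3) (𝓡 4) ∞ F) (p : N) (w w' : EuclideanSpace ℝ (Fin 3)) :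
    fderiv ℝ (localForm u F p) (extChartAt (𝓡 3) p p) w w' -
      fderiv ℝ (localForm u F p) (extChartAt (𝓡 3) p p) w' w =
    -bracket0 κ (localForm u F p (extChartAt (𝓡 3) p p) w)
      (localForm u F p (extChartAt (𝓡 3) p p) w') := by
  set σ := (extChartAt (𝓡 3) p).symm with hσ
  set a₀ := extChartAt (𝓡 3) p p with ha₀
  set g := F p with hg
  set b₀ := extChartAt (𝓡 4) g g with hb₀
  set A := localForm u F p with hA
  set Φ : EuclideanSpace ℝ (Fin 3) → EuclideanSpace ℝ (Fin 4) :=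
    fun b => extChartAt (𝓡 4) g (F (σ b)) with hΦ
  set W : Fin 4 → EuclideanSpace ℝ (Fin 4) := fun k => chartField u g k b₀ with hW
  set D : Fin 4 → EuclideanSpace ℝ (Fin 4) →L[ℝ] EuclideanSpace ℝ (Fin 4) :=
    fun k => fderiv ℝ (chartField u g k) b₀ with hD
  have ha : a₀ ∈ (extChartAt (𝓡 3) p).target := mem_extChartAt_target p
  have hσa : σ a₀ = p := extChartAt_to_inv p
  have hΦa : Φ a₀ = b₀ := by simp only [hΦ, hσa, hb₀, hg]
  have hFσ : ContMDiffAt 𝓘(ℝ, EuclideanSpace ℝ (Fin 3)) (𝓡 4) ∞ (fun b => F (σ b)) a₀ :=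
    hF.contMDiffAt.comp a₀ (contMDiffAt_extChartAt_symm ha)
  have hΦs : ContDiffAt ℝ ∞ Φ a₀ := by
    rw [← contMDiffAt_iff_contDiffAt]
    refine ContMDiffAt.comp a₀ (g := extChartAt (𝓡 4) g) ?_ hFσ
    rw [hσa]
    exact contMDiffAt_extChartAt
  have hAd : DifferentiableAt ℝ A a₀ := (contDiffAt_localForm u hF ha).differentiableAt (by simp)
  -- `dΦ = ∑ₖ ωₖ Wₖ ∘ Φ` near `a₀`; differentiating it and using the symmetry of the second
  -- derivative of `Φ` gives the equation
  have hev : ∀ w, (fun a => fderiv ℝ Φ a w) =ᶠ[𝓝 a₀]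
      fun a => ∑ k, A a w k • chartField u g k (Φ a) := by
    intro w
    have h1 : ∀ᶠ a in 𝓝 a₀, F (σ a) ∈ (extChartAt (𝓡 4) g).source := by
      apply hFσ.continuousAt.eventually_mem
      rw [hσa]
      exact extChartAt_source_mem_nhds g
    filter_upwards [(isOpen_extChartAt_target p).mem_nhds ha, h1] with a h2 h3
    exact fderiv_chart_eq_sum u hF h2 h3 w
  have hdΦ : ∀ w, fderiv ℝ Φ a₀ w = ∑ k, A a₀ w k • W k := by
    intro w
    have h := (hev w).self_of_nhds
    simp only [hΦa] at h
    exact h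
  have hd2 : ∀ v w, fderiv ℝ (fderiv ℝ Φ) a₀ v w =
      ∑ k, (A a₀ w k • D k (fderiv ℝ Φ a₀ v) + fderiv ℝ A a₀ v w k • W k) := by
    intro v w
    have h1 : HasFDerivAt (fun a => fderiv ℝ Φ a w)
        (((ContinuousLinearMap.apply ℝ _ w)).comp (fderiv ℝ (fderiv ℝ Φ) a₀)) a₀ :=
      (ContinuousLinearMap.apply ℝ (EuclideanSpace ℝ (Fin 4)) w).hasFDerivAt.comp a₀
        ((hΦs.fderiv_right (m := ∞) (by simp)).differentiableAt (by simp)).hasFDerivAt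
    have h2 : ∀ k, HasFDerivAt (fun a => A a w k)
        (((ContinuousLinearMap.proj k).comp (ContinuousLinearMap.apply ℝ Vec w)).comp
          (fderiv ℝ A a₀)) a₀ := fun k =>
      ((ContinuousLinearMap.proj (R := ℝ) (φ := fun _ : Fin 4 => ℝ) k).comp
        (ContinuousLinearMap.apply ℝ Vec w)).hasFDerivAt.comp a₀ hAd.hasFDerivAt
    have h3 : ∀ k, HasFDerivAt (fun a => chartField u g k (Φ a))
        ((D k).comp (fderiv ℝ Φ a₀)) a₀ := by
      intro k
      have h4 : HasFDerivAt (chartField u g k) (D k) (Φ a₀) := by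
        rw [hΦa]; exact (differentiableAt_chartField u g k).hasFDerivAt
      exact h4.comp a₀ (hΦs.differentiableAt (by simp)).hasFDerivAt
    have h5 := (HasFDerivAt.fun_sum fun k (_ : k ∈ Finset.univ) =>
      (h2 k).smul (h3 k)).congr_of_eventuallyEq (hev w)
    have h6 := congrArg (fun L : EuclideanSpace ℝ (Fin 3) →L[ℝ] EuclideanSpace ℝ (Fin 4) => L v)
      (h1.unique h5)
    simpa [hΦa] using h6
  have hsymm : fderiv ℝ (fderiv ℝ Φ) a₀ w w' = fderiv ℝ (fderiv ℝ Φ) a₀ w' w :=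
    ((hΦs.of_le (m := 2) (WithTop.coe_le_coe.2 (le_top (a := (2 : ℕ∞))))).isSymmSndFDerivAt
      (by simp)) w w'
  have hbr : ∀ i j, D j (W i) - D i (W j) =
      ∑ k, bracket0 κ (Pi.single i 1) (Pi.single j 1) k • W k := by
    intro i j
    have h1 := lieBracket_chartField u g i j
    rw [mulInvariantVectorField_eq_sum u, equivFun_lie hu] at h1
    refine Eq.trans h1 (Finset.sum_congr rfl fun k _ => ?_)
    simp only [hW, hb₀]
    rw [chartField_extChartAt u g k (mem_extChartAt_source g), mfderiv_extChartAt_self]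
    rfl
  have hbil : ∀ (x y : Vec) k, bracket0 κ x y k =
      ∑ i, ∑ j, x i * y j * bracket0 κ (Pi.single i 1) (Pi.single j 1) k := by
    intro x y k
    fin_cases k <;> simp [bracket0, Fin.sum_univ_four] <;> ring
  have hbrW : ∀ x y : Vec, ∑ k, bracket0 κ x y k • W k =
      ∑ i, ∑ j, (x i * y j) • (D j (W i) - D i (W j)) := by
    intro x y
    simp_rw [hbr, hbil x y, Finset.sum_smul, Finset.smul_sum, smul_smul]
    rw [Finset.sum_comm]
    exact Finset.sum_congr rfl fun i _ => Finset.sum_comm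
  have hDΦ : ∀ v v', ∑ k, A a₀ v k • D k (fderiv ℝ Φ a₀ v') =
      ∑ i, ∑ j, (A a₀ v i * A a₀ v' j) • D i (W j) := by
    intro v v'
    simp_rw [hdΦ, map_sum, map_smul, Finset.smul_sum, smul_smul]
  rw [hd2, hd2, Finset.sum_add_distrib, Finset.sum_add_distrib, hDΦ, hDΦ, Finset.sum_comm] at hsymm
  have key : ∑ k, (fderiv ℝ A a₀ w w' - fderiv ℝ A a₀ w' w +
      bracket0 κ (A a₀ w) (A a₀ w')) k • W k = 0 := by
    simp only [Pi.add_apply, Pi.sub_apply, add_smul, sub_smul, Finset.sum_add_distrib,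
      Finset.sum_sub_distrib, hbrW, smul_sub]
    simp only [mul_comm (A a₀ w' _)] at hsymm
    rw [eq_sub_of_add_eq' hsymm]
    abel
  have h0 := chartField_linearIndependent u g _ key
  exact eq_neg_of_add_eq_zero_left h0

end MaurerCartan

/-! ### Derivations along tangent fields -/

section Derivations

open Filter Topology

variable {G : Type*} [TopologicalSpace G] [ChartedSpace (EuclideanSpace ℝ (Fin 4)) G] [Group G]
  {N : Type*} [TopologicalSpace N] [ChartedSpace (EuclideanSpace ℝ (Fin 3)) N]
  {u : Module.Basis (Fin 4) ℝ (GroupLieAlgebra (𝓡 4) G)} {F : N → G}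

theorem fderiv_comp_extChartAt_symm [IsManifold (𝓡 3) ∞ N] {f : N → ℝ}
    (hf : ContMDiff (𝓡 3) 𝓘(ℝ, ℝ) ∞ f) {p : N}
    {a : EuclideanSpace ℝ (Fin 3)} (ha : a ∈ (extChartAt (𝓡 3) p).target)
    (w : EuclideanSpace ℝ (Fin 3)) :
    fderiv ℝ (fun b => f ((extChartAt (𝓡 3) p).symm b)) a w =
      mfderiv (𝓡 3) 𝓘(ℝ, ℝ) f ((extChartAt (𝓡 3) p).symm a)
        (mfderiv 𝓘(ℝ, EuclideanSpace ℝ (Fin 3)) (𝓡 3) (extChartAt (𝓡 3) p).symm a w) := by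
  have h1 := (hf.contMDiffAt.mdifferentiableAt (by simp)).hasMFDerivAt.comp a
    ((contMDiffAt_extChartAt_symm ha).mdifferentiableAt (by simp)).hasMFDerivAt
  have h2 := (mfderiv_eq_fderiv (𝕜 := ℝ) (x := a) (f := fun b : EuclideanSpace ℝ (Fin 3) =>
    f ((extChartAt (𝓡 3) p).symm b))).symm.trans h1.mfderiv
  exact congrArg (fun L : EuclideanSpace ℝ (Fin 3) →L[ℝ] ℝ => L w) h2

theorem contDiffAt_comp_extChartAt_symm [IsManifold (𝓡 3) ∞ N] {f : N → ℝ}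
    (hf : ContMDiff (𝓡 3) 𝓘(ℝ, ℝ) ∞ f) {p : N}
    {a : EuclideanSpace ℝ (Fin 3)} (ha : a ∈ (extChartAt (𝓡 3) p).target) :
    ContDiffAt ℝ ∞ (fun b => f ((extChartAt (𝓡 3) p).symm b)) a := by
  rw [← contMDiffAt_iff_contDiffAt]
  exact hf.contMDiffAt.comp a (contMDiffAt_extChartAt_symm ha)

theorem mfderiv_extChartAt_symm_self [IsManifold (𝓡 3) ∞ N] (p : N)
    (w : EuclideanSpace ℝ (Fin 3)) :
    (mfderiv 𝓘(ℝ, EuclideanSpace ℝ (Fin 3)) (𝓡 3) (extChartAt (𝓡 3) p).symm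
      (extChartAt (𝓡 3) p p) w : EuclideanSpace ℝ (Fin 3)) = w := by
  have : IsManifold (𝓡 3) 1 N := IsManifold.of_le (n := ∞) (by simp)
  have h := mfderivWithin_range_extChartAt_symm (I := 𝓡 3) (x := p)
  rw [ModelWithCorners.range_eq_univ, mfderivWithin_univ] at h
  exact congrArg (fun L : EuclideanSpace ℝ (Fin 3) →L[ℝ] EuclideanSpace ℝ (Fin 3) => L w) h

theorem fderiv_comp_extChartAt_symm_self [IsManifold (𝓡 3) ∞ N] {f : N → ℝ}
    (hf : ContMDiff (𝓡 3) 𝓘(ℝ, ℝ) ∞ f) (p : N) (v : EuclideanSpace ℝ (Fin 3)) :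
    fderiv ℝ (fun b => f ((extChartAt (𝓡 3) p).symm b)) (extChartAt (𝓡 3) p p) v =
      mfderiv (𝓡 3) 𝓘(ℝ, ℝ) f p v := by
  have h : ∀ q : N, q = p → ∀ v : EuclideanSpace ℝ (Fin 3),
    (mfderiv (𝓡 3) 𝓘(ℝ, ℝ) f q v : ℝ) = mfderiv (𝓡 3) 𝓘(ℝ, ℝ) f p v := by rintro q rfl v; rfl
  rw [fderiv_comp_extChartAt_symm hf (mem_extChartAt_target p),
    ← h _ (extChartAt_to_inv (I := 𝓡 3) p)]
  exact congrArg _ (mfderiv_extChartAt_symm_self p v)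

theorem exists_mfderiv_extChartAt_symm_eq [IsManifold (𝓡 3) ∞ N] {p : N}
    {a : EuclideanSpace ℝ (Fin 3)} (ha : a ∈ (extChartAt (𝓡 3) p).target)
    (v : TangentSpace (𝓡 3) ((extChartAt (𝓡 3) p).symm a)) :
    ∃ w : EuclideanSpace ℝ (Fin 3),
      mfderiv 𝓘(ℝ, EuclideanSpace ℝ (Fin 3)) (𝓡 3) (extChartAt (𝓡 3) p).symm a w = v := by
  have : IsManifold (𝓡 3) 1 N := IsManifold.of_le (n := ∞) (by simp)
  have h := mfderivWithin_extChartAt_symm_comp_mfderiv_extChartAt (I := 𝓡 3) ha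
  rw [ModelWithCorners.range_eq_univ, mfderivWithin_univ] at h
  exact ⟨_, congrArg (fun L : TangentSpace (𝓡 3) ((extChartAt (𝓡 3) p).symm a) →L[ℝ]
    TangentSpace (𝓡 3) ((extChartAt (𝓡 3) p).symm a) => L v) h⟩

theorem mfderiv_extChartAt_symm_injective [IsManifold (𝓡 3) ∞ N] {p : N}
    {a : EuclideanSpace ℝ (Fin 3)} (ha : a ∈ (extChartAt (𝓡 3) p).target) :
    Function.Injective
      (mfderiv 𝓘(ℝ, EuclideanSpace ℝ (Fin 3)) (𝓡 3) (extChartAt (𝓡 3) p).symm a) := by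
  have : IsManifold (𝓡 3) 1 N := IsManifold.of_le (n := ∞) (by simp)
  have h := (isInvertible_mfderivWithin_extChartAt_symm (I := 𝓡 3) ha).injective
  rwa [ModelWithCorners.range_eq_univ, mfderivWithin_univ] at h

variable [LieGroup (𝓡 4) ∞ G]

theorem comp_injective (hF' : ∀ p, Function.Injective (mfderiv (𝓡 3) (𝓡 4) F p)) (p : N) :
    Function.Injective (comp u F p) := by
  have h : Function.Injective (maurerCartan (F p)) :=
    Function.LeftInverse.injective (g := fun v => mulInvariantVectorField v (F p))
      (mulInvariantVectorField_maurerCartan (F p))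
  exact u.equivFun.injective.comp (h.comp (hF' p))

theorem derivAlong_eq_mfderiv (hF' : ∀ p, Function.Injective (mfderiv (𝓡 3) (𝓡 4) F p))
    {X : N → Vec} {p : N} {v : TangentSpace (𝓡 3) p} (hv : comp u F p v = X p) (f : N → ℝ) :
    derivAlong u F X f p = mfderiv (𝓡 3) 𝓘(ℝ, ℝ) f p v := by
  unfold derivAlong tangentVec
  rw [← hv, Function.leftInverse_invFun (comp_injective hF' p) v]

variable [IsManifold (𝓡 3) ∞ N]

theorem derivAlong_eq_fderiv (hF : ContMDiff (𝓡 3) (𝓡 4) ∞ F)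
    (hF' : ∀ p, Function.Injective (mfderiv (𝓡 3) (𝓡 4) F p))
    {X : N → Vec} {f : N → ℝ} (hf : ContMDiff (𝓡 3) 𝓘(ℝ, ℝ) ∞ f) {p : N}
    {a : EuclideanSpace ℝ (Fin 3)} (ha : a ∈ (extChartAt (𝓡 3) p).target)
    {w : EuclideanSpace ℝ (Fin 3)}
    (hw : localForm u F p a w = X ((extChartAt (𝓡 3) p).symm a)) :
    derivAlong u F X f ((extChartAt (𝓡 3) p).symm a) =
      fderiv ℝ (fun b => f ((extChartAt (𝓡 3) p).symm b)) a w := by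
  rw [localForm_apply u hF ha] at hw
  rw [derivAlong_eq_mfderiv hF' hw, fderiv_comp_extChartAt_symm hf ha]

theorem localForm_injective (hF : ContMDiff (𝓡 3) (𝓡 4) ∞ F)
    (hF' : ∀ p, Function.Injective (mfderiv (𝓡 3) (𝓡 4) F p)) {p : N}
    {a : EuclideanSpace ℝ (Fin 3)} (ha : a ∈ (extChartAt (𝓡 3) p).target) :
    Function.Injective (localForm u F p a) := by
  have h := (comp_injective (u := u) hF' ((extChartAt (𝓡 3) p).symm a)).comp
    (mfderiv_extChartAt_symm_injective ha)
  intro w w' hw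
  rw [localForm_apply u hF ha, localForm_apply u hF ha] at hw
  exact h hw

theorem comp_eq_localForm (hF : ContMDiff (𝓡 3) (𝓡 4) ∞ F) (p : N)
    (v : EuclideanSpace ℝ (Fin 3)) : comp u F p v = localForm u F p (extChartAt (𝓡 3) p p) v := by
  have h1 : ∀ q : N, q = p → ∀ v : EuclideanSpace ℝ (Fin 3),
      comp u F q v = comp u F p v := by rintro q rfl v; rfl
  rw [localForm_apply u hF (mem_extChartAt_target p), ← h1 _ (extChartAt_to_inv (I := 𝓡 3) p)]
  exact congrArg _ (mfderiv_extChartAt_symm_self p v).symm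

/-- The vector field `X`, read in the chart at `p`, is smooth: near each point it arises from the
smooth family `X` of component vectors by inverting the injective linear maps `localForm u F p a`
composed with a fixed projection. -/
theorem exists_local_field (hF : ContMDiff (𝓡 3) (𝓡 4) ∞ F)
    (hF' : ∀ p, Function.Injective (mfderiv (𝓡 3) (𝓡 4) F p))
    {X : N → Vec} (hX : IsTangentField u F X) (p : N) :
    ∃ w : EuclideanSpace ℝ (Fin 3) → EuclideanSpace ℝ (Fin 3),
      ContDiffAt ℝ ∞ w (extChartAt (𝓡 3) p p) ∧
      ∀ a ∈ (extChartAt (𝓡 3) p).target,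
        localForm u F p a (w a) = X ((extChartAt (𝓡 3) p).symm a) := by
  set σ := (extChartAt (𝓡 3) p).symm with hσ
  set a₀ := extChartAt (𝓡 3) p p with ha₀
  set A := localForm u F p with hA
  have ha : a₀ ∈ (extChartAt (𝓡 3) p).target := mem_extChartAt_target p
  have hex : ∀ a, ∃ w, a ∈ (extChartAt (𝓡 3) p).target → A a w = X (σ a) := by
    intro a
    by_cases h : a ∈ (extChartAt (𝓡 3) p).target
    · obtain ⟨v, hv⟩ := hX.2 (σ a)
      obtain ⟨w, hw⟩ := exists_mfderiv_extChartAt_symm_eq h v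
      refine ⟨w, fun _ => ?_⟩
      rw [hA, localForm_apply u hF h, hw, hv]
    · exact ⟨0, fun h' => absurd h' h⟩
  choose w hw using hex
  -- `w` is the given family of solutions; with a left inverse `L` of `A a₀` it equals
  -- `(L ∘ A a)⁻¹ (L (X a))` near `a₀`, which is smooth in `a`
  refine ⟨w, ?_, fun a h => hw a h⟩
  obtain ⟨L, hL⟩ := LinearMap.exists_leftInverse_of_injective
    (A a₀ : EuclideanSpace ℝ (Fin 3) →ₗ[ℝ] Vec)
    (LinearMap.ker_eq_bot.2 (localForm_injective hF hF' ha))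
  set L' : Vec →L[ℝ] EuclideanSpace ℝ (Fin 3) := LinearMap.toContinuousLinearMap L with hL'
  have hLA : L' ∘L A a₀ = ((ContinuousLinearEquiv.refl ℝ (EuclideanSpace ℝ (Fin 3)) :
      EuclideanSpace ℝ (Fin 3) ≃L[ℝ] EuclideanSpace ℝ (Fin 3)) :
      EuclideanSpace ℝ (Fin 3) →L[ℝ] EuclideanSpace ℝ (Fin 3)) := by
    ext1 v
    exact congrArg (fun M : EuclideanSpace ℝ (Fin 3) →ₗ[ℝ] EuclideanSpace ℝ (Fin 3) => M v) hL
  have hAs : ContDiffAt ℝ ∞ A a₀ := contDiffAt_localForm u hF ha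
  have hLAs : ContDiffAt ℝ ∞ (fun a => L' ∘L A a) a₀ := contDiffAt_const.clm_comp hAs
  have hXs : ContDiffAt ℝ ∞ (fun a => X (σ a)) a₀ :=
    contDiffAt_pi.2 fun k => contDiffAt_comp_extChartAt_symm (hX.1 k) ha
  have hinv : ContDiffAt ℝ ∞ (fun a => (L' ∘L A a).inverse) a₀ := by
    refine ContDiffAt.comp a₀ (g := ContinuousLinearMap.inverse) ?_ hLAs
    rw [hLA]
    exact contDiffAt_map_inverse _
  refine (hinv.clm_apply (contDiffAt_const.clm_apply hXs : ContDiffAt ℝ ∞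
    (fun a => L' (X (σ a))) a₀)).congr_of_eventuallyEq ?_
  have hev : ∀ᶠ a in 𝓝 a₀, (L' ∘L A a).IsInvertible := by
    have h1 := (ContinuousLinearEquiv.isOpen (𝕜 := ℝ) (E := EuclideanSpace ℝ (Fin 3))
      (F := EuclideanSpace ℝ (Fin 3))).mem_nhds (x := L' ∘L A a₀) ⟨_, hLA.symm⟩
    exact hLAs.continuousAt.eventually_mem h1
  filter_upwards [hev, (isOpen_extChartAt_target p).mem_nhds ha] with a h1 h2
  obtain ⟨e, he⟩ := h1
  rw [← hw a h2]
  have h3 : L' (A a (w a)) = e (w a) := by rw [← ContinuousLinearMap.comp_apply, ← he]; rfl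
  rw [h3, ← he, ContinuousLinearMap.inverse_equiv]
  simp

section Calculus

variable (hF : ContMDiff (𝓡 3) (𝓡 4) ∞ F)
  (hF' : ∀ p, Function.Injective (mfderiv (𝓡 3) (𝓡 4) F p))
include hF hF'

theorem contMDiff_derivAlong {X : N → Vec} (hX : IsTangentField u F X) {f : N → ℝ}
    (hf : ContMDiff (𝓡 3) 𝓘(ℝ, ℝ) ∞ f) : ContMDiff (𝓡 3) 𝓘(ℝ, ℝ) ∞ (derivAlong u F X f) := by
  intro p
  obtain ⟨w, hws, hw⟩ := exists_local_field hF hF' hX p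
  have ha := mem_extChartAt_target (I := 𝓡 3) p
  have h1 : ContDiffAt ℝ ∞ (fun a => fderiv ℝ (fun b => f ((extChartAt (𝓡 3) p).symm b)) a (w a))
      (extChartAt (𝓡 3) p p) :=
    ((contDiffAt_comp_extChartAt_symm hf ha).fderiv_right (by simp)).clm_apply hws
  have h2 : ContMDiffAt (𝓡 3) 𝓘(ℝ, ℝ) ∞ (fun q => fderiv ℝ (fun b =>
      f ((extChartAt (𝓡 3) p).symm b)) (extChartAt (𝓡 3) p q) (w (extChartAt (𝓡 3) p q))) p :=
    h1.contMDiffAt.comp p (contMDiffAt_extChartAt (I := 𝓡 3) (x := p))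
  refine h2.congr_of_eventuallyEq ?_
  filter_upwards [extChartAt_source_mem_nhds (I := 𝓡 3) p] with q hq
  have hq' := (extChartAt (𝓡 3) p).map_source hq
  rw [← derivAlong_eq_fderiv hF hF' hf hq' (hw _ hq'), (extChartAt (𝓡 3) p).left_inv hq]

/-- The bracket of two tangent fields, `[X, Y] = X(Y) - Y(X) + [X, Y]_𝔪` in components, is tangent,
and acts on functions as the commutator of `X` and `Y`. -/
theorem exists_comp_eq_bracket {κ : ℝ} (hu : IsBasisA2 κ u) {X Y : N → Vec}
    (hX : IsTangentField u F X) (hY : IsTangentField u F Y) (p : N) :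
    ∃ v : TangentSpace (𝓡 3) p,
      comp u F p v = (fun k => derivAlong u F X (fun q => Y q k) p
        - derivAlong u F Y (fun q => X q k) p) + bracket0 κ (X p) (Y p) ∧
      ∀ f : N → ℝ, ContMDiff (𝓡 3) 𝓘(ℝ, ℝ) ∞ f →
        derivAlong u F X (derivAlong u F Y f) p - derivAlong u F Y (derivAlong u F X f) p =
          mfderiv (𝓡 3) 𝓘(ℝ, ℝ) f p v := by
  obtain ⟨x, hxs, hx⟩ := exists_local_field hF hF' hX p
  obtain ⟨y, hys, hy⟩ := exists_local_field hF hF' hY p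
  set σ := (extChartAt (𝓡 3) p).symm with hσ
  set a₀ := extChartAt (𝓡 3) p p with ha₀
  set A := localForm u F p with hA
  have ha : a₀ ∈ (extChartAt (𝓡 3) p).target := mem_extChartAt_target p
  have hσa : σ a₀ = p := extChartAt_to_inv p
  have hxd : DifferentiableAt ℝ x a₀ := hxs.differentiableAt (by simp)
  have hyd : DifferentiableAt ℝ y a₀ := hys.differentiableAt (by simp)
  -- derivatives along `X` and `Y` at `p` of smooth functions, computed in the chart
  have hdX : ∀ f : N → ℝ, ContMDiff (𝓡 3) 𝓘(ℝ, ℝ) ∞ f → ∀ a ∈ (extChartAt (𝓡 3) p).target,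
      derivAlong u F X f (σ a) = fderiv ℝ (fun b => f (σ b)) a (x a) := fun f hf a h =>
    derivAlong_eq_fderiv hF hF' hf h (hx a h)
  have hdY : ∀ f : N → ℝ, ContMDiff (𝓡 3) 𝓘(ℝ, ℝ) ∞ f → ∀ a ∈ (extChartAt (𝓡 3) p).target,
      derivAlong u F Y f (σ a) = fderiv ℝ (fun b => f (σ b)) a (y a) := fun f hf a h =>
    derivAlong_eq_fderiv hF hF' hf h (hy a h)
  have hnhds := (isOpen_extChartAt_target (I := 𝓡 3) p).mem_nhds ha
  have hAd : DifferentiableAt ℝ A a₀ := (contDiffAt_localForm u hF ha).differentiableAt (by simp)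
  -- the derivative of a component `b ↦ (A b (z b)) k`
  have hcomp : ∀ (Z : N → Vec) (z : EuclideanSpace ℝ (Fin 3) → EuclideanSpace ℝ (Fin 3)),
      DifferentiableAt ℝ z a₀ →
      (∀ a ∈ (extChartAt (𝓡 3) p).target, A a (z a) = Z (σ a)) → ∀ k v,
      fderiv ℝ (fun b => Z (σ b) k) a₀ v =
        (fderiv ℝ A a₀ v (z a₀) + A a₀ (fderiv ℝ z a₀ v)) k := by
    intro Z z hz hZ k v
    have h1 : (fun b => Z (σ b) k) =ᶠ[𝓝 a₀] fun b => A b (z b) k := by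
      filter_upwards [hnhds] with a h
      rw [hZ a h]
    rw [h1.fderiv_eq]
    have h2 := (hasFDerivAt_pi'.1 (hAd.hasFDerivAt.clm_apply hz.hasFDerivAt)) k
    rw [h2.fderiv]
    simp [add_comm]
  refine ⟨fderiv ℝ y a₀ (x a₀) - fderiv ℝ x a₀ (y a₀), ?_, ?_⟩
  · rw [comp_eq_localForm hF, map_sub]
    have hMC := maurerCartan_localForm u hu hF p (x a₀) (y a₀)
    funext k
    have hXp : X p = A a₀ (x a₀) := by rw [hx a₀ ha, hσa]
    have hYp : Y p = A a₀ (y a₀) := by rw [hy a₀ ha, hσa]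
    have h1 := hdX (fun q => Y q k) (hY.1 k) a₀ ha
    have h2 := hdY (fun q => X q k) (hX.1 k) a₀ ha
    rw [hσa, hcomp Y y hyd hy] at h1
    rw [hσa, hcomp X x hxd hx] at h2
    have h3 := congrFun hMC k
    simp only [Pi.add_apply, Pi.sub_apply, Pi.neg_apply] at h1 h2 h3 ⊢
    rw [h1, h2, hXp, hYp]
    linarith
  · intro f hf
    have hfs : ContDiffAt ℝ ∞ (fun b => f (σ b)) a₀ := contDiffAt_comp_extChartAt_symm hf ha
    have hfd : DifferentiableAt ℝ (fderiv ℝ (fun b => f (σ b))) a₀ :=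
      (hfs.fderiv_right (m := ∞) (by simp)).differentiableAt (by simp)
    have h1 := hdX _ (contMDiff_derivAlong hF hF' hY hf) a₀ ha
    have h2 := hdY _ (contMDiff_derivAlong hF hF' hX hf) a₀ ha
    have e1 : (fun b => derivAlong u F Y f (σ b)) =ᶠ[𝓝 a₀]
        fun b => fderiv ℝ (fun b => f (σ b)) b (y b) := by
      filter_upwards [hnhds] with a h using hdY f hf a h
    have e2 : (fun b => derivAlong u F X f (σ b)) =ᶠ[𝓝 a₀]
        fun b => fderiv ℝ (fun b => f (σ b)) b (x b) := by
      filter_upwards [hnhds] with a h using hdX f hf a h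
    rw [e1.fderiv_eq, (hfd.hasFDerivAt.clm_apply hyd.hasFDerivAt).fderiv, hσa] at h1
    rw [e2.fderiv_eq, (hfd.hasFDerivAt.clm_apply hxd.hasFDerivAt).fderiv, hσa] at h2
    have hsymm := ((hfs.of_le (m := 2) (WithTop.coe_le_coe.2
      (le_top (a := (2 : ℕ∞))))).isSymmSndFDerivAt (by simp)) (x a₀) (y a₀)
    rw [← fderiv_comp_extChartAt_symm_self hf, map_sub, h1, h2]
    simp only [add_apply, ContinuousLinearMap.comp_apply,
      ContinuousLinearMap.flip_apply, hsymm]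
    ring

end Calculus

end Derivations

/-! ### Connection and curvature on the Lie algebra -/

section Algebra

theorem inner0_comm (d : ℝ) (x y : Vec) : inner0 d x y = inner0 d y x := by
  simp only [inner0]; ring

theorem inner0_add_left (d : ℝ) (x y z : Vec) :
    inner0 d (x + y) z = inner0 d x z + inner0 d y z := by
  simp only [inner0, Pi.add_apply]; ring

theorem inner0_sub_left (d : ℝ) (x y z : Vec) :
    inner0 d (x - y) z = inner0 d x z - inner0 d y z := by
  simp only [inner0, Pi.sub_apply]; ring

theorem inner0_neg_left (d : ℝ) (x z : Vec) : inner0 d (-x) z = -inner0 d x z := by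
  simp only [inner0, Pi.neg_apply]; ring

theorem inner0_smul_left (d a : ℝ) (x z : Vec) : inner0 d (a • x) z = a * inner0 d x z := by
  simp only [inner0, Pi.smul_apply, smul_eq_mul]; ring

theorem inner0_sub_right (d : ℝ) (x y z : Vec) :
    inner0 d x (y - z) = inner0 d x y - inner0 d x z := by
  simp only [inner0, Pi.sub_apply]; ring

theorem inner0_smul_right (d a : ℝ) (x z : Vec) : inner0 d x (a • z) = a * inner0 d x z := by
  simp only [inner0, Pi.smul_apply, smul_eq_mul]; ring

/-- The endomorphisms `lam κ d x` are skew-adjoint: the connection is metric. -/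
theorem inner0_lam_skew (κ : ℝ) {d : ℝ} (hd : d ≠ 0) (x y z : Vec) :
    inner0 d (lam κ d x y) z + inner0 d y (lam κ d x z) = 0 := by
  simp only [inner0, lam, Matrix.cons_val]
  field_simp
  ring

/-- The connection is torsion-free. -/
theorem lam_sub_lam (κ d : ℝ) (x y : Vec) : lam κ d x y - lam κ d y x = bracket0 κ x y := by
  ext k
  fin_cases k <;> simp [lam, bracket0] <;> ring

theorem lam_add_left (κ d : ℝ) (x y z : Vec) :
    lam κ d (x + y) z = lam κ d x z + lam κ d y z := by
  ext k
  fin_cases k <;> simp [lam] <;> ring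

theorem lam_smul_left (κ d a : ℝ) (x z : Vec) : lam κ d (a • x) z = a • lam κ d x z := by
  ext k
  fin_cases k <;> simp [lam] <;> ring

theorem lam_add_right (κ d : ℝ) (x y z : Vec) :
    lam κ d x (y + z) = lam κ d x y + lam κ d x z := by
  ext k
  fin_cases k <;> simp [lam] <;> ring

theorem lam_sub_left (κ d : ℝ) (x y z : Vec) :
    lam κ d (x - y) z = lam κ d x z - lam κ d y z := by
  ext k
  fin_cases k <;> simp [lam] <;> ring

/-- The curvature operator `R(x, y) z = λ(x) λ(y) z - λ(y) λ(x) z - λ([x, y]) z`. -/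
noncomputable def curv (κ d : ℝ) (x y z : Vec) : Vec :=
  lam κ d x (lam κ d y z) - lam κ d y (lam κ d x z) - lam κ d (bracket0 κ x y) z

/-- The curvature is that of constant sectional curvature `-κ² / d` plus two terms of rank one, of
which at least one is present, since `κ` and `1 - κ` are not both zero. -/
theorem inner0_curv (κ : ℝ) {d : ℝ} (hd : d ≠ 0) (x y z w : Vec) :
    inner0 d (curv κ d x y z) w =
      -κ ^ 2 / d * (inner0 d y z * inner0 d x w - inner0 d x z * inner0 d y w) +
      κ / d * (x 1 * y 2 - x 2 * y 1) * (z 2 * w 1 - z 1 * w 2) +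
      2 * (1 - κ) * (x 2 * y 3 - x 3 * y 2) * (z 2 * w 3 - z 3 * w 2) := by
  simp only [curv, inner0, lam, bracket0, Matrix.cons_val, Pi.sub_apply]
  field_simp
  ring

end Algebra

section Hypersurfaces

open Filter Topology

variable {G : Type*} [TopologicalSpace G] [ChartedSpace (EuclideanSpace ℝ (Fin 4)) G] [Group G]
  {N : Type*} [TopologicalSpace N] [ChartedSpace (EuclideanSpace ℝ (Fin 3)) N]

/-- An immersed hypersurface `F` with unit normal `ξ` in the Lie group `G`. -/
structure IsHypersurface (κ d ε : ℝ) (u : Module.Basis (Fin 4) ℝ (GroupLieAlgebra (𝓡 4) G))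
    (F : N → G) (ξ : N → Vec) : Prop where
  ne_zero : d ≠ 0
  sign : ε = 1 ∨ ε = -1
  basis : IsBasisA2 κ u
  smooth : ContMDiff (𝓡 3) (𝓡 4) ∞ F
  injective : ∀ p, Function.Injective (mfderiv (𝓡 3) (𝓡 4) F p)
  normal : IsUnitNormal u F d ε ξ

/-- Smooth real functions on `N`. -/
def Sm (f : N → ℝ) : Prop := ContMDiff (𝓡 3) 𝓘(ℝ, ℝ) ∞ f

/-- Vector fields along `N` (not necessarily tangent) with smooth components. -/
def SmV (Y : N → Vec) : Prop := ∀ k, Sm fun p => Y p k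

/-- The derivative of `f` at `p` in the direction of the tangent vector with components `x`. -/
noncomputable def dirDeriv (u : Module.Basis (Fin 4) ℝ (GroupLieAlgebra (𝓡 4) G)) (F : N → G)
    (p : N) (x : Vec) (f : N → ℝ) : ℝ :=
  (mfderiv (𝓡 3) 𝓘(ℝ, ℝ) f p (tangentVec u F p x) : ℝ)

/-- The covariant derivative at `p` of `Y` in the direction of `x`. -/
noncomputable def nablaAt (κ d : ℝ) (u : Module.Basis (Fin 4) ℝ (GroupLieAlgebra (𝓡 4) G))
    (F : N → G) (p : N) (x : Vec) (Y : N → Vec) : Vec :=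
  (fun k => dirDeriv u F p x fun q => Y q k) + lam κ d x (Y p)

/-- The second fundamental form at `p`. -/
noncomputable def hAt (κ d : ℝ) (u : Module.Basis (Fin 4) ℝ (GroupLieAlgebra (𝓡 4) G))
    (F : N → G) (ξ : N → Vec) (p : N) (x y : Vec) : ℝ :=
  -inner0 d (nablaAt κ d u F p x ξ) y

theorem Sm.add {f g : N → ℝ} (hf : Sm f) (hg : Sm g) : Sm fun p => f p + g p :=
  ContMDiff.add hf hg

theorem Sm.sub {f g : N → ℝ} (hf : Sm f) (hg : Sm g) : Sm fun p => f p - g p :=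
  ContMDiff.sub hf hg

theorem Sm.mul {f g : N → ℝ} (hf : Sm f) (hg : Sm g) : Sm fun p => f p * g p :=
  ContMDiff.mul hf hg

theorem Sm.const (c : ℝ) : Sm fun _ : N => c := contMDiff_const

theorem Sm.neg {f : N → ℝ} (hf : Sm f) : Sm fun p => -f p := by
  simpa using (Sm.const (-1)).mul hf

theorem Sm.inner0 {Y Z : N → Vec} (d : ℝ) (hY : SmV Y) (hZ : SmV Z) :
    Sm fun p => inner0 d (Y p) (Z p) :=
  (((((hY 0).mul (hZ 2)).add ((hY 2).mul (hZ 0))).neg.add ((hY 1).mul (hZ 1))).add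
    ((hY 2).mul (hZ 2))).add ((Sm.const d).mul ((hY 3).mul (hZ 3)))

theorem SmV.lam {Y Z : N → Vec} (κ d : ℝ) (hY : SmV Y) (hZ : SmV Z) :
    SmV fun p => lam κ d (Y p) (Z p) := by
  intro k
  have hc := fun c => Sm.const (N := N) c
  fin_cases k
  · exact ((((hc κ).mul ((hY 0).mul (hZ 3))).add ((hY 2).mul (hZ 3))).sub ((hY 3).mul (hZ 0))).add
      ((hY 3).mul (hZ 2))
  · exact (hc κ).mul ((hY 1).mul (hZ 3))
  · exact ((hc κ).mul ((hY 2).mul (hZ 3))).add ((hY 3).mul (hZ 2))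
  · have h := (((((hc κ).mul ((hY 0).mul (hZ 2))).sub ((hc κ).mul ((hY 1).mul (hZ 1)))).add
      ((hc κ).mul ((hY 2).mul (hZ 0)))).sub ((hc (κ - 1)).mul ((hY 2).mul (hZ 2)))).mul (hc d⁻¹)
    simp only [← div_eq_mul_inv] at h
    exact h

variable [IsManifold (𝓡 3) ∞ N]
  {κ d ε : ℝ} {u : Module.Basis (Fin 4) ℝ (GroupLieAlgebra (𝓡 4) G)} {F : N → G} {ξ : N → Vec}

theorem dirDeriv_eq_fderiv (p : N) (x : Vec) {f : N → ℝ} (hf : Sm f) :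
    dirDeriv u F p x f = fderiv ℝ (fun b => f ((extChartAt (𝓡 3) p).symm b))
      (extChartAt (𝓡 3) p p) (tangentVec u F p x) :=
  (fderiv_comp_extChartAt_symm_self hf p _).symm

theorem Sm.differentiableAt {f : N → ℝ} (hf : Sm f) (p : N) :
    DifferentiableAt ℝ (fun b => f ((extChartAt (𝓡 3) p).symm b)) (extChartAt (𝓡 3) p p) :=
  (contDiffAt_comp_extChartAt_symm hf (mem_extChartAt_target p)).differentiableAt (by simp)

theorem dirDeriv_const (p : N) (x : Vec) (c : ℝ) : dirDeriv u F p x (fun _ => c) = 0 := by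
  rw [dirDeriv_eq_fderiv p x (Sm.const c), fderiv_fun_const]
  rfl

theorem dirDeriv_add (p : N) (x : Vec) {f g : N → ℝ} (hf : Sm f) (hg : Sm g) :
    dirDeriv u F p x (fun q => f q + g q) = dirDeriv u F p x f + dirDeriv u F p x g := by
  rw [dirDeriv_eq_fderiv p x (hf.add hg), dirDeriv_eq_fderiv p x hf, dirDeriv_eq_fderiv p x hg]
  erw [fderiv_fun_add (hf.differentiableAt p) (hg.differentiableAt p)]
  rfl

theorem dirDeriv_mul (p : N) (x : Vec) {f g : N → ℝ} (hf : Sm f) (hg : Sm g) :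
    dirDeriv u F p x (fun q => f q * g q) =
      dirDeriv u F p x f * g p + f p * dirDeriv u F p x g := by
  rw [dirDeriv_eq_fderiv p x (hf.mul hg), dirDeriv_eq_fderiv p x hf, dirDeriv_eq_fderiv p x hg]
  have h := (hf.differentiableAt p).hasFDerivAt.mul (hg.differentiableAt p).hasFDerivAt
  have h' := congrArg (fun L : EuclideanSpace ℝ (Fin 3) →L[ℝ] ℝ => L (tangentVec u F p x)) h.fderiv
  refine h'.trans ?_
  simp only [extChartAt_to_inv]
  exact (add_comm _ _).trans (congrArg₂ _ (mul_comm _ _) rfl)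

theorem dirDeriv_const_mul (p : N) (x : Vec) (c : ℝ) {f : N → ℝ} (hf : Sm f) :
    dirDeriv u F p x (fun q => c * f q) = c * dirDeriv u F p x f := by
  rw [dirDeriv_mul p x (Sm.const c) hf, dirDeriv_const]; ring

theorem dirDeriv_neg (p : N) (x : Vec) {f : N → ℝ} (hf : Sm f) :
    dirDeriv u F p x (fun q => -f q) = -dirDeriv u F p x f := by
  have h := dirDeriv_const_mul (u := u) (F := F) p x (-1) hf
  simpa using h

theorem dirDeriv_sub (p : N) (x : Vec) {f g : N → ℝ} (hf : Sm f) (hg : Sm g) :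
    dirDeriv u F p x (fun q => f q - g q) = dirDeriv u F p x f - dirDeriv u F p x g := by
  have h := dirDeriv_add (u := u) (F := F) p x hf hg.neg
  rw [dirDeriv_neg p x hg] at h
  simpa only [sub_eq_add_neg] using h

/-- The connection is compatible with the metric. -/
theorem dirDeriv_inner0 (κ : ℝ) (hd : d ≠ 0) (p : N) (x : Vec) {Y Z : N → Vec} (hY : SmV Y)
    (hZ : SmV Z) :
    dirDeriv u F p x (fun q => inner0 d (Y q) (Z q)) =
      inner0 d (nablaAt κ d u F p x Y) (Z p) + inner0 d (Y p) (nablaAt κ d u F p x Z) := by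
  have h := inner0_lam_skew κ hd x (Y p) (Z p)
  have h1 : dirDeriv u F p x (fun q => inner0 d (Y q) (Z q)) =
      inner0 d (fun k => dirDeriv u F p x fun q => Y q k) (Z p) +
        inner0 d (Y p) (fun k => dirDeriv u F p x fun q => Z q k) := by
    unfold A2.inner0
    have e := fun i j => (hY i).mul (hZ j)
    rw [dirDeriv_add p x ((((e 0 2).add (e 2 0)).neg.add (e 1 1)).add (e 2 2))
        ((Sm.const d).mul (e 3 3)),
      dirDeriv_add p x (((e 0 2).add (e 2 0)).neg.add (e 1 1)) (e 2 2),
      dirDeriv_add p x ((e 0 2).add (e 2 0)).neg (e 1 1), dirDeriv_neg p x ((e 0 2).add (e 2 0)),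
      dirDeriv_add p x (e 0 2) (e 2 0), dirDeriv_const_mul p x d (e 3 3),
      dirDeriv_mul p x (hY 0) (hZ 2), dirDeriv_mul p x (hY 2) (hZ 0),
      dirDeriv_mul p x (hY 1) (hZ 1), dirDeriv_mul p x (hY 2) (hZ 2),
      dirDeriv_mul p x (hY 3) (hZ 3)]
    ring
  rw [h1, nablaAt, nablaAt, inner0_add_left, inner0_comm d (Y p) (_ + _), inner0_add_left,
    inner0_comm d (lam κ d x (Z p)), inner0_comm d _ (Y p)]
  linarith

theorem dirDeriv_lam (κ d : ℝ) (p : N) (x : Vec) {Y Z : N → Vec} (hY : SmV Y) (hZ : SmV Z) :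
    (fun k => dirDeriv u F p x fun q => lam κ d (Y q) (Z q) k) =
      lam κ d (fun k => dirDeriv u F p x fun q => Y q k) (Z p) +
        lam κ d (Y p) (fun k => dirDeriv u F p x fun q => Z q k) := by
  have e := fun i j => (hY i).mul (hZ j)
  have hc := fun c => Sm.const (N := N) c
  have hm := fun i j => dirDeriv_mul (u := u) (F := F) p x (hY i) (hZ j)
  have hcm := fun c i j => dirDeriv_const_mul (u := u) (F := F) p x c (e i j)
  funext k
  fin_cases k
  · simp only [lam, Pi.add_apply, Fin.zero_eta, Matrix.cons_val]
    rw [dirDeriv_add p x ((((hc κ).mul (e 0 3)).add (e 2 3)).sub (e 3 0)) (e 3 2),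
      dirDeriv_sub p x (((hc κ).mul (e 0 3)).add (e 2 3)) (e 3 0),
      dirDeriv_add p x ((hc κ).mul (e 0 3)) (e 2 3), hcm, hm, hm, hm, hm]
    ring
  · simp only [lam, Pi.add_apply, Fin.mk_one, Matrix.cons_val]
    rw [hcm, hm]
    ring
  · simp only [lam, Pi.add_apply, Fin.reduceFinMk, Matrix.cons_val]
    rw [dirDeriv_add p x ((hc κ).mul (e 2 3)) (e 3 2), hcm, hm, hm]
    ring
  · simp only [lam, Pi.add_apply, Fin.reduceFinMk, Matrix.cons_val, div_eq_inv_mul]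
    rw [dirDeriv_const_mul p x d⁻¹ (((((hc κ).mul (e 0 2)).sub ((hc κ).mul (e 1 1))).add
        ((hc κ).mul (e 2 0))).sub ((hc (κ - 1)).mul (e 2 2))),
      dirDeriv_sub p x ((((hc κ).mul (e 0 2)).sub ((hc κ).mul (e 1 1))).add
        ((hc κ).mul (e 2 0))) ((hc (κ - 1)).mul (e 2 2)),
      dirDeriv_add p x (((hc κ).mul (e 0 2)).sub ((hc κ).mul (e 1 1))) ((hc κ).mul (e 2 0)),
      dirDeriv_sub p x ((hc κ).mul (e 0 2)) ((hc κ).mul (e 1 1)), hcm, hcm, hcm, hcm, hm, hm, hm,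
      hm]
    ring

end Hypersurfaces

/-! ### The equations of a hypersurface -/

section Tangent

open Filter Topology

variable {G : Type*} [TopologicalSpace G] [ChartedSpace (EuclideanSpace ℝ (Fin 4)) G] [Group G]
  {N : Type*} [TopologicalSpace N] [ChartedSpace (EuclideanSpace ℝ (Fin 3)) N]
  {κ d ε : ℝ} {u : Module.Basis (Fin 4) ℝ (GroupLieAlgebra (𝓡 4) G)} {F : N → G} {ξ : N → Vec}

/-- The components of the Lie bracket of two tangent fields. -/
noncomputable def bracket (κ : ℝ) (u : Module.Basis (Fin 4) ℝ (GroupLieAlgebra (𝓡 4) G))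
    (F : N → G) (X Y : N → Vec) (p : N) : Vec :=
  (fun k => derivAlong u F X (fun q => Y q k) p - derivAlong u F Y (fun q => X q k) p)
    + bracket0 κ (X p) (Y p)

/-- The connection is torsion-free. -/
theorem nabla_sub_nabla (X Y : N → Vec) (p : N) :
    nabla u F κ d X Y p - nabla u F κ d Y X p = bracket κ u F X Y p := by
  rw [bracket, ← lam_sub_lam κ d]
  ext k
  simp only [nabla, Pi.add_apply, Pi.sub_apply]
  ring

namespace IsHypersurface

theorem sq_sign (H : IsHypersurface κ d ε u F ξ) : ε * ε = 1 := by
  rcases H.sign with h | h <;> simp [h]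

theorem smV (H : IsHypersurface κ d ε u F ξ) : SmV ξ := H.normal.smooth

theorem secondForm_eq_hAt (X Y : N → Vec) (p : N) :
    secondForm u F κ d ξ X Y p = hAt κ d u F ξ p (X p) (Y p) :=
  inner0_neg_left _ _ _

theorem inner0_nablaInduced (H : IsHypersurface κ d ε u F ξ) (X Y : N → Vec) (p : N) :
    inner0 d (nablaInduced u F κ d ξ X Y p) (ξ p) = 0 := by
  have h0 : inner0 d (ξ p) (ξ p) ≠ 0 := by
    rw [H.normal.unit p]; rintro rfl; simpa using H.sq_sign
  rw [nablaInduced, inner0_sub_left, inner0_smul_left, div_mul_cancel₀ _ h0, sub_self]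

theorem nablaInduced_eq (H : IsHypersurface κ d ε u F ξ) (X Y : N → Vec) (p : N) :
    nablaInduced u F κ d ξ X Y p =
      nabla u F κ d X Y p - (ε * inner0 d (nabla u F κ d X Y p) (ξ p)) • ξ p := by
  rw [nablaInduced, H.normal.unit p]
  congr 2
  have h0 : ε ≠ 0 := by rintro rfl; simpa using H.sq_sign
  rw [div_eq_iff h0]
  linear_combination (-inner0 d (nabla u F κ d X Y p) (ξ p)) * H.sq_sign

variable [IsManifold (𝓡 3) ∞ N]

theorem inner0_nablaAt_normal (H : IsHypersurface κ d ε u F ξ) (p : N) (x : Vec) :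
    inner0 d (nablaAt κ d u F p x ξ) (ξ p) = 0 := by
  have h := dirDeriv_inner0 (u := u) (F := F) κ H.ne_zero p x H.smV H.smV
  have h1 : (fun q => inner0 d (ξ q) (ξ q)) = fun _ => ε := funext H.normal.unit
  rw [h1, dirDeriv_const, inner0_comm d (ξ p)] at h
  linarith

variable [LieGroup (𝓡 4) ∞ G]

/-- By a count of dimensions, the tangent vectors are exactly those orthogonal to the normal. -/
theorem exists_comp_eq_iff (H : IsHypersurface κ d ε u F ξ) (p : N) (x : Vec) :
    (∃ v, comp u F p v = x) ↔ inner0 d x (ξ p) = 0 := by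
  refine ⟨by rintro ⟨v, rfl⟩; exact H.normal.normal p v, fun hx => ?_⟩
  let A : EuclideanSpace ℝ (Fin 3) →ₗ[ℝ] Vec := localForm u F p (extChartAt (𝓡 3) p p)
  let ν : Vec →ₗ[ℝ] ℝ :=
    { toFun := fun x => inner0 d x (ξ p)
      map_add' := fun x y => inner0_add_left d x y _
      map_smul' := fun a x => inner0_smul_left d a x _ }
  have hinj : Function.Injective A :=
    localForm_injective H.smooth H.injective (mem_extChartAt_target p)
  have hle : LinearMap.range A ≤ LinearMap.ker ν := by
    rintro _ ⟨v, rfl⟩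
    have h := H.normal.normal p v
    rw [comp_eq_localForm H.smooth] at h
    exact h
  have hν : ν (ξ p) ≠ 0 := by
    have h := H.normal.unit p
    have h1 : ν (ξ p) = ε := h
    rw [h1]
    rintro rfl
    simpa using H.sq_sign
  have hsurj : LinearMap.range ν = ⊤ := by
    rw [LinearMap.range_eq_top]
    intro c
    exact ⟨(c / ν (ξ p)) • ξ p, by rw [map_smul, smul_eq_mul, div_mul_cancel₀ _ hν]⟩
  -- both the image of `dF` and the orthogonal complement of `ξ` have dimension `3`
  have hdim : Module.finrank ℝ (LinearMap.range A) = Module.finrank ℝ (LinearMap.ker ν) := by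
    have h1 := LinearMap.finrank_range_add_finrank_ker ν
    rw [hsurj, finrank_top] at h1
    rw [LinearMap.finrank_range_of_inj hinj]
    simp only [Module.finrank_self, Module.finrank_fin_fun] at h1
    rw [finrank_euclideanSpace_fin]
    omega
  have hmem : x ∈ LinearMap.range A := by
    rw [Submodule.eq_of_le_of_finrank_eq hle hdim]
    exact hx
  obtain ⟨v, hv⟩ := hmem
  refine ⟨v, ?_⟩
  rw [comp_eq_localForm H.smooth]
  exact hv

theorem isTangentField_iff (H : IsHypersurface κ d ε u F ξ) {X : N → Vec} :
    IsTangentField u F X ↔ SmV X ∧ ∀ p, inner0 d (X p) (ξ p) = 0 :=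
  and_congr Iff.rfl (forall_congr' fun p => H.exists_comp_eq_iff p (X p))

/-- Every tangent vector extends to a global tangent field: the tangential part of the
left-invariant field it generates. -/
theorem exists_extension (H : IsHypersurface κ d ε u F ξ) {p : N} {x : Vec}
    (hx : inner0 d x (ξ p) = 0) : ∃ X, IsTangentField u F X ∧ X p = x := by
  refine ⟨fun q => x - (ε * inner0 d x (ξ q)) • ξ q, H.isTangentField_iff.2 ⟨fun k => ?_,
    fun q => ?_⟩, by simp [hx]⟩
  · exact (Sm.const _).sub (((Sm.const ε).mul (Sm.inner0 (Y := fun _ => x) d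
      (fun k => Sm.const (x k)) H.smV)).mul
      (H.smV k))
  · rw [inner0_sub_left, inner0_smul_left, H.normal.unit q]
    linear_combination (-inner0 d x (ξ q)) * H.sq_sign

/-- `tangentVec` is linear on the components of tangent vectors. -/
theorem tangentVec_add_smul (H : IsHypersurface κ d ε u F ξ) {p : N} {x y : Vec} (a b : ℝ)
    (hx : inner0 d x (ξ p) = 0) (hy : inner0 d y (ξ p) = 0) :
    tangentVec u F p (a • x + b • y) = a • tangentVec u F p x + b • tangentVec u F p y := by
  obtain ⟨v, rfl⟩ := (H.exists_comp_eq_iff p x).2 hx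
  obtain ⟨w, rfl⟩ := (H.exists_comp_eq_iff p y).2 hy
  have hlin : a • comp u F p v + b • comp u F p w = comp u F p (a • v + b • w) := by
    refine Eq.trans (congrArg₂ (fun s t => a • s + b • t) (comp_eq_localForm H.smooth p v)
      (comp_eq_localForm H.smooth p w))
      (Eq.trans ?_ (comp_eq_localForm H.smooth p (a • v + b • w)).symm)
    exact (((localForm u F p (extChartAt (𝓡 3) p p)).map_add _ _).trans (congrArg₂ _
      ((localForm u F p (extChartAt (𝓡 3) p p)).map_smul _ _)
      ((localForm u F p (extChartAt (𝓡 3) p p)).map_smul _ _))).symm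
  have hinv := Function.leftInverse_invFun (comp_injective (u := u) H.injective p)
  unfold tangentVec
  rw [hlin, hinv, hinv, hinv]

theorem dirDeriv_comb (H : IsHypersurface κ d ε u F ξ) {p : N} {x y : Vec} (a b : ℝ)
    (hx : inner0 d x (ξ p) = 0) (hy : inner0 d y (ξ p) = 0) (f : N → ℝ) :
    dirDeriv u F p (a • x + b • y) f = a * dirDeriv u F p x f + b * dirDeriv u F p y f := by
  unfold dirDeriv
  rw [H.tangentVec_add_smul a b hx hy]
  exact ((mfderiv (𝓡 3) 𝓘(ℝ, ℝ) f p).map_add _ _).trans (congrArg₂ _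
    ((mfderiv (𝓡 3) 𝓘(ℝ, ℝ) f p).map_smul _ _) ((mfderiv (𝓡 3) 𝓘(ℝ, ℝ) f p).map_smul _ _))

theorem sm_derivAlong (H : IsHypersurface κ d ε u F ξ) {X : N → Vec} (hX : IsTangentField u F X)
    {f : N → ℝ} (hf : Sm f) : Sm (derivAlong u F X f) :=
  contMDiff_derivAlong H.smooth H.injective hX hf

theorem smV_nabla (H : IsHypersurface κ d ε u F ξ) {X Y : N → Vec} (hX : IsTangentField u F X)
    (hY : SmV Y) : SmV (nabla u F κ d X Y) := fun k =>
  (H.sm_derivAlong hX (hY k)).add (SmV.lam κ d hX.1 hY k)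

theorem inner0_bracket (H : IsHypersurface κ d ε u F ξ) {X Y : N → Vec}
    (hX : IsTangentField u F X) (hY : IsTangentField u F Y) (p : N) :
    inner0 d (bracket κ u F X Y p) (ξ p) = 0 := by
  obtain ⟨v, hv, -⟩ := exists_comp_eq_bracket H.smooth H.injective H.basis hX hY p
  exact (H.exists_comp_eq_iff p _).1 ⟨v, hv⟩

theorem derivAlong_commutator (H : IsHypersurface κ d ε u F ξ) {X Y : N → Vec}
    (hX : IsTangentField u F X) (hY : IsTangentField u F Y) {f : N → ℝ} (hf : Sm f) (p : N) :
    derivAlong u F X (derivAlong u F Y f) p - derivAlong u F Y (derivAlong u F X f) p =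
      dirDeriv u F p (bracket κ u F X Y p) f := by
  obtain ⟨v, hv, h⟩ := exists_comp_eq_bracket H.smooth H.injective H.basis hX hY p
  rw [h f hf]
  unfold dirDeriv tangentVec
  rw [bracket, ← hv, Function.leftInverse_invFun (comp_injective H.injective p) v]

/-- Differentiating `⟨Y, ξ⟩ = 0`. -/
theorem hAt_eq_inner0 (H : IsHypersurface κ d ε u F ξ) {p : N} {x : Vec} {Y : N → Vec}
    (hY : IsTangentField u F Y) :
    hAt κ d u F ξ p x (Y p) = inner0 d (nablaAt κ d u F p x Y) (ξ p) := by
  have h := dirDeriv_inner0 (u := u) (F := F) κ H.ne_zero p x hY.1 H.smV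
  have h1 : (fun q => inner0 d (Y q) (ξ q)) = fun _ => 0 :=
    funext (H.isTangentField_iff.1 hY).2
  rw [h1, dirDeriv_const, inner0_comm d (Y p)] at h
  unfold hAt
  linarith

/-- The second fundamental form is symmetric because the bracket of two tangent fields is
tangent. -/
theorem hAt_symm (H : IsHypersurface κ d ε u F ξ) {p : N} {x y : Vec}
    (hx : inner0 d x (ξ p) = 0) (hy : inner0 d y (ξ p) = 0) :
    hAt κ d u F ξ p x y = hAt κ d u F ξ p y x := by
  obtain ⟨X, hX, rfl⟩ := H.exists_extension hx
  obtain ⟨Y, hY, rfl⟩ := H.exists_extension hy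
  rw [H.hAt_eq_inner0 hX, H.hAt_eq_inner0 hY, ← sub_eq_zero, ← inner0_sub_left]
  exact (congrArg (inner0 d · (ξ p)) (nabla_sub_nabla X Y p)).trans (H.inner0_bracket hX hY p)

theorem hAt_comb_left (H : IsHypersurface κ d ε u F ξ) {p : N} {x y : Vec} (a b : ℝ) (z : Vec)
    (hx : inner0 d x (ξ p) = 0) (hy : inner0 d y (ξ p) = 0) :
    hAt κ d u F ξ p (a • x + b • y) z = a * hAt κ d u F ξ p x z + b * hAt κ d u F ξ p y z := by
  unfold hAt nablaAt
  simp only [H.dirDeriv_comb a b hx hy, inner0, lam_add_left, lam_smul_left, Pi.add_apply,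
    Pi.smul_apply, smul_eq_mul]
  ring

/-- The covariant derivative of `h` in terms of second covariant derivatives of `ξ`. The tangency of
`∇_Y ξ` allows the induced connection on `Z` to be replaced by the ambient one. -/
theorem nablaSecondForm_eq (H : IsHypersurface κ d ε u F ξ) {X Y Z : N → Vec}
    (hY : IsTangentField u F Y) (hZ : IsTangentField u F Z) (p : N) :
    nablaSecondForm u F κ d ξ X Y Z p =
      -inner0 d (nabla u F κ d X (nabla u F κ d Y ξ) p) (Z p) -
        hAt κ d u F ξ p (nablaInduced u F κ d ξ X Y p) (Z p) := by
  have hW := H.smV_nabla hY H.smV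
  have h1 : derivAlong u F X (secondForm u F κ d ξ Y Z) p =
      -dirDeriv u F p (X p) (fun q => inner0 d (nabla u F κ d Y ξ q) (Z q)) := by
    rw [← dirDeriv_neg p (X p) (Sm.inner0 d hW hZ.1)]
    exact congrArg (fun f => derivAlong u F X f p) (funext fun q => inner0_neg_left _ _ _)
  have h2 : hAt κ d u F ξ p (Y p) (nablaInduced u F κ d ξ X Z p) =
      -inner0 d (nabla u F κ d Y ξ p) (nabla u F κ d X Z p) := by
    rw [H.nablaInduced_eq, hAt, inner0_sub_right, inner0_smul_right, H.inner0_nablaAt_normal,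
      mul_zero, sub_zero]
    rfl
  rw [nablaSecondForm, h1, secondForm_eq_hAt, secondForm_eq_hAt, h2,
    dirDeriv_inner0 κ H.ne_zero p (X p) hW hZ.1]
  change -(inner0 d (nabla u F κ d X (nabla u F κ d Y ξ) p) (Z p) +
    inner0 d (nabla u F κ d Y ξ p) (nabla u F κ d X Z p)) - _ - _ = _
  ring

/-- The commutator of covariant derivatives of the normal is given by the curvature. -/
theorem nabla_nabla_sub (H : IsHypersurface κ d ε u F ξ) {X Y : N → Vec}
    (hX : IsTangentField u F X) (hY : IsTangentField u F Y) (p : N) :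
    nabla u F κ d X (nabla u F κ d Y ξ) p - nabla u F κ d Y (nabla u F κ d X ξ) p =
      nablaAt κ d u F p (bracket κ u F X Y p) ξ + curv κ d (X p) (Y p) (ξ p) := by
  have key : ∀ {X Y : N → Vec}, IsTangentField u F Y →
      nabla u F κ d X (nabla u F κ d Y ξ) p =
        (fun k => derivAlong u F X (derivAlong u F Y fun q => ξ q k) p) +
        (lam κ d (fun k => derivAlong u F X (fun q => Y q k) p) (ξ p) +
          lam κ d (Y p) (fun k => derivAlong u F X (fun q => ξ q k) p)) +
        (lam κ d (X p) (fun k => derivAlong u F Y (fun q => ξ q k) p) +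
          lam κ d (X p) (lam κ d (Y p) (ξ p))) := by
    intro X Y hY
    have h2 := dirDeriv_lam (u := u) (F := F) κ d p (X p) hY.1 H.smV
    rw [← lam_add_right]
    refine congrArg₂ (· + ·) (Eq.trans (b :=
      (fun k => derivAlong u F X (derivAlong u F Y fun q => ξ q k) p) +
        fun k => dirDeriv u F p (X p) fun q => lam κ d (Y q) (ξ q) k) ?_ (congrArg _ h2)) rfl
    funext k
    exact dirDeriv_add p (X p) (H.sm_derivAlong hY (H.smV k)) (SmV.lam κ d hY.1 H.smV k)
  rw [key hY, key hX, nablaAt, curv]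
  have hc : (fun k => dirDeriv u F p (bracket κ u F X Y p) fun q => ξ q k) =
      (fun k => derivAlong u F X (derivAlong u F Y fun q => ξ q k) p) -
        fun k => derivAlong u F Y (derivAlong u F X fun q => ξ q k) p :=
    funext fun k => (H.derivAlong_commutator hX hY (H.smV k) p).symm
  have hb : lam κ d (bracket κ u F X Y p) (ξ p) =
      lam κ d (fun k => derivAlong u F X (fun q => Y q k) p) (ξ p) -
      lam κ d (fun k => derivAlong u F Y (fun q => X q k) p) (ξ p) +
      lam κ d (bracket0 κ (X p) (Y p)) (ξ p) := by
    rw [← lam_sub_left, ← lam_add_left]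
    rfl
  rw [hc, hb]
  abel

/-- The Codazzi equation. -/
theorem codazzi (H : IsHypersurface κ d ε u F ξ) {X Y Z : N → Vec}
    (hX : IsTangentField u F X) (hY : IsTangentField u F Y) (hZ : IsTangentField u F Z) (p : N) :
    nablaSecondForm u F κ d ξ X Y Z p - nablaSecondForm u F κ d ξ Y X Z p =
      -inner0 d (curv κ d (X p) (Y p) (ξ p)) (Z p) := by
  have hB : (1 : ℝ) • nablaInduced u F κ d ξ X Y p + (-1 : ℝ) • nablaInduced u F κ d ξ Y X p =
      bracket κ u F X Y p := by
    have h1 : inner0 d (nabla u F κ d X Y p) (ξ p) = inner0 d (nabla u F κ d Y X p) (ξ p) := by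
      rw [← sub_eq_zero, ← inner0_sub_left, nabla_sub_nabla, H.inner0_bracket hX hY]
    rw [H.nablaInduced_eq, H.nablaInduced_eq, h1, ← nabla_sub_nabla (d := d) X Y p]
    module
  have h2 := H.hAt_comb_left 1 (-1) (Z p) (H.inner0_nablaInduced X Y p)
    (H.inner0_nablaInduced Y X p)
  rw [hB] at h2
  have h3 := congrArg (inner0 d · (Z p)) (H.nabla_nabla_sub hX hY p)
  simp only [inner0_sub_left, inner0_add_left] at h3
  rw [H.nablaSecondForm_eq hY hZ, H.nablaSecondForm_eq hX hZ]
  unfold hAt at h2 ⊢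
  linarith

/-- The curvature maps pairs of tangent vectors of a parallel hypersurface to endomorphisms that
kill the normal. -/
theorem inner0_curv_eq_zero (H : IsHypersurface κ d ε u F ξ) (hpar : IsParallel u F κ d ξ) {p : N}
    {x y z : Vec} (hx : inner0 d x (ξ p) = 0) (hy : inner0 d y (ξ p) = 0)
    (hz : inner0 d z (ξ p) = 0) : inner0 d (curv κ d x y (ξ p)) z = 0 := by
  obtain ⟨X, hX, rfl⟩ := H.exists_extension hx
  obtain ⟨Y, hY, rfl⟩ := H.exists_extension hy
  obtain ⟨Z, hZ, rfl⟩ := H.exists_extension hz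
  have h := H.codazzi hX hY hZ p
  rw [hpar X Y Z hX hY hZ, hpar Y X Z hY hX hZ] at h
  linarith

end IsHypersurface

end Tangent

/-! ### Consequences of the curvature condition, and connectedness -/

section Cases

open Filter Topology

variable {G : Type*} [TopologicalSpace G] [ChartedSpace (EuclideanSpace ℝ (Fin 4)) G] [Group G]
  {N : Type*} [TopologicalSpace N] [ChartedSpace (EuclideanSpace ℝ (Fin 3)) N]
  {κ d ε : ℝ} {u : Module.Basis (Fin 4) ℝ (GroupLieAlgebra (𝓡 4) G)} {F : N → G} {ξ : N → Vec}

namespace IsHypersurface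

variable [IsManifold (𝓡 3) ∞ N]

/-- The second fundamental form when `γ = 0`, with the derivatives of the other components of `ξ`
kept as unknowns. -/
theorem hAt_apply (hd : d ≠ 0) (hγ : ∀ q, ξ q 2 = 0) (p : N) (x y : Vec) :
    hAt κ d u F ξ p x y =
      (dirDeriv u F p x (fun q => ξ q 0) + κ * x 0 * ξ p 3 + x 2 * ξ p 3 - x 3 * ξ p 0) * y 2
      + κ * x 2 * ξ p 3 * y 0 - (dirDeriv u F p x (fun q => ξ q 1) + κ * x 1 * ξ p 3) * y 1
      - κ * x 2 * ξ p 3 * y 2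
      - (d * dirDeriv u F p x (fun q => ξ q 3) - κ * x 1 * ξ p 1 + κ * x 2 * ξ p 0) * y 3 := by
  simp only [hAt, nablaAt, inner0, lam, Pi.add_apply, hγ, dirDeriv_const, Matrix.cons_val]
  field_simp
  ring

variable [LieGroup (𝓡 4) ∞ G]

/-- A smooth function with `df = k f θ⁴` vanishes identically on the connected manifold `N` if it
vanishes at a point: by Grönwall's inequality its zero set is open. -/
theorem eq_zero_of_dirDeriv_eq [ConnectedSpace N] (H : IsHypersurface κ d ε u F ξ) {f : N → ℝ}
    (hf : Sm f) (k : ℝ)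
    (hD : ∀ p x, inner0 d x (ξ p) = 0 → dirDeriv u F p x f = k * x 3 * f p) {p₀ : N}
    (h0 : f p₀ = 0) (p : N) : f p = 0 := by
  have hclosed : IsClosed {q | f q = 0} := isClosed_eq hf.continuous continuous_const
  have hopen : IsOpen {q | f q = 0} := by
    rw [isOpen_iff_mem_nhds]
    intro p hp
    set σ := (extChartAt (𝓡 3) p).symm with hσ
    set a₀ := extChartAt (𝓡 3) p p with ha₀
    set A := localForm u F p with hA
    have ha : a₀ ∈ (extChartAt (𝓡 3) p).target := mem_extChartAt_target p
    have hAc : ContinuousAt A a₀ := (contDiffAt_localForm u H.smooth ha).continuousAt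
    have hev : ∀ᶠ a in 𝓝 a₀, a ∈ (extChartAt (𝓡 3) p).target ∧ ‖A a‖ < ‖A a₀‖ + 1 :=
      ((isOpen_extChartAt_target p).eventually_mem ha).and
        (hAc.norm.eventually_lt_const (lt_add_one _))
    obtain ⟨r, hr, hball⟩ := Metric.eventually_nhds_iff_ball.1 hev
    -- along the segment from `a₀` to `b` the function satisfies a linear differential equation with
    -- bounded coefficient
    have hzero : ∀ b ∈ Metric.ball a₀ r, f (σ b) = 0 := by
      intro b hb
      set v := b - a₀ with hv
      have hmem : ∀ t ∈ Set.Icc (0 : ℝ) 1, a₀ + t • v ∈ Metric.ball a₀ r := by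
        intro t ht
        rw [mem_ball_iff_norm, add_sub_cancel_left, norm_smul, Real.norm_of_nonneg ht.1]
        rw [mem_ball_iff_norm] at hb
        exact (mul_le_of_le_one_left (norm_nonneg _) ht.2).trans_lt hb
      have hderiv : ∀ t ∈ Set.Icc (0 : ℝ) 1, HasDerivAt (fun t : ℝ => f (σ (a₀ + t • v)))
          (k * A (a₀ + t • v) v 3 * f (σ (a₀ + t • v))) t := by
        intro t ht
        have hta := (hball _ (hmem t ht)).1
        have h1 : HasDerivAt (fun t : ℝ => a₀ + t • v) v t := by
          simpa using ((hasDerivAt_id t).smul_const v).const_add a₀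
        have h2 := ((contDiffAt_comp_extChartAt_symm hf hta).differentiableAt
          (by simp)).hasFDerivAt.comp_hasDerivAt t h1
        have h3 := fderiv_comp_extChartAt_symm hf hta v
        have h4 := localForm_apply u H.smooth hta v
        have h5 := (H.exists_comp_eq_iff _ _).1 ⟨_, h4.symm⟩
        have h6 := hD _ _ h5
        have h7 := derivAlong_eq_mfderiv (X := fun _ => A (a₀ + t • v) v) H.injective h4.symm f
        rw [h3, ← h7] at h2
        rw [← h6]
        exact h2
      have hK := eq_zero_of_abs_deriv_le_mul_abs_self_of_eq_zero_right
        (f := fun t : ℝ => f (σ (a₀ + t • v))) (K := |k| * ((‖A a₀‖ + 1) * ‖v‖)) (a := 0) (b := 1)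
        (fun t ht => (hderiv t ht).continuousAt.continuousWithinAt)
        (fun t ht => (hderiv t (Set.Ico_subset_Icc_self ht)).hasDerivWithinAt)
        (by simpa [hσ, ha₀] using hp)
        (by
          intro t ht
          rw [norm_mul, norm_mul, Real.norm_eq_abs k]
          refine mul_le_mul_of_nonneg_right (mul_le_mul_of_nonneg_left ?_ (abs_nonneg _))
            (norm_nonneg _)
          refine (norm_le_pi_norm (A (a₀ + t • v) v) 3).trans
            (((A (a₀ + t • v)).le_opNorm v).trans (mul_le_mul_of_nonneg_right ?_ (norm_nonneg _)))
          exact (hball _ (hmem t (Set.Ico_subset_Icc_self ht))).2.le)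
        1 (by simp)
      simpa [hv] using hK
    have hc : ContinuousAt (extChartAt (𝓡 3) p) p := continuousAt_extChartAt p
    filter_upwards [hc.preimage_mem_nhds (Metric.ball_mem_nhds a₀ hr),
      extChartAt_source_mem_nhds (I := 𝓡 3) p] with q hq hq'
    have h := hzero _ hq
    rwa [hσ, (extChartAt (𝓡 3) p).left_inv hq'] at h
  have huniv := IsClopen.eq_univ ⟨hclosed, hopen⟩ ⟨p₀, h0⟩
  exact huniv.ge (Set.mem_univ p)

theorem eq_of_dirDeriv_eq_zero [ConnectedSpace N] (H : IsHypersurface κ d ε u F ξ) {f : N → ℝ}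
    (hf : Sm f) (hD : ∀ p x, inner0 d x (ξ p) = 0 → dirDeriv u F p x f = 0) (p q : N) :
    f p = f q := by
  have h := H.eq_zero_of_dirDeriv_eq (f := fun r => f r - f q) (hf.sub (Sm.const _)) 0
    (fun r x hx => by rw [dirDeriv_sub r x hf (Sm.const _), hD r x hx, dirDeriv_const]; ring)
    (p₀ := q) (sub_self _) p
  exact sub_eq_zero.1 h

/-- The curvature condition for a parallel hypersurface forces `γ = 0`. -/
theorem gamma_eq_zero (H : IsHypersurface κ d ε u F ξ) (hpar : IsParallel u F κ d ξ) (p : N) :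
    ξ p 2 = 0 := by
  by_contra hγ
  have hd := H.ne_zero
  -- tangent vectors with prescribed last three components
  have htan : ∀ x1 x2 x3 : ℝ, inner0 d ![(x1 * ξ p 1 + x2 * (ξ p 2 - ξ p 0) + d * (x3 * ξ p 3)) /
      ξ p 2, x1, x2, x3] (ξ p) = 0 := by
    intro x1 x2 x3
    simp only [inner0, Matrix.cons_val]
    field_simp
    ring
  -- these triples isolate the two terms of the curvature that are not of constant curvature
  have h1 := H.inner0_curv_eq_zero hpar (htan 1 0 0) (htan 0 1 0) (htan 1 0 0)
  have h2 := H.inner0_curv_eq_zero hpar (htan 0 1 0) (htan 0 0 1) (htan 0 0 1)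
  rw [inner0_curv κ hd, htan, htan] at h1 h2
  simp only [Matrix.cons_val] at h1 h2
  have hκ : κ = 0 := by
    have h3 : κ / d * ξ p 2 = 0 := by linarith
    simpa [hd, hγ] using h3
  have hκ' : 1 - κ = 0 := by
    have h3 : (1 - κ) * ξ p 2 = 0 := by linarith
    simpa [hγ] using h3
  linarith

/-- The curvature condition for a parallel hypersurface, in the tangent plane spanned by
`d δ u₂ - β u₄` and `α u₂ + β u₃`. -/
theorem kappa_eq_two (H : IsHypersurface κ d ε u F ξ) (hpar : IsParallel u F κ d ξ) {p : N}
    (hβ : ξ p 1 ≠ 0) (hδ : ξ p 3 ≠ 0) : κ = 2 := by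
  have hd := H.ne_zero
  have hγ := H.gamma_eq_zero hpar p
  have hx : inner0 d ![0, d * ξ p 3, 0, -ξ p 1] (ξ p) = 0 := by
    simp only [inner0, Matrix.cons_val, hγ]; ring
  have hy : inner0 d ![0, ξ p 0, ξ p 1, 0] (ξ p) = 0 := by
    simp only [inner0, Matrix.cons_val, hγ]; ring
  have h := H.inner0_curv_eq_zero hpar hx hy hy
  rw [inner0_curv κ hd, hx, hy] at h
  simp only [Matrix.cons_val, hγ] at h
  field_simp at h
  have h' : d * ((2 - κ) * (ξ p 1 ^ 3 * ξ p 3)) = 0 := by linear_combination -h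
  replace h' := (mul_eq_zero.1 h').resolve_left hd
  rcases mul_eq_zero.1 h' with h | h
  · linarith
  · exact absurd h (mul_ne_zero (pow_ne_zero 3 hβ) hδ)

end IsHypersurface

end Cases

/-! ### Hypersurfaces with `γ = 0` -/

section Families

set_option linter.unusedSectionVars false

open Filter Topology

variable {G : Type*} [TopologicalSpace G] [ChartedSpace (EuclideanSpace ℝ (Fin 4)) G] [Group G]
  {N : Type*} [TopologicalSpace N] [ChartedSpace (EuclideanSpace ℝ (Fin 3)) N]
  {κ d ε : ℝ} {u : Module.Basis (Fin 4) ℝ (GroupLieAlgebra (𝓡 4) G)} {F : N → G} {ξ : N → Vec}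

namespace IsHypersurface

theorem inner0_normal_of_gamma (hγ : ∀ q, ξ q 2 = 0) (p : N) (x : Vec) :
    inner0 d x (ξ p) = ξ p 1 * x 1 - ξ p 0 * x 2 + d * ξ p 3 * x 3 := by
  simp only [inner0, hγ]; ring

theorem unit_of_gamma (H : IsHypersurface κ d ε u F ξ) (hγ : ∀ q, ξ q 2 = 0) (p : N) :
    ξ p 1 * ξ p 1 + d * (ξ p 3 * ξ p 3) = ε := by
  have h := H.normal.unit p
  simp only [inner0, hγ] at h
  linarith

variable [IsManifold (𝓡 3) ∞ N]

/-- Differentiating `β² + d δ² = ε`. -/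
theorem dirDeriv_unit_of_gamma (H : IsHypersurface κ d ε u F ξ) (hγ : ∀ q, ξ q 2 = 0) (p : N)
    (x : Vec) : ξ p 1 * dirDeriv u F p x (fun q => ξ q 1) +
      d * ξ p 3 * dirDeriv u F p x (fun q => ξ q 3) = 0 := by
  have h1 : (fun q => ξ q 1 * ξ q 1 + d * (ξ q 3 * ξ q 3)) = fun _ => ε :=
    funext (H.unit_of_gamma hγ)
  have h2 := dirDeriv_const (u := u) (F := F) p x ε
  rw [← h1, dirDeriv_add p x ((H.smV 1).mul (H.smV 1)) ((Sm.const d).mul ((H.smV 3).mul (H.smV 3))),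
    dirDeriv_mul p x (H.smV 1) (H.smV 1), dirDeriv_const_mul p x d ((H.smV 3).mul (H.smV 3)),
    dirDeriv_mul p x (H.smV 3) (H.smV 3)] at h2
  linarith

variable [LieGroup (𝓡 4) ∞ G]

theorem inner0_nablaInduced_of_normal (H : IsHypersurface κ d ε u F ξ) (X Y : N → Vec) {p : N}
    {z : Vec} (hz : inner0 d z (ξ p) = 0) :
    inner0 d (nablaInduced u F κ d ξ X Y p) z = inner0 d (nablaAt κ d u F p (X p) Y) z := by
  rw [H.nablaInduced_eq, inner0_sub_left, inner0_smul_left, inner0_comm d (ξ p), hz, mul_zero,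
    sub_zero]
  rfl

/-- Since `γ = 0`, the `θ³`-component of the induced connection is that of the ambient one. -/
theorem nablaInduced_two (H : IsHypersurface κ d ε u F ξ) (hγ : ∀ q, ξ q 2 = 0) (X Y : N → Vec)
    (p : N) : nablaInduced u F κ d ξ X Y p 2 =
      dirDeriv u F p (X p) (fun q => Y q 2) + (κ * (X p 2 * Y p 3) + X p 3 * Y p 2) := by
  rw [H.nablaInduced_eq]
  simp only [Pi.sub_apply, Pi.smul_apply, hγ, smul_zero, sub_zero]
  rfl

/-- When `h` is a constant multiple of the metric plus `f θ³ ⊗ θ³`, the covariant derivative of `h`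
only involves that of `f θ³ ⊗ θ³`. -/
theorem nablaSecondForm_of_hAt_eq (H : IsHypersurface κ d ε u F ξ) (hγ : ∀ q, ξ q 2 = 0)
    (hδ : ∀ p x, inner0 d x (ξ p) = 0 → dirDeriv u F p x (fun q => ξ q 3) = 0)
    {f : N → ℝ} (hf : Sm f)
    (hh : ∀ p x y, inner0 d x (ξ p) = 0 → inner0 d y (ξ p) = 0 →
      hAt κ d u F ξ p x y = -κ * (ξ p 3 * inner0 d x y) + f p * (x 2 * y 2))
    {X Y Z : N → Vec} (hX : IsTangentField u F X) (hY : IsTangentField u F Y)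
    (hZ : IsTangentField u F Z) (p : N) :
    nablaSecondForm u F κ d ξ X Y Z p =
      dirDeriv u F p (X p) f * (Y p 2 * Z p 2) -
        f p * ((κ * X p 2 * Y p 3 + X p 3 * Y p 2) * Z p 2 +
          Y p 2 * (κ * X p 2 * Z p 3 + X p 3 * Z p 2)) := by
  have tX := (H.isTangentField_iff.1 hX).2
  have tY := (H.isTangentField_iff.1 hY).2
  have tZ := (H.isTangentField_iff.1 hZ).2
  have h1 : secondForm u F κ d ξ Y Z = fun q =>
      -κ * (ξ q 3 * inner0 d (Y q) (Z q)) + f q * (Y q 2 * Z q 2) :=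
    funext fun q => by rw [secondForm_eq_hAt, hh q _ _ (tY q) (tZ q)]
  have h2 : derivAlong u F X (secondForm u F κ d ξ Y Z) p =
      -κ * (ξ p 3 * (inner0 d (nablaAt κ d u F p (X p) Y) (Z p) +
        inner0 d (Y p) (nablaAt κ d u F p (X p) Z))) +
      (dirDeriv u F p (X p) f * (Y p 2 * Z p 2) + f p *
        (dirDeriv u F p (X p) (fun q => Y q 2) * Z p 2 +
          Y p 2 * dirDeriv u F p (X p) (fun q => Z q 2))) := by
    have sY : SmV Y := hY.1
    have sZ : SmV Z := hZ.1
    have hi := Sm.inner0 d sY sZ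
    rw [h1]
    change dirDeriv u F p (X p) _ = _
    rw [dirDeriv_add p _ ((Sm.const _).mul ((H.smV 3).mul hi)) (hf.mul ((sY 2).mul (sZ 2))),
      dirDeriv_const_mul p _ _ ((H.smV 3).mul hi), dirDeriv_mul p _ (H.smV 3) hi,
      dirDeriv_mul p _ hf ((sY 2).mul (sZ 2)), dirDeriv_mul p _ (sY 2) (sZ 2),
      hδ p _ (tX p), dirDeriv_inner0 κ H.ne_zero p _ sY sZ, zero_mul, zero_add]
  rw [nablaSecondForm, h2, secondForm_eq_hAt, secondForm_eq_hAt,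
    hh p _ _ (H.inner0_nablaInduced X Y p) (tZ p), hh p _ _ (tY p) (H.inner0_nablaInduced X Z p),
    H.inner0_nablaInduced_of_normal X Y (tZ p), inner0_comm d (Y p) (nablaInduced u F κ d ξ X Z p),
    H.inner0_nablaInduced_of_normal X Z (tY p), H.nablaInduced_two hγ, H.nablaInduced_two hγ,
    inner0_comm d (Y p)]
  ring

theorem isTangentField_V₁ (H : IsHypersurface κ d ε u F ξ) (hγ : ∀ q, ξ q 2 = 0) :
    IsTangentField u F V₁ := by
  refine H.isTangentField_iff.2 ⟨fun k => Sm.const _, fun p => ?_⟩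
  rw [inner0_normal_of_gamma hγ]
  simp [V₁]

theorem hAt_V₁_right (H : IsHypersurface κ d ε u F ξ) (hγ : ∀ q, ξ q 2 = 0) (p : N) (x : Vec) :
    hAt κ d u F ξ p x ![1, 0, 0, 0] = κ * ξ p 3 * x 2 := by
  rw [hAt_apply H.ne_zero hγ]
  simp only [Matrix.cons_val]
  ring

theorem hAt_V₁_left (H : IsHypersurface κ d ε u F ξ) (hγ : ∀ q, ξ q 2 = 0) {p : N} {x : Vec}
    (hx : inner0 d x (ξ p) = 0) : hAt κ d u F ξ p ![1, 0, 0, 0] x = κ * ξ p 3 * x 2 := by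
  have t1 : inner0 d ![1, 0, 0, 0] (ξ p) = 0 :=
    (H.isTangentField_iff.1 (H.isTangentField_V₁ hγ)).2 p
  rw [H.hAt_symm t1 hx, H.hAt_V₁_right hγ]

/-! ### The first family -/

section First

variable (h1 : Algebraic1 d ε (fun q => ξ q 1) (fun q => ξ q 2) (fun q => ξ q 3))

include h1 in
theorem isTangentField_V₂i (H : IsHypersurface κ d ε u F ξ) : IsTangentField u F V₂i := by
  refine H.isTangentField_iff.2 ⟨fun k => Sm.const _, fun p => ?_⟩
  rw [inner0_normal_of_gamma fun q => (h1 q).2.1]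
  simp [V₂i, (h1 p).1]

include h1 in
theorem isTangentField_V₃i (H : IsHypersurface κ d ε u F ξ) :
    IsTangentField u F (V₃i d (fun q => ξ q 0) (fun q => ξ q 3)) := by
  refine H.isTangentField_iff.2 ⟨fun k => ?_, fun p => ?_⟩
  · fin_cases k
    exacts [Sm.const 0, Sm.const 0, (Sm.const d).mul (H.smV 3), H.smV 0]
  · rw [inner0_normal_of_gamma fun q => (h1 q).2.1]
    simp only [V₃i, Matrix.cons_val]
    ring

include h1 in
theorem delta_ne_zero_of_algebraic1 (H : IsHypersurface κ d ε u F ξ) (p : N) : ξ p 3 ≠ 0 := by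
  intro h
  have h2 := (h1 p).2.2
  simp only [h] at h2
  have h3 := H.sq_sign
  rw [← h2] at h3
  simp at h3

include h1 in
theorem dirDeriv_delta_of_algebraic1 (H : IsHypersurface κ d ε u F ξ) (p : N) (x : Vec) :
    dirDeriv u F p x (fun q => ξ q 3) = 0 := by
  have h := H.dirDeriv_unit_of_gamma (fun q => (h1 q).2.1) p x
  rw [show ξ p 1 = 0 from (h1 p).1, zero_mul, zero_add] at h
  exact (mul_eq_zero.1 h).resolve_left (mul_ne_zero H.ne_zero (H.delta_ne_zero_of_algebraic1 h1 p))

include h1 in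
theorem dirDeriv_beta_of_algebraic1 (p : N) (x : Vec) :
    dirDeriv u F p x (fun q => ξ q 1) = 0 := by
  rw [show (fun q => ξ q 1) = fun _ => (0 : ℝ) from funext fun q => (h1 q).1, dirDeriv_const]

include h1 in
/-- From `h(V₁, V₃) = h(V₃, V₁)`. -/
theorem V₁_alpha_of_algebraic1 (H : IsHypersurface κ d ε u F ξ) (p : N) :
    derivAlong u F V₁ (fun q => ξ q 0) p = 0 := by
  have hγ : ∀ q, ξ q 2 = 0 := fun q => (h1 q).2.1
  have h := H.hAt_V₁_left hγ ((H.isTangentField_iff.1 (H.isTangentField_V₃i h1)).2 p)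
  rw [hAt_apply H.ne_zero hγ, H.dirDeriv_delta_of_algebraic1 h1] at h
  simp only [V₃i, Matrix.cons_val] at h
  have h' : dirDeriv u F p ![1, 0, 0, 0] (fun q => ξ q 0) * (d * ξ p 3) = 0 := by linarith
  exact (mul_eq_zero.1 h').resolve_right
    (mul_ne_zero H.ne_zero (H.delta_ne_zero_of_algebraic1 h1 p))

include h1 in
/-- From `h(V₂, V₃) = h(V₃, V₂)`. -/
theorem V₂_alpha_of_algebraic1 (H : IsHypersurface κ d ε u F ξ) (p : N) :
    derivAlong u F V₂i (fun q => ξ q 0) p = 0 := by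
  have hγ : ∀ q, ξ q 2 = 0 := fun q => (h1 q).2.1
  have h := H.hAt_symm ((H.isTangentField_iff.1 (H.isTangentField_V₂i h1)).2 p)
    ((H.isTangentField_iff.1 (H.isTangentField_V₃i h1)).2 p)
  rw [hAt_apply H.ne_zero hγ, hAt_apply H.ne_zero hγ, H.dirDeriv_delta_of_algebraic1 h1,
    H.dirDeriv_delta_of_algebraic1 h1, dirDeriv_beta_of_algebraic1 h1,
    dirDeriv_beta_of_algebraic1 h1, show ξ p 1 = 0 from (h1 p).1] at h
  simp only [V₂i, V₃i, Matrix.cons_val] at h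
  have h' : dirDeriv u F p ![0, 1, 0, 0] (fun q => ξ q 0) * (d * ξ p 3) = 0 := by linarith
  exact (mul_eq_zero.1 h').resolve_right
    (mul_ne_zero H.ne_zero (H.delta_ne_zero_of_algebraic1 h1 p))

include h1 in
/-- A function annihilated by `V₁` and `V₂` is differentiated by its `V₃`-derivative. -/
theorem dirDeriv_of_algebraic1 (H : IsHypersurface κ d ε u F ξ) {f : N → ℝ} {p : N}
    (hf1 : derivAlong u F V₁ f p = 0) (hf2 : derivAlong u F V₂i f p = 0) {x : Vec}
    (hx : inner0 d x (ξ p) = 0) :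
    dirDeriv u F p x f = ε * ξ p 3 * x 2 *
      derivAlong u F (V₃i d (fun q => ξ q 0) (fun q => ξ q 3)) f p := by
  have hγ : ∀ q, ξ q 2 = 0 := fun q => (h1 q).2.1
  have t1 := (H.isTangentField_iff.1 (H.isTangentField_V₁ hγ)).2 p
  have t2 := (H.isTangentField_iff.1 (H.isTangentField_V₂i h1)).2 p
  have t3 := (H.isTangentField_iff.1 (H.isTangentField_V₃i h1)).2 p
  have t12 : inner0 d (x 0 • V₁ p + x 1 • V₂i p) (ξ p) = 0 := by
    rw [inner0_add_left, inner0_smul_left, inner0_smul_left, t1, t2]; ring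
  have hε : d * ξ p 3 ^ 2 = ε := (h1 p).2.2
  have hx' := hx
  rw [inner0_normal_of_gamma hγ, show ξ p 1 = 0 from (h1 p).1] at hx'
  have hdec : x = (1 : ℝ) • (x 0 • V₁ p + x 1 • V₂i p) +
      (ε * ξ p 3 * x 2) • V₃i d (fun q => ξ q 0) (fun q => ξ q 3) p := by
    ext k
    fin_cases k
    · simp [V₁, V₂i, V₃i]
    · simp [V₁, V₂i, V₃i]
    · simp [V₁, V₂i, V₃i]
      linear_combination (-ε * x 2) * hε - x 2 * H.sq_sign
    · simp [V₁, V₂i, V₃i]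
      linear_combination (ε * ξ p 3) * hx' - ε * x 3 * hε - x 3 * H.sq_sign
  conv_lhs => rw [hdec]
  rw [H.dirDeriv_comb _ _ t12 t3, H.dirDeriv_comb _ _ t1 t2]
  change 1 * (x 0 * derivAlong u F V₁ f p + x 1 * derivAlong u F V₂i f p) +
    _ * derivAlong u F (V₃i d (fun q => ξ q 0) (fun q => ξ q 3)) f p = _
  rw [hf1, hf2]
  ring

include h1 in
theorem sm_phi (H : IsHypersurface κ d ε u F ξ) :
    Sm (phi u F d ε (fun q => ξ q 0) (fun q => ξ q 3)) := by
  have h := (((H.smV 0).mul (H.smV 0)).sub (Sm.const ε)).sub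
    (H.sm_derivAlong (H.isTangentField_V₃i h1) (H.smV 0))
  simp only [← pow_two] at h
  exact h

include h1 in
theorem dirDeriv_phi (H : IsHypersurface κ d ε u F ξ) (p : N) (x : Vec) :
    dirDeriv u F p x (phi u F d ε (fun q => ξ q 0) (fun q => ξ q 3)) =
      2 * ξ p 0 * dirDeriv u F p x (fun q => ξ q 0) - dirDeriv u F p x
        (derivAlong u F (V₃i d (fun q => ξ q 0) (fun q => ξ q 3)) (fun q => ξ q 0)) := by
  have h : phi u F d ε (fun q => ξ q 0) (fun q => ξ q 3) = fun p => (ξ p 0 * ξ p 0 - ε) -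
      derivAlong u F (V₃i d (fun q => ξ q 0) (fun q => ξ q 3)) (fun q => ξ q 0) p := by
    funext p; simp only [phi, pow_two]
  rw [h, dirDeriv_sub p x (((H.smV 0).mul (H.smV 0)).sub (Sm.const ε))
      (H.sm_derivAlong (H.isTangentField_V₃i h1) (H.smV 0)),
    dirDeriv_sub p x ((H.smV 0).mul (H.smV 0)) (Sm.const ε), dirDeriv_const,
    dirDeriv_mul p x (H.smV 0) (H.smV 0)]
  ring

include h1 in
/-- From the commutator `[V₁, V₃] = (κ + 1) α V₁`, applied to `α`. -/
theorem V₁_phi (H : IsHypersurface κ d ε u F ξ) (p : N) :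
    derivAlong u F V₁ (phi u F d ε (fun q => ξ q 0) (fun q => ξ q 3)) p = 0 := by
  have hγ : ∀ q, ξ q 2 = 0 := fun q => (h1 q).2.1
  have hα := H.V₁_alpha_of_algebraic1 h1
  have t1 := (H.isTangentField_iff.1 (H.isTangentField_V₁ hγ)).2 p
  have hc := H.derivAlong_commutator (H.isTangentField_V₁ hγ) (H.isTangentField_V₃i h1) (H.smV 0) p
  have hb : bracket κ u F V₁ (V₃i d (fun q => ξ q 0) (fun q => ξ q 3)) p =
      ((κ + 1) * ξ p 0) • V₁ p + (0 : ℝ) • V₁ p := by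
    have e : ∀ (c : ℝ),
        derivAlong u F (V₃i d (fun q => ξ q 0) (fun q => ξ q 3)) (fun _ => c) p = 0 :=
      fun c => dirDeriv_const _ _ _
    have e0 : ∀ (c : ℝ), derivAlong u F V₁ (fun _ => c) p = 0 :=
      fun c => dirDeriv_const _ _ _
    have e1 : derivAlong u F V₁ (fun q => d * ξ q 3) p = 0 :=
      (dirDeriv_const_mul p _ d (H.smV 3)).trans (by
        rw [H.dirDeriv_delta_of_algebraic1 h1, mul_zero])
    ext k
    fin_cases k <;> simp [bracket, bracket0, V₁, V₃i] <;> simp [e, e0, e1, hα]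
  have hz : derivAlong u F V₁ (fun q => ξ q 0) = fun _ => 0 := funext hα
  rw [hb, H.dirDeriv_comb _ _ t1 t1, hz] at hc
  have h3 : derivAlong u F (V₃i d (fun q => ξ q 0) (fun q => ξ q 3)) (fun _ => (0 : ℝ)) p = 0 :=
    dirDeriv_const _ _ _
  have h4 : dirDeriv u F p (V₁ p) (fun q => ξ q 0) = 0 := hα p
  rw [h3, h4] at hc
  refine (H.dirDeriv_phi h1 p (V₁ p)).trans ?_
  rw [h4]
  change _ - derivAlong u F V₁ (derivAlong u F _ _) p = 0
  linarith

include h1 in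
/-- From the commutator `[V₂, V₃] = κ α V₂`, applied to `α`. -/
theorem V₂_phi (H : IsHypersurface κ d ε u F ξ) (p : N) :
    derivAlong u F V₂i (phi u F d ε (fun q => ξ q 0) (fun q => ξ q 3)) p = 0 := by
  have hα := H.V₂_alpha_of_algebraic1 h1
  have t2 := (H.isTangentField_iff.1 (H.isTangentField_V₂i h1)).2 p
  have hc := H.derivAlong_commutator (H.isTangentField_V₂i h1) (H.isTangentField_V₃i h1) (H.smV 0) p
  have hb : bracket κ u F V₂i (V₃i d (fun q => ξ q 0) (fun q => ξ q 3)) p =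
      (κ * ξ p 0) • V₂i p + (0 : ℝ) • V₂i p := by
    have e : ∀ (c : ℝ),
        derivAlong u F (V₃i d (fun q => ξ q 0) (fun q => ξ q 3)) (fun _ => c) p = 0 :=
      fun c => dirDeriv_const _ _ _
    have e0 : ∀ (c : ℝ), derivAlong u F V₂i (fun _ => c) p = 0 :=
      fun c => dirDeriv_const _ _ _
    have e1 : derivAlong u F V₂i (fun q => d * ξ q 3) p = 0 :=
      (dirDeriv_const_mul p _ d (H.smV 3)).trans (by
        rw [H.dirDeriv_delta_of_algebraic1 h1, mul_zero])
    ext k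
    fin_cases k <;> simp [bracket, bracket0, V₂i, V₃i] <;> simp [e, e0, e1, hα]
  have hz : derivAlong u F V₂i (fun q => ξ q 0) = fun _ => 0 := funext hα
  rw [hb, H.dirDeriv_comb _ _ t2 t2, hz] at hc
  have h3 : derivAlong u F (V₃i d (fun q => ξ q 0) (fun q => ξ q 3)) (fun _ => (0 : ℝ)) p = 0 :=
    dirDeriv_const _ _ _
  have h4 : dirDeriv u F p (V₂i p) (fun q => ξ q 0) = 0 := hα p
  rw [h3, h4] at hc
  refine (H.dirDeriv_phi h1 p (V₂i p)).trans ?_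
  rw [h4]
  change _ - derivAlong u F V₂i (derivAlong u F _ _) p = 0
  linarith

include h1 in
/-- In the first family `h = -κδ g - εδφ θ³ ⊗ θ³`. -/
theorem hAt_of_algebraic1 (H : IsHypersurface κ d ε u F ξ) {p : N} {x y : Vec}
    (hx : inner0 d x (ξ p) = 0) :
    hAt κ d u F ξ p x y = -κ * (ξ p 3 * inner0 d x y) +
      -ε * (ξ p 3 * phi u F d ε (fun q => ξ q 0) (fun q => ξ q 3) p) * (x 2 * y 2) := by
  have hγ : ∀ q, ξ q 2 = 0 := fun q => (h1 q).2.1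
  have hε : d * ξ p 3 ^ 2 = ε := (h1 p).2.2
  rw [hAt_apply H.ne_zero hγ, H.dirDeriv_delta_of_algebraic1 h1, dirDeriv_beta_of_algebraic1 h1,
    H.dirDeriv_of_algebraic1 h1 (H.V₁_alpha_of_algebraic1 h1 p) (H.V₂_alpha_of_algebraic1 h1 p) hx]
  rw [inner0_normal_of_gamma hγ] at hx
  simp only [show ξ p 1 = 0 from (h1 p).1] at hx ⊢
  simp only [phi, inner0]
  have hs := H.sq_sign
  linear_combination (κ * y 3 - ξ p 0 * y 2 * ε * ξ p 3) * hx + ξ p 0 * y 2 * ε * x 3 * hε +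
    (ξ p 0 * y 2 * x 3 - ξ p 3 * x 2 * y 2) * hs

include h1 in
/-- The component `(∇_{V₃} h)(V₃, V₃)` carries the whole of `∇h`, since `φ` is constant along `V₁`
and `V₂`. -/
theorem isParallel_iff_of_algebraic1 (H : IsHypersurface κ d ε u F ξ) :
    IsParallel u F κ d ξ ↔ ∀ p, derivAlong u F (V₃i d (fun q => ξ q 0) (fun q => ξ q 3))
      (phi u F d ε (fun q => ξ q 0) (fun q => ξ q 3)) p =
        2 * (κ + 1) * ξ p 0 * phi u F d ε (fun q => ξ q 0) (fun q => ξ q 3) p := by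
  have hγ : ∀ q, ξ q 2 = 0 := fun q => (h1 q).2.1
  set φ := phi u F d ε (fun q => ξ q 0) (fun q => ξ q 3) with hφ
  have sφ : Sm φ := H.sm_phi h1
  have hε : ε ≠ 0 := by rintro rfl; simpa using H.sq_sign
  have hform := fun {X Y Z : N → Vec} (hX : IsTangentField u F X) (hY : IsTangentField u F Y)
    (hZ : IsTangentField u F Z) (p : N) => H.nablaSecondForm_of_hAt_eq hγ
      (fun p x _ => H.dirDeriv_delta_of_algebraic1 h1 p x)
      (f := fun p => -ε * (ξ p 3 * φ p)) ((Sm.const (-ε)).mul ((H.smV 3).mul sφ))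
      (fun p x y hx _ => H.hAt_of_algebraic1 h1 hx) hX hY hZ p
  have hf : ∀ p x, dirDeriv u F p x (fun p => -ε * (ξ p 3 * φ p)) =
      -ε * (ξ p 3 * dirDeriv u F p x φ) := by
    intro p x
    rw [dirDeriv_const_mul p x _ ((H.smV 3).mul sφ), dirDeriv_mul p x (H.smV 3) sφ,
      H.dirDeriv_delta_of_algebraic1 h1, zero_mul, zero_add]
  constructor
  · intro hpar p
    have h3 := H.isTangentField_V₃i h1
    have hδ := H.delta_ne_zero_of_algebraic1 h1 p
    have h := hpar _ _ _ h3 h3 h3 p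
    rw [hform h3 h3 h3, hf] at h
    change -ε * (ξ p 3 * derivAlong u F _ φ p) * _ - _ = 0 at h
    simp only [V₃i, Matrix.cons_val] at h ⊢
    have hc : -ε * ξ p 3 * (d * ξ p 3) ^ 2 ≠ 0 :=
      mul_ne_zero (mul_ne_zero (neg_ne_zero.2 hε) hδ) (pow_ne_zero 2 (mul_ne_zero H.ne_zero hδ))
    apply mul_left_cancel₀ hc
    linear_combination h
  · intro hpde X Y Z hX hY hZ p
    have tX := (H.isTangentField_iff.1 hX).2 p
    have tY := (H.isTangentField_iff.1 hY).2 p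
    have tZ := (H.isTangentField_iff.1 hZ).2 p
    rw [hform hX hY hZ, hf, H.dirDeriv_of_algebraic1 h1 (H.V₁_phi h1 p) (H.V₂_phi h1 p) tX, hpde]
    rw [inner0_normal_of_gamma hγ] at tX tY tZ
    simp only [show ξ p 1 = 0 from (h1 p).1] at tX tY tZ
    have hs : d * ξ p 3 ^ 2 = ε := (h1 p).2.2
    have hss := H.sq_sign
    -- tangency expresses the fourth components in terms of the third ones
    have e : ∀ t : Vec, 0 * t 1 - ξ p 0 * t 2 + d * ξ p 3 * t 3 = 0 →
        t 3 = ε * ξ p 3 * ξ p 0 * t 2 := fun t ht => by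
      linear_combination (ε * ξ p 3) * ht - ε * t 3 * hs - t 3 * hss
    rw [e _ tX, e _ tY, e _ tZ]
    ring

include h1 in
theorem isTotallyGeodesic_iff_of_algebraic1 [Nonempty N] (H : IsHypersurface κ d ε u F ξ) :
    IsTotallyGeodesic u F κ d ξ ↔
      κ = 0 ∧ ∀ p, phi u F d ε (fun q => ξ q 0) (fun q => ξ q 3) p = 0 := by
  have hε : ε ≠ 0 := by rintro rfl; simpa using H.sq_sign
  constructor
  · intro hg
    have hκ : κ = 0 := by
      obtain ⟨p⟩ := ‹Nonempty N›
      have h2 := H.isTangentField_V₂i h1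
      have t2 := (H.isTangentField_iff.1 h2).2 p
      have h := hg _ _ h2 h2 p
      rw [secondForm_eq_hAt, H.hAt_of_algebraic1 h1 t2] at h
      simpa [V₂i, inner0, H.delta_ne_zero_of_algebraic1 h1 p] using h
    refine ⟨hκ, fun p => ?_⟩
    have h3 := H.isTangentField_V₃i h1
    have t3 := (H.isTangentField_iff.1 h3).2 p
    have h := hg _ _ h3 h3 p
    rw [secondForm_eq_hAt, H.hAt_of_algebraic1 h1 t3, hκ] at h
    simpa [V₃i, hε, H.ne_zero, H.delta_ne_zero_of_algebraic1 h1 p] using h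
  · rintro ⟨hκ, hφ⟩ X Y hX _ p
    rw [secondForm_eq_hAt, H.hAt_of_algebraic1 h1 ((H.isTangentField_iff.1 hX).2 p), hκ, hφ]
    ring

end First

end IsHypersurface

end Families

/-! ### The second family -/

section SecondFamily

set_option linter.unusedSectionVars false

open Filter Topology

variable {G : Type*} [TopologicalSpace G] [ChartedSpace (EuclideanSpace ℝ (Fin 4)) G] [Group G]
  {N : Type*} [TopologicalSpace N] [ChartedSpace (EuclideanSpace ℝ (Fin 3)) N]
  {κ d ε : ℝ} {u : Module.Basis (Fin 4) ℝ (GroupLieAlgebra (𝓡 4) G)} {F : N → G} {ξ : N → Vec}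
  [IsManifold (𝓡 3) ∞ N] [LieGroup (𝓡 4) ∞ G]

namespace IsHypersurface

variable (h2 : Algebraic2 ε (fun q => ξ q 1) (fun q => ξ q 2) (fun q => ξ q 3))

include h2

theorem gamma_of_algebraic2 (p : N) : ξ p 2 = 0 := (h2.2 p).1

theorem delta_of_algebraic2 (p : N) : ξ p 3 = 0 := (h2.2 p).2.1

theorem beta_of_algebraic2 (p : N) : ξ p 1 * ξ p 1 = 1 := by
  have h := (h2.2 p).2.2
  rw [h2.1] at h
  linear_combination h

theorem dirDeriv_delta_of_algebraic2 (p : N) (x : Vec) :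
    dirDeriv u F p x (fun q => ξ q 3) = 0 := by
  rw [show (fun q => ξ q 3) = fun _ => (0 : ℝ) from funext (delta_of_algebraic2 h2), dirDeriv_const]

theorem dirDeriv_beta_of_algebraic2 (H : IsHypersurface κ d ε u F ξ) (p : N) (x : Vec) :
    dirDeriv u F p x (fun q => ξ q 1) = 0 := by
  have h := H.dirDeriv_unit_of_gamma (gamma_of_algebraic2 h2) p x
  rw [delta_of_algebraic2 h2] at h
  have hβ := beta_of_algebraic2 h2 p
  linear_combination ξ p 1 * h - dirDeriv u F p x (fun q => ξ q 1) * hβ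

theorem isTangentField_V₂ii (H : IsHypersurface κ d ε u F ξ) :
    IsTangentField u F (V₂ii (fun q => ξ q 0) (fun q => ξ q 1)) := by
  refine H.isTangentField_iff.2 ⟨fun k => ?_, fun p => ?_⟩
  · fin_cases k
    exacts [Sm.const 0, H.smV 0, H.smV 1, Sm.const 0]
  · rw [inner0_normal_of_gamma (gamma_of_algebraic2 h2)]
    simp only [V₂ii, Matrix.cons_val]
    ring

theorem isTangentField_V₃ii (H : IsHypersurface κ d ε u F ξ) : IsTangentField u F V₃ii := by
  refine H.isTangentField_iff.2 ⟨fun k => Sm.const _, fun p => ?_⟩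
  rw [inner0_normal_of_gamma (gamma_of_algebraic2 h2), delta_of_algebraic2 h2]
  simp [V₃ii]

/-- The expansion of a tangent vector in the frame `V₁, V₂, V₃` of the second family. -/
theorem dirDeriv_of_algebraic2 (H : IsHypersurface κ d ε u F ξ) (f : N → ℝ) {p : N} {x : Vec}
    (hx : inner0 d x (ξ p) = 0) :
    dirDeriv u F p x f = x 0 * derivAlong u F V₁ f p +
      ξ p 1 * x 2 * derivAlong u F (V₂ii (fun q => ξ q 0) (fun q => ξ q 1)) f p +
      x 3 * derivAlong u F V₃ii f p := by
  have hγ := gamma_of_algebraic2 h2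
  have t1 := (H.isTangentField_iff.1 (H.isTangentField_V₁ hγ)).2 p
  have t2 := (H.isTangentField_iff.1 (H.isTangentField_V₂ii h2)).2 p
  have t3 := (H.isTangentField_iff.1 (H.isTangentField_V₃ii h2)).2 p
  set W := V₂ii (fun q => ξ q 0) (fun q => ξ q 1) with hW
  have t12 : inner0 d (x 0 • V₁ p + (ξ p 1 * x 2) • W p) (ξ p) = 0 := by
    rw [inner0_add_left, inner0_smul_left, inner0_smul_left, t1, t2]; ring
  have hβ := beta_of_algebraic2 h2 p
  have hx' := hx
  rw [inner0_normal_of_gamma hγ, delta_of_algebraic2 h2] at hx'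
  have hdec : x = (1 : ℝ) • (x 0 • V₁ p + (ξ p 1 * x 2) • W p) + x 3 • V₃ii p := by
    ext k
    fin_cases k
    · simp [V₁, hW, V₂ii, V₃ii]
    · simp [V₁, hW, V₂ii, V₃ii]
      linear_combination ξ p 1 * hx' - x 1 * hβ
    · simp [V₁, hW, V₂ii, V₃ii]
      linear_combination (-x 2) * hβ
    · simp [V₁, hW, V₂ii, V₃ii]
  conv_lhs => rw [hdec]
  rw [H.dirDeriv_comb _ _ t12 t3, H.dirDeriv_comb _ _ t1 t2]
  change 1 * (x 0 * derivAlong u F V₁ f p + _ * derivAlong u F W f p) +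
    _ * derivAlong u F V₃ii f p = _
  ring

theorem hAt_apply_of_algebraic2 (H : IsHypersurface κ d ε u F ξ) {p : N} {x : Vec} (y : Vec)
    (hx : inner0 d x (ξ p) = 0) :
    hAt κ d u F ξ p x y = (dirDeriv u F p x (fun q => ξ q 0) - x 3 * ξ p 0) * y 2 := by
  rw [hAt_apply H.ne_zero (gamma_of_algebraic2 h2), dirDeriv_delta_of_algebraic2 h2,
    H.dirDeriv_beta_of_algebraic2 h2, delta_of_algebraic2 h2]
  rw [inner0_normal_of_gamma (gamma_of_algebraic2 h2), delta_of_algebraic2 h2] at hx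
  linear_combination κ * y 3 * hx

/-- From `h(V₁, V₂) = h(V₂, V₁)`. -/
theorem V₁_alpha_of_algebraic2 (H : IsHypersurface κ d ε u F ξ) (p : N) :
    derivAlong u F V₁ (fun q => ξ q 0) p = 0 := by
  have hγ := gamma_of_algebraic2 h2
  have t1 : inner0 d ![1, 0, 0, 0] (ξ p) = 0 :=
    (H.isTangentField_iff.1 (H.isTangentField_V₁ hγ)).2 p
  have t2 := (H.isTangentField_iff.1 (H.isTangentField_V₂ii h2)).2 p
  have h := H.hAt_V₁_left hγ t2
  rw [H.hAt_apply_of_algebraic2 h2 _ t1, delta_of_algebraic2 h2] at h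
  simp only [V₂ii, Matrix.cons_val] at h
  change dirDeriv u F p ![1, 0, 0, 0] _ = 0
  linear_combination ξ p 1 * h - dirDeriv u F p ![1, 0, 0, 0] (fun q => ξ q 0) *
    beta_of_algebraic2 h2 p

/-- From `h(V₂, V₃) = h(V₃, V₂)`. -/
theorem V₃_alpha_of_algebraic2 (H : IsHypersurface κ d ε u F ξ) (p : N) :
    derivAlong u F V₃ii (fun q => ξ q 0) p = ξ p 0 := by
  have t2 := (H.isTangentField_iff.1 (H.isTangentField_V₂ii h2)).2 p
  have t3 := (H.isTangentField_iff.1 (H.isTangentField_V₃ii h2)).2 p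
  have h := H.hAt_symm t3 t2
  rw [H.hAt_apply_of_algebraic2 h2 _ t2, H.hAt_apply_of_algebraic2 h2 _ t3] at h
  simp only [V₂ii, V₃ii, Matrix.cons_val] at h
  change dirDeriv u F p ![0, 0, 0, 1] _ = _
  linear_combination ξ p 1 * h - (dirDeriv u F p ![0, 0, 0, 1] (fun q => ξ q 0) - ξ p 0) *
    beta_of_algebraic2 h2 p

/-- In the second family `h = β V₂(α) θ³ ⊗ θ³`. The summand with `δ = 0` brings the formula into
the form required by `nablaSecondForm_of_hAt_eq`. -/
theorem hAt_of_algebraic2 (H : IsHypersurface κ d ε u F ξ) {p : N} {x : Vec} (y : Vec)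
    (hx : inner0 d x (ξ p) = 0) :
    hAt κ d u F ξ p x y = -κ * (ξ p 3 * inner0 d x y) +
      ξ p 1 * derivAlong u F (V₂ii (fun q => ξ q 0) (fun q => ξ q 1)) (fun q => ξ q 0) p *
        (x 2 * y 2) := by
  rw [H.hAt_apply_of_algebraic2 h2 y hx, H.dirDeriv_of_algebraic2 h2 _ hx,
    H.V₁_alpha_of_algebraic2 h2, H.V₃_alpha_of_algebraic2 h2, delta_of_algebraic2 h2]
  ring

theorem sm_V₂_alpha (H : IsHypersurface κ d ε u F ξ) :
    Sm (derivAlong u F (V₂ii (fun q => ξ q 0) (fun q => ξ q 1)) (fun q => ξ q 0)) :=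
  H.sm_derivAlong (H.isTangentField_V₂ii h2) (H.smV 0)

theorem nablaSecondForm_of_algebraic2 (H : IsHypersurface κ d ε u F ξ)
    {X Y Z : N → Vec} (hX : IsTangentField u F X) (hY : IsTangentField u F Y)
    (hZ : IsTangentField u F Z) (p : N) :
    nablaSecondForm u F κ d ξ X Y Z p =
      ξ p 1 * dirDeriv u F p (X p) (derivAlong u F (V₂ii (fun q => ξ q 0) (fun q => ξ q 1))
        (fun q => ξ q 0)) * (Y p 2 * Z p 2) -
      ξ p 1 * derivAlong u F (V₂ii (fun q => ξ q 0) (fun q => ξ q 1)) (fun q => ξ q 0) p *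
        ((κ * X p 2 * Y p 3 + X p 3 * Y p 2) * Z p 2 +
          Y p 2 * (κ * X p 2 * Z p 3 + X p 3 * Z p 2)) := by
  have hg := H.sm_V₂_alpha h2
  rw [H.nablaSecondForm_of_hAt_eq (gamma_of_algebraic2 h2)
    (fun p x _ => dirDeriv_delta_of_algebraic2 h2 p x) ((H.smV 1).mul hg)
    (fun p x y hx _ => H.hAt_of_algebraic2 h2 y hx) hX hY hZ p,
    dirDeriv_mul p _ (H.smV 1) hg, H.dirDeriv_beta_of_algebraic2 h2, zero_mul, zero_add]

/-- From the commutator `[V₁, V₂] = 0`, applied to `α`. -/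
theorem V₁_V₂_alpha (H : IsHypersurface κ d ε u F ξ) (p : N) :
    derivAlong u F V₁ (derivAlong u F (V₂ii (fun q => ξ q 0) (fun q => ξ q 1))
      (fun q => ξ q 0)) p = 0 := by
  have hγ := gamma_of_algebraic2 h2
  have t1 := (H.isTangentField_iff.1 (H.isTangentField_V₁ hγ)).2 p
  have hc := H.derivAlong_commutator (H.isTangentField_V₁ hγ) (H.isTangentField_V₂ii h2)
    (H.smV 0) p
  set W := V₂ii (fun q => ξ q 0) (fun q => ξ q 1) with hW
  have hb : bracket κ u F V₁ W p = (0 : ℝ) • V₁ p + (0 : ℝ) • V₁ p := by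
    have e : ∀ c : ℝ, derivAlong u F W (fun _ => c) p = 0 := fun c => dirDeriv_const _ _ _
    have e0 : ∀ c : ℝ, derivAlong u F V₁ (fun _ => c) p = 0 := fun c => dirDeriv_const _ _ _
    have e1 : derivAlong u F V₁ (fun q => ξ q 1) p = 0 := H.dirDeriv_beta_of_algebraic2 h2 p _
    have e2 := H.V₁_alpha_of_algebraic2 h2 p
    ext k
    fin_cases k <;> simp [bracket, bracket0, V₁, e] <;> simp [hW, V₂ii, e0, e1, e2]
  have hz : derivAlong u F V₁ (fun q => ξ q 0) = fun _ => 0 :=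
    funext (H.V₁_alpha_of_algebraic2 h2)
  have h3 : derivAlong u F W (fun _ => (0 : ℝ)) p = 0 := dirDeriv_const _ _ _
  rw [hb, H.dirDeriv_comb _ _ t1 t1, hz, h3] at hc
  linarith

/-- From the commutator `[V₃, V₂] = (1 - κ) V₂`, applied to `α`. -/
theorem V₃_V₂_alpha (H : IsHypersurface κ d ε u F ξ) (p : N) :
    derivAlong u F V₃ii (derivAlong u F (V₂ii (fun q => ξ q 0) (fun q => ξ q 1))
      (fun q => ξ q 0)) p =
    (2 - κ) * derivAlong u F (V₂ii (fun q => ξ q 0) (fun q => ξ q 1)) (fun q => ξ q 0) p := by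
  have t2 := (H.isTangentField_iff.1 (H.isTangentField_V₂ii h2)).2 p
  have hc := H.derivAlong_commutator (H.isTangentField_V₃ii h2) (H.isTangentField_V₂ii h2)
    (H.smV 0) p
  set W := V₂ii (fun q => ξ q 0) (fun q => ξ q 1) with hW
  have hb : bracket κ u F V₃ii W p = (1 - κ) • W p + (0 : ℝ) • W p := by
    have e : ∀ c : ℝ, derivAlong u F W (fun _ => c) p = 0 := fun c => dirDeriv_const _ _ _
    have e0 : ∀ c : ℝ, derivAlong u F V₃ii (fun _ => c) p = 0 := fun c => dirDeriv_const _ _ _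
    have e1 : derivAlong u F V₃ii (fun q => ξ q 1) p = 0 := H.dirDeriv_beta_of_algebraic2 h2 p _
    have e2 := H.V₃_alpha_of_algebraic2 h2 p
    ext k
    fin_cases k <;> simp [bracket, bracket0, V₃ii, e] <;> simp [hW, V₂ii, e0, e1, e2] <;> ring
  have hz : derivAlong u F V₃ii (fun q => ξ q 0) = fun q => ξ q 0 :=
    funext (H.V₃_alpha_of_algebraic2 h2)
  rw [hb, H.dirDeriv_comb _ _ t2 t2, hz] at hc
  change _ - _ = (1 - κ) * derivAlong u F W (fun q => ξ q 0) p + _ at hc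
  linarith

theorem isTotallyGeodesic_of_case2a (H : IsHypersurface κ d ε u F ξ)
    (h : ∀ p, derivAlong u F (V₂ii (fun q => ξ q 0) (fun q => ξ q 1)) (fun q => ξ q 0) p = 0) :
    IsTotallyGeodesic u F κ d ξ := by
  intro X Y hX _ p
  rw [secondForm_eq_hAt, H.hAt_of_algebraic2 h2 _ ((H.isTangentField_iff.1 hX).2 p), h,
    delta_of_algebraic2 h2]
  ring

theorem not_isTotallyGeodesic_of_case2b [Nonempty N] (H : IsHypersurface κ d ε u F ξ)
    (h : ∀ p, derivAlong u F (V₂ii (fun q => ξ q 0) (fun q => ξ q 1)) (fun q => ξ q 0) p ≠ 0) :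
    ¬ IsTotallyGeodesic u F κ d ξ := by
  intro hg
  obtain ⟨p⟩ := ‹Nonempty N›
  have hW := H.isTangentField_V₂ii h2
  have hβ := beta_of_algebraic2 h2 p
  have h' := hg _ _ hW hW p
  rw [secondForm_eq_hAt, H.hAt_of_algebraic2 h2 _ ((H.isTangentField_iff.1 hW).2 p),
    delta_of_algebraic2 h2] at h'
  rw [show V₂ii (fun q => ξ q 0) (fun q => ξ q 1) p 2 = ξ p 1 from rfl] at h'
  have hβ0 : ξ p 1 ≠ 0 := by
    intro h0
    rw [h0] at hβ
    norm_num at hβ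
  have h'' : ξ p 1 * derivAlong u F (V₂ii (fun q => ξ q 0) (fun q => ξ q 1)) (fun q => ξ q 0) p =
      0 := by
    linear_combination h' - ξ p 1 * derivAlong u F (V₂ii (fun q => ξ q 0) (fun q => ξ q 1))
      (fun q => ξ q 0) p * hβ
  exact mul_ne_zero hβ0 (h p) h''

/-- For a hypersurface of the second family the covariant derivative of `h` along `V₂` gives
`κ V₂(α) = 0` and `V₂(V₂(α)) = 0`; conversely these suffice. When `κ = 0`, the function `V₂(α)`
solves a linear equation `df = 2 f θ⁴`, and so has no zero unless it vanishes identically. -/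
theorem isParallel_iff_of_algebraic2 [ConnectedSpace N] (H : IsHypersurface κ d ε u F ξ) :
    IsParallel u F κ d ξ ↔
      Case2a u F ε (fun q => ξ q 0) (fun q => ξ q 1) (fun q => ξ q 2) (fun q => ξ q 3) ∨
      Case2b u F κ ε (fun q => ξ q 0) (fun q => ξ q 1) (fun q => ξ q 2) (fun q => ξ q 3) := by
  set W := V₂ii (fun q => ξ q 0) (fun q => ξ q 1) with hW
  set g := derivAlong u F W (fun q => ξ q 0) with hg
  have hα1 := H.V₁_alpha_of_algebraic2 h2
  have hα3 := H.V₃_alpha_of_algebraic2 h2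
  constructor
  · intro hpar
    have tW := H.isTangentField_V₂ii h2
    have t3 := H.isTangentField_V₃ii h2
    have hβ := beta_of_algebraic2 h2
    have hβ0 : ∀ p, ξ p 1 ≠ 0 := fun p h0 => by
      have := hβ p
      rw [h0] at this
      norm_num at this
    have hWg : ∀ p, derivAlong u F W g p = 0 := by
      intro p
      have h := hpar _ _ _ tW tW tW p
      rw [H.nablaSecondForm_of_algebraic2 h2 tW tW tW] at h
      change ξ p 1 * derivAlong u F W g p * _ - ξ p 1 * g p * _ = 0 at h
      simp only [hW, V₂ii, Matrix.cons_val, mul_zero, zero_mul, add_zero, sub_zero] at h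
      rw [hβ p, mul_one] at h
      exact (mul_eq_zero.1 h).resolve_left (hβ0 p)
    have hκg : ∀ p, κ * g p = 0 := by
      intro p
      have h := hpar _ _ _ tW t3 tW p
      rw [H.nablaSecondForm_of_algebraic2 h2 tW t3 tW] at h
      change ξ p 1 * derivAlong u F W g p * _ - ξ p 1 * g p * _ = 0 at h
      simp only [hW, V₂ii, V₃ii, Matrix.cons_val] at h
      apply mul_left_cancel₀ (pow_ne_zero 3 (hβ0 p))
      linear_combination -h
    by_cases hκ : κ = 0
    · have hD : ∀ p x, inner0 d x (ξ p) = 0 → dirDeriv u F p x g = 2 * x 3 * g p := by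
        intro p x hx
        have e3 := H.V₃_V₂_alpha h2 p
        rw [H.dirDeriv_of_algebraic2 h2 g hx, hWg p, H.V₁_V₂_alpha h2 p, e3, hκ]
        ring
      by_cases h0 : ∃ p, g p = 0
      · obtain ⟨p₀, hp₀⟩ := h0
        exact Or.inl ⟨h2, fun p => ⟨hα1 p, sub_eq_zero.2 (hα3 p),
          H.eq_zero_of_dirDeriv_eq (H.sm_V₂_alpha h2) 2 hD hp₀ p⟩⟩
      · push Not at h0
        exact Or.inr ⟨h2, hκ, fun p => ⟨hα1 p, sub_eq_zero.2 (hα3 p), hWg p, h0 p⟩⟩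
    · exact Or.inl ⟨h2, fun p => ⟨hα1 p, sub_eq_zero.2 (hα3 p),
        (mul_eq_zero.1 (hκg p)).resolve_left hκ⟩⟩
  · rintro (⟨-, h⟩ | ⟨-, hκ, h⟩) X Y Z hX hY hZ p
    · have h0 : derivAlong u F W (fun q => ξ q 0) = fun _ => 0 := funext fun p => (h p).2.2
      rw [H.nablaSecondForm_of_algebraic2 h2 hX hY hZ, h0, dirDeriv_const]
      ring
    · have tX := (H.isTangentField_iff.1 hX).2 p
      have e3 := H.V₃_V₂_alpha h2 p
      rw [H.nablaSecondForm_of_algebraic2 h2 hX hY hZ, H.dirDeriv_of_algebraic2 h2 _ tX,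
        (h p).2.2.1, H.V₁_V₂_alpha h2 p, e3, hκ]
      ring

end IsHypersurface

end SecondFamily

/-! ### The third family -/

section ThirdFamily

set_option linter.unusedSectionVars false

open Filter Topology

variable {G : Type*} [TopologicalSpace G] [ChartedSpace (EuclideanSpace ℝ (Fin 4)) G] [Group G]
  {N : Type*} [TopologicalSpace N] [ChartedSpace (EuclideanSpace ℝ (Fin 3)) N]
  {κ d ε : ℝ} {u : Module.Basis (Fin 4) ℝ (GroupLieAlgebra (𝓡 4) G)} {F : N → G} {ξ : N → Vec}
  [IsManifold (𝓡 3) ∞ N] [LieGroup (𝓡 4) ∞ G]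

namespace IsHypersurface

variable (hγ : ∀ q, ξ q 2 = 0)

include hγ

theorem isTangentField_V₂iii (H : IsHypersurface κ d ε u F ξ) :
    IsTangentField u F (V₂iii d (fun q => ξ q 1) (fun q => ξ q 3)) := by
  refine H.isTangentField_iff.2 ⟨fun k => ?_, fun p => ?_⟩
  · fin_cases k
    exacts [Sm.const 0, (Sm.const d).mul (H.smV 3), Sm.const 0, (H.smV 1).neg]
  · rw [inner0_normal_of_gamma hγ]
    simp only [V₂iii, Matrix.cons_val]
    ring

theorem isTangentField_V₃iii (H : IsHypersurface κ d ε u F ξ) :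
    IsTangentField u F (V₃iii (fun q => ξ q 0) (fun q => ξ q 1)) := by
  refine H.isTangentField_iff.2 ⟨fun k => ?_, fun p => ?_⟩
  · fin_cases k
    exacts [Sm.const 0, H.smV 0, H.smV 1, Sm.const 0]
  · rw [inner0_normal_of_gamma hγ]
    simp only [V₃iii, Matrix.cons_val]
    ring

/-- The expansion of a tangent vector in the frame `V₁, V₂, V₃` of the third family. -/
theorem dirDeriv_of_beta_ne_zero (H : IsHypersurface κ d ε u F ξ) (f : N → ℝ) {p : N}
    (hβ : ξ p 1 ≠ 0) {x : Vec} (hx : inner0 d x (ξ p) = 0) :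
    dirDeriv u F p x f = x 0 * derivAlong u F V₁ f p -
      x 3 / ξ p 1 * derivAlong u F (V₂iii d (fun q => ξ q 1) (fun q => ξ q 3)) f p +
      x 2 / ξ p 1 * derivAlong u F (V₃iii (fun q => ξ q 0) (fun q => ξ q 1)) f p := by
  have t1 := (H.isTangentField_iff.1 (H.isTangentField_V₁ hγ)).2 p
  have t2 := (H.isTangentField_iff.1 (H.isTangentField_V₂iii hγ)).2 p
  have t3 := (H.isTangentField_iff.1 (H.isTangentField_V₃iii hγ)).2 p
  set V := V₂iii d (fun q => ξ q 1) (fun q => ξ q 3) with hV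
  set W := V₃iii (fun q => ξ q 0) (fun q => ξ q 1) with hW
  have t12 : inner0 d (x 0 • V₁ p + (-(x 3 / ξ p 1)) • V p) (ξ p) = 0 := by
    rw [inner0_add_left, inner0_smul_left, inner0_smul_left, t1, t2]; ring
  have hx' := hx
  rw [inner0_normal_of_gamma hγ] at hx'
  have hdec : x = (1 : ℝ) • (x 0 • V₁ p + (-(x 3 / ξ p 1)) • V p) + (x 2 / ξ p 1) • W p := by
    ext k
    fin_cases k
    · simp [V₁, hV, V₂iii, hW, V₃iii]
    · simp [V₁, hV, V₂iii, hW, V₃iii]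
      field_simp
      linear_combination hx'
    · simp [V₁, hV, V₂iii, hW, V₃iii]
      field_simp
    · simp [V₁, hV, V₂iii, hW, V₃iii]
      field_simp
  conv_lhs => rw [hdec]
  rw [H.dirDeriv_comb _ _ t12 t3, H.dirDeriv_comb _ _ t1 t2]
  change 1 * (x 0 * derivAlong u F V₁ f p + _ * derivAlong u F V f p) +
    _ * derivAlong u F W f p = _
  ring

/-- The covariant derivative of `h` in the null direction `V₁`, for which
`h(V₁, ·) = -κδ g(V₁, ·)`. Here `nablaInduced V₁` has been made explicit. -/
theorem nablaSecondForm_V₁ (H : IsHypersurface κ d ε u F ξ) (X : N → Vec) {Z : N → Vec}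
    (hZ : IsTangentField u F Z) (p : N) :
    nablaSecondForm u F κ d ξ X V₁ Z p =
      κ * dirDeriv u F p (X p) (fun q => ξ q 3) * Z p 2 -
        hAt κ d u F ξ p (![-X p 3, 0, 0, κ * X p 2 / d] - (ε * (κ * X p 2 * ξ p 3)) • ξ p) (Z p) -
        κ * ξ p 3 * (κ * (X p 2 * Z p 3) + X p 3 * Z p 2) := by
  have tZ := (H.isTangentField_iff.1 hZ).2
  have sZ : SmV Z := hZ.1
  have e1 : secondForm u F κ d ξ V₁ Z = fun q => κ * (ξ q 3 * Z q 2) := by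
    funext q
    rw [secondForm_eq_hAt]
    exact (H.hAt_V₁_left hγ (tZ q)).trans (mul_assoc _ _ _)
  have e2 : nabla u F κ d X V₁ p = ![-X p 3, 0, 0, κ * X p 2 / d] := by
    have e : ∀ c : ℝ, derivAlong u F X (fun _ => c) p = 0 := fun c => dirDeriv_const _ _ _
    ext k
    fin_cases k <;> simp [nabla, V₁, lam] <;> simp [e]
  have e3 : inner0 d (![-X p 3, 0, 0, κ * X p 2 / d] : Vec) (ξ p) = κ * X p 2 * ξ p 3 := by
    rw [inner0_normal_of_gamma hγ]
    have hd := H.ne_zero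
    simp only [Matrix.cons_val]
    field_simp
    ring
  have e4 : derivAlong u F X (secondForm u F κ d ξ V₁ Z) p =
      κ * (dirDeriv u F p (X p) (fun q => ξ q 3) * Z p 2 +
        ξ p 3 * dirDeriv u F p (X p) (fun q => Z q 2)) := by
    rw [e1]
    change dirDeriv u F p (X p) _ = _
    rw [dirDeriv_const_mul p _ _ ((H.smV 3).mul (sZ 2)), dirDeriv_mul p _ (H.smV 3) (sZ 2)]
  have e5 : hAt κ d u F ξ p (V₁ p) (nablaInduced u F κ d ξ X Z p) =
      κ * ξ p 3 * nablaInduced u F κ d ξ X Z p 2 :=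
    H.hAt_V₁_left hγ (H.inner0_nablaInduced X Z p)
  rw [nablaSecondForm, e4, secondForm_eq_hAt, secondForm_eq_hAt, e5, H.nablaInduced_two hγ,
    H.nablaInduced_eq, e2, e3]
  ring

/-- At a point of a parallel hypersurface where neither `β` nor `δ` vanishes, `δ` is critical and
`V₂(α) + αβ = 0`. -/
theorem critical_of_isParallel (H : IsHypersurface κ d ε u F ξ) (hpar : IsParallel u F κ d ξ)
    {p : N} (hβ : ξ p 1 ≠ 0) (hδ : ξ p 3 ≠ 0) :
    (∀ x, inner0 d x (ξ p) = 0 → dirDeriv u F p x (fun q => ξ q 3) = 0) ∧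
      derivAlong u F (V₂iii d (fun q => ξ q 1) (fun q => ξ q 3)) (fun q => ξ q 0) p +
        ξ p 0 * ξ p 1 = 0 := by
  have hd := H.ne_zero
  have hκ : κ ≠ 0 := by rw [H.kappa_eq_two hpar hβ hδ]; norm_num
  have T1 := H.isTangentField_V₁ hγ
  have T2 := H.isTangentField_V₂iii hγ
  have T3 := H.isTangentField_V₃iii hγ
  have t1 := (H.isTangentField_iff.1 T1).2 p
  have t2 := (H.isTangentField_iff.1 T2).2 p
  have t3 := (H.isTangentField_iff.1 T3).2 p
  set V := V₂iii d (fun q => ξ q 1) (fun q => ξ q 3) with hV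
  set W := V₃iii (fun q => ξ q 0) (fun q => ξ q 1) with hW
  have V0 : V p 0 = 0 := rfl
  have V1 : V p 1 = d * ξ p 3 := rfl
  have V2 : V p 2 = 0 := rfl
  have V3 : V p 3 = -ξ p 1 := rfl
  have W0 : W p 0 = 0 := rfl
  have W1 : W p 1 = ξ p 0 := rfl
  have W2 : W p 2 = ξ p 1 := rfl
  have W3 : W p 3 = 0 := rfl
  have hu := H.unit_of_gamma hγ p
  have hs := H.sq_sign
  -- `V₁(δ) = 0`
  have d1 : derivAlong u F V₁ (fun q => ξ q 3) p = 0 := by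
    have h := hpar _ _ _ T1 T1 T3 p
    have hz : (![-V₁ p 3, 0, 0, κ * V₁ p 2 / d] - (ε * (κ * V₁ p 2 * ξ p 3)) • ξ p : Vec) =
        (0 : ℝ) • V₁ p + (0 : ℝ) • V₁ p := by
      ext k
      fin_cases k <;> simp [V₁]
    rw [H.nablaSecondForm_V₁ hγ V₁ T3, hz, H.hAt_comb_left _ _ _ t1 t1, W2, W3] at h
    have h' : κ * derivAlong u F V₁ (fun q => ξ q 3) p * ξ p 1 = 0 := by
      simp only [V₁, Matrix.cons_val] at h
      change κ * dirDeriv u F p ![1, 0, 0, 0] (fun q => ξ q 3) * ξ p 1 = 0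
      linarith
    simpa [hκ, hβ] using h'
  -- `V₂(δ) = 0`
  have d2 : derivAlong u F V (fun q => ξ q 3) p = 0 := by
    have h := hpar _ _ _ T2 T1 T3 p
    have hz : (![-V p 3, 0, 0, κ * V p 2 / d] - (ε * (κ * V p 2 * ξ p 3)) • ξ p : Vec) =
        ξ p 1 • V₁ p + (0 : ℝ) • V₁ p := by
      rw [V2, V3]
      ext k
      fin_cases k <;> simp [V₁]
    have h1 : hAt κ d u F ξ p (V₁ p) (W p) = κ * ξ p 3 * W p 2 := H.hAt_V₁_left hγ t3
    rw [H.nablaSecondForm_V₁ hγ V T3, hz, H.hAt_comb_left _ _ _ t1 t1, h1, V2, V3, W2, W3] at h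
    have h' : κ * derivAlong u F V (fun q => ξ q 3) p * ξ p 1 = 0 := by
      change κ * dirDeriv u F p (V p) (fun q => ξ q 3) * ξ p 1 = 0
      linarith
    simpa [hκ, hβ] using h'
  have b2 : dirDeriv u F p (V p) (fun q => ξ q 1) = 0 := by
    have h := H.dirDeriv_unit_of_gamma hγ p (V p)
    rw [show dirDeriv u F p (V p) (fun q => ξ q 3) = 0 from d2, mul_zero, add_zero] at h
    exact (mul_eq_zero.1 h).resolve_left hβ
  -- `h(V₂, V₃)` in two ways
  have h23 : hAt κ d u F ξ p (V p) (W p) =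
      ξ p 1 * (derivAlong u F V (fun q => ξ q 0) p + ξ p 0 * ξ p 1) -
        κ * d * ξ p 3 ^ 2 * ξ p 0 := by
    rw [hAt_apply hd hγ, b2, V0, V1, V2, V3, W0, W1, W2, W3]
    change (derivAlong u F V (fun q => ξ q 0) p + _ + _ - _) * _ + _ - _ - _ - _ = _
    ring
  have h32 : hAt κ d u F ξ p (W p) (V p) =
      -(d * ξ p 3 * dirDeriv u F p (W p) (fun q => ξ q 1)) +
        d * ξ p 1 * dirDeriv u F p (W p) (fun q => ξ q 3) - κ * d * ξ p 3 ^ 2 * ξ p 0 := by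
    rw [hAt_apply hd hγ, V0, V1, V2, V3, W0, W1, W2, W3]
    ring
  have hsymm := H.hAt_symm t2 t3
  rw [h23, h32] at hsymm
  have hDu := H.dirDeriv_unit_of_gamma hγ p (W p)
  -- `(∇_{V₃} h)(V₁, V₃) = 0`
  have hN : ε * d * dirDeriv u F p (W p) (fun q => ξ q 3) + ξ p 1 ^ 2 *
      (derivAlong u F V (fun q => ξ q 0) p + ξ p 0 * ξ p 1) = 0 := by
    have h := hpar _ _ _ T3 T1 T3 p
    have hz : (![-W p 3, 0, 0, κ * W p 2 / d] - (ε * (κ * W p 2 * ξ p 3)) • ξ p : Vec) =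
        (-(ε * κ * ξ p 1 * ξ p 3 * ξ p 0)) • V₁ p + (-(ε * κ * ξ p 1 ^ 2 / d)) • V p := by
      rw [W2, W3]
      ext k
      fin_cases k
      · simp [V₁, V0]
        left
        ring
      · simp [V₁, V1]; field_simp
      · simp [V₁, V2, hγ]
      · simp [V₁, V3]
        field_simp
        linear_combination -hs - ε * hu
    have h1 : hAt κ d u F ξ p (V₁ p) (W p) = κ * ξ p 3 * W p 2 := H.hAt_V₁_left hγ t3
    rw [H.nablaSecondForm_V₁ hγ W T3, hz, H.hAt_comb_left _ _ _ t1 t2, h1, h23, W2, W3] at h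
    field_simp at h
    apply mul_left_cancel₀ (mul_ne_zero hκ hβ)
    linear_combination ε * h - κ * ξ p 1 ^ 3 *
      (derivAlong u F V (fun q => ξ q 0) p + ξ p 0 * ξ p 1) * hs
  have hA : derivAlong u F V (fun q => ξ q 0) p + ξ p 0 * ξ p 1 = 0 := by
    have h : 2 * ξ p 1 ^ 2 * (derivAlong u F V (fun q => ξ q 0) p + ξ p 0 * ξ p 1) = 0 := by
      linear_combination ξ p 1 * hsymm + hN - d * ξ p 3 * hDu +
        d * dirDeriv u F p (W p) (fun q => ξ q 3) * hu
    exact (mul_eq_zero.1 h).resolve_left (mul_ne_zero two_ne_zero (pow_ne_zero 2 hβ))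
  refine ⟨fun x hx => ?_, hA⟩
  rw [hA, mul_zero, add_zero] at hN
  have d3 : derivAlong u F W (fun q => ξ q 3) p = 0 := by
    refine (mul_eq_zero.1 hN).resolve_left (mul_ne_zero ?_ hd)
    rintro rfl
    simp at hs
  rw [H.dirDeriv_of_beta_ne_zero hγ _ hβ hx, d1, d2, d3]
  ring

/-- When `β` and `δ` are constant, `V₁(α) = 0` and `V₂(α) + αβ = 0`, the second fundamental form
is `h = -κδ g + β⁻¹ (V₃(α) + βδ) θ³ ⊗ θ³`. -/
theorem hAt_of_critical (H : IsHypersurface κ d ε u F ξ) {p : N} (hβ : ξ p 1 ≠ 0)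
    (dβ : ∀ x, inner0 d x (ξ p) = 0 → dirDeriv u F p x (fun q => ξ q 1) = 0)
    (dδ : ∀ x, inner0 d x (ξ p) = 0 → dirDeriv u F p x (fun q => ξ q 3) = 0)
    (hα1 : derivAlong u F V₁ (fun q => ξ q 0) p = 0)
    (hA : derivAlong u F (V₂iii d (fun q => ξ q 1) (fun q => ξ q 3)) (fun q => ξ q 0) p +
      ξ p 0 * ξ p 1 = 0) {x : Vec} (y : Vec) (hx : inner0 d x (ξ p) = 0) :
    hAt κ d u F ξ p x y = -κ * (ξ p 3 * inner0 d x y) +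
      (ξ p 1)⁻¹ * (derivAlong u F (V₃iii (fun q => ξ q 0) (fun q => ξ q 1)) (fun q => ξ q 0) p +
        ξ p 1 * ξ p 3) * (x 2 * y 2) := by
  rw [hAt_apply H.ne_zero hγ, dβ x hx, dδ x hx, H.dirDeriv_of_beta_ne_zero hγ _ hβ hx, hα1,
    eq_neg_of_add_eq_zero_left hA]
  rw [inner0_normal_of_gamma hγ] at hx
  simp only [inner0]
  field_simp
  linear_combination κ * y 3 * ξ p 1 * hx

omit hγ

/-- With `β` and `δ` constant, `∇h` is governed by `f = β⁻¹ (V₃(α) + βδ)`, and the component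
`(∇_{V₃} h)(V₂, V₃) = κ β³ f` forces `f = 0`. -/
theorem isParallel_iff_of_algebraic3 (H : IsHypersurface κ d ε u F ξ)
    (h3 : Algebraic3 κ d ε (fun q => ξ q 1) (fun q => ξ q 2) (fun q => ξ q 3)) :
    IsParallel u F κ d ξ ↔
      Case3 u F κ d ε (fun q => ξ q 0) (fun q => ξ q 1) (fun q => ξ q 2) (fun q => ξ q 3) := by
  have hγ : ∀ q, ξ q 2 = 0 := fun q => (h3.2 q).1
  have hβ : ∀ q, ξ q 1 ≠ 0 := fun q => (h3.2 q).2.1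
  have hδ : ∀ q, ξ q 3 ≠ 0 := fun q => (h3.2 q).2.2.1
  have T2 := H.isTangentField_V₂iii hγ
  have T3 := H.isTangentField_V₃iii hγ
  set V := V₂iii d (fun q => ξ q 1) (fun q => ξ q 3) with hV
  set W := V₃iii (fun q => ξ q 0) (fun q => ξ q 1) with hW
  set B : N → ℝ := fun p => derivAlong u F W (fun q => ξ q 0) p + ξ p 1 * ξ p 3 with hB
  have sB : Sm B := (H.sm_derivAlong T3 (H.smV 0)).add ((H.smV 1).mul (H.smV 3))
  have sf : Sm fun p => (ξ p 1)⁻¹ * B p :=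
    Sm.mul (f := fun p => (ξ p 1)⁻¹) (ContMDiff.inv₀ (H.smV 1) hβ) sB
  -- both implications use the formula for `∇h` in terms of `f = β⁻¹ B`
  have hform := fun (dβ : ∀ p x, inner0 d x (ξ p) = 0 → dirDeriv u F p x (fun q => ξ q 1) = 0)
    (dδ : ∀ p x, inner0 d x (ξ p) = 0 → dirDeriv u F p x (fun q => ξ q 3) = 0)
    (hα1 : ∀ p, derivAlong u F V₁ (fun q => ξ q 0) p = 0)
    (hA : ∀ p, derivAlong u F V (fun q => ξ q 0) p + ξ p 0 * ξ p 1 = 0)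
    {X Y Z : N → Vec} (hX : IsTangentField u F X) (hY : IsTangentField u F Y)
    (hZ : IsTangentField u F Z) (p : N) =>
    H.nablaSecondForm_of_hAt_eq hγ dδ sf (fun p x y hx _ =>
      H.hAt_of_critical hγ (hβ p) (dβ p) (dδ p) (hα1 p) (hA p) y hx) hX hY hZ p
  constructor
  · intro hpar
    have hcrit := fun p => H.critical_of_isParallel hγ hpar (hβ p) (hδ p)
    have dδ : ∀ p x, inner0 d x (ξ p) = 0 → dirDeriv u F p x (fun q => ξ q 3) = 0 :=
      fun p => (hcrit p).1
    have dβ : ∀ p x, inner0 d x (ξ p) = 0 → dirDeriv u F p x (fun q => ξ q 1) = 0 := by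
      intro p x hx
      have h := H.dirDeriv_unit_of_gamma hγ p x
      rw [dδ p x hx, mul_zero, add_zero] at h
      exact (mul_eq_zero.1 h).resolve_left (hβ p)
    have hα1 : ∀ p, derivAlong u F V₁ (fun q => ξ q 0) p = 0 := by
      intro p
      have t1 : inner0 d ![1, 0, 0, 0] (ξ p) = 0 :=
        (H.isTangentField_iff.1 (H.isTangentField_V₁ hγ)).2 p
      have h := H.hAt_V₁_left hγ ((H.isTangentField_iff.1 T3).2 p)
      rw [hAt_apply H.ne_zero hγ, dβ p _ t1, dδ p _ t1] at h
      simp only [hW, V₃iii, Matrix.cons_val] at h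
      have h' : dirDeriv u F p ![1, 0, 0, 0] (fun q => ξ q 0) * ξ p 1 = 0 := by linarith
      exact (mul_eq_zero.1 h').resolve_right (hβ p)
    have hBz : ∀ p, B p = 0 := by
      intro p
      have h := hpar _ _ _ T3 T2 T3 p
      rw [hform dβ dδ hα1 (fun p => (hcrit p).2) T3 T2 T3] at h
      rw [show V p 2 = 0 from rfl, show V p 3 = -ξ p 1 from rfl, show W p 2 = ξ p 1 from rfl,
        show W p 3 = 0 from rfl] at h
      have hi := inv_mul_cancel₀ (hβ p)
      have h' : κ * ξ p 1 ^ 2 * B p = 0 := by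
        generalize B p = b at h ⊢
        linear_combination h - κ * ξ p 1 ^ 2 * b * hi
      refine (mul_eq_zero.1 h').resolve_left (mul_ne_zero ?_ (pow_ne_zero 2 (hβ p)))
      rw [h3.1]
      norm_num
    have tV₁ := (H.isTangentField_iff.1 (H.isTangentField_V₁ hγ)).2
    have tV := (H.isTangentField_iff.1 T2).2
    have tW := (H.isTangentField_iff.1 T3).2
    exact ⟨h3, fun p => ⟨dβ p _ (tV₁ p), dβ p _ (tV p), dβ p _ (tW p), hα1 p, (hcrit p).2, hBz p⟩⟩
  · rintro ⟨-, h⟩ X Y Z hX hY hZ p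
    have dβ : ∀ p x, inner0 d x (ξ p) = 0 → dirDeriv u F p x (fun q => ξ q 1) = 0 := by
      intro p x hx
      rw [H.dirDeriv_of_beta_ne_zero hγ _ (hβ p) hx, (h p).1, (h p).2.1, (h p).2.2.1]
      ring
    have dδ : ∀ p x, inner0 d x (ξ p) = 0 → dirDeriv u F p x (fun q => ξ q 3) = 0 := by
      intro p x hx
      have h := H.dirDeriv_unit_of_gamma hγ p x
      rw [dβ p x hx, mul_zero, zero_add] at h
      exact (mul_eq_zero.1 h).resolve_left (mul_ne_zero H.ne_zero (hδ p))
    have hBz : (fun p => (ξ p 1)⁻¹ * B p) = fun _ => 0 :=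
      funext fun p => by rw [show B p = 0 from (h p).2.2.2.2.2, mul_zero]
    rw [hform dβ dδ (fun p => (h p).2.2.2.1) (fun p => (h p).2.2.2.2.1) hX hY hZ p, hBz,
      dirDeriv_const, show B p = 0 from (h p).2.2.2.2.2]
    ring

/-- Hypersurfaces of the third family are totally umbilical. -/
theorem shape_of_case3 (H : IsHypersurface κ d ε u F ξ)
    (h : Case3 u F κ d ε (fun q => ξ q 0) (fun q => ξ q 1) (fun q => ξ q 2) (fun q => ξ q 3))
    {X : N → Vec} (hX : IsTangentField u F X) (p : N) :
    shape u F κ d ξ X p = (-2 * ξ p 3) • X p := by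
  obtain ⟨⟨rfl, h3⟩, h⟩ := h
  have hγ : ∀ q, ξ q 2 = 0 := fun q => (h3 q).1
  have hβ : ξ p 1 ≠ 0 := (h3 p).2.1
  have hδ : ξ p 3 ≠ 0 := (h3 p).2.2.1
  have hd := H.ne_zero
  have tX := (H.isTangentField_iff.1 hX).2 p
  obtain ⟨hb1, hb2, hb3, ha1, ha2, ha3⟩ := h p
  have dβ : derivAlong u F X (fun q => ξ q 1) p = 0 := by
    change dirDeriv u F p (X p) _ = 0
    rw [H.dirDeriv_of_beta_ne_zero hγ _ hβ tX, hb1, hb2, hb3]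
    ring
  have dδ : derivAlong u F X (fun q => ξ q 3) p = 0 := by
    have h := H.dirDeriv_unit_of_gamma hγ p (X p)
    rw [show dirDeriv u F p (X p) (fun q => ξ q 1) = 0 from dβ, mul_zero, zero_add] at h
    exact (mul_eq_zero.1 h).resolve_left (mul_ne_zero hd hδ)
  have dγ : derivAlong u F X (fun q => ξ q 2) p = 0 := by
    rw [show (fun q => ξ q 2) = fun _ => (0 : ℝ) from funext hγ]
    exact dirDeriv_const _ _ _
  have dα : derivAlong u F X (fun q => ξ q 0) p = X p 3 * ξ p 0 - X p 2 * ξ p 3 := by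
    change dirDeriv u F p (X p) _ = _
    rw [H.dirDeriv_of_beta_ne_zero hγ _ hβ tX, ha1, eq_neg_of_add_eq_zero_left ha2,
      eq_neg_of_add_eq_zero_left ha3]
    field_simp
    ring
  rw [inner0_normal_of_gamma hγ] at tX
  ext k
  fin_cases k
  · change -(derivAlong u F X (fun q => ξ q 0) p + lam 2 d (X p) (ξ p) 0)
      = -2 * ξ p 3 * X p 0
    rw [dα]
    simp only [lam, Matrix.cons_val, hγ]
    ring
  · change -(derivAlong u F X (fun q => ξ q 1) p + lam 2 d (X p) (ξ p) 1)
      = -2 * ξ p 3 * X p 1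
    rw [dβ]
    simp only [lam, Matrix.cons_val]
    ring
  · change -(derivAlong u F X (fun q => ξ q 2) p + lam 2 d (X p) (ξ p) 2)
      = -2 * ξ p 3 * X p 2
    rw [dγ]
    simp only [lam, Matrix.cons_val, hγ]
    ring
  · change -(derivAlong u F X (fun q => ξ q 3) p + lam 2 d (X p) (ξ p) 3)
      = -2 * ξ p 3 * X p 3
    rw [dδ]
    simp only [lam, Matrix.cons_val, hγ]
    field_simp
    linear_combination 2 * tX

/-- Here `h(V₁, V₃) = 2βδ`. -/
theorem not_isTotallyGeodesic_of_case3 [Nonempty N] (H : IsHypersurface κ d ε u F ξ)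
    (h : Case3 u F κ d ε (fun q => ξ q 0) (fun q => ξ q 1) (fun q => ξ q 2) (fun q => ξ q 3)) :
    ¬ IsTotallyGeodesic u F κ d ξ := by
  intro hg
  obtain ⟨p⟩ := ‹Nonempty N›
  have hγ : ∀ q, ξ q 2 = 0 := fun q => (h.1.2 q).1
  have T3 := H.isTangentField_V₃iii hγ
  have h1 := hg _ _ (H.isTangentField_V₁ hγ) T3 p
  rw [secondForm_eq_hAt] at h1
  have h2 := (H.hAt_V₁_left hγ ((H.isTangentField_iff.1 T3).2 p)).symm.trans h1
  rw [h.1.1] at h2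
  exact mul_ne_zero (mul_ne_zero two_ne_zero (h.1.2 p).2.2.1) (h.1.2 p).2.1 h2

/-! ### The trichotomy -/

/-- The curvature condition gives `γ = 0`, and it gives `κ = 2` where
`βδ ≠ 0`; in all cases `β dβ = 0`, so that `β²` and `δ²` are constant. -/
theorem algebraic_of_isParallel [ConnectedSpace N] (H : IsHypersurface κ d ε u F ξ)
    (hpar : IsParallel u F κ d ξ) :
    Algebraic1 d ε (fun q => ξ q 1) (fun q => ξ q 2) (fun q => ξ q 3) ∨
    Algebraic2 ε (fun q => ξ q 1) (fun q => ξ q 2) (fun q => ξ q 3) ∨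
    Algebraic3 κ d ε (fun q => ξ q 1) (fun q => ξ q 2) (fun q => ξ q 3) := by
  have hd := H.ne_zero
  have hγ := H.gamma_eq_zero hpar
  have hunit := H.unit_of_gamma hγ
  obtain ⟨p₀⟩ : Nonempty N := inferInstance
  have hββ : ∀ p x, inner0 d x (ξ p) = 0 → ξ p 1 * dirDeriv u F p x (fun q => ξ q 1) = 0 := by
    intro p x hx
    have h := H.dirDeriv_unit_of_gamma hγ p x
    by_cases hβ : ξ p 1 = 0
    · rw [hβ, zero_mul]
    by_cases hδ : ξ p 3 = 0
    · rw [hδ] at h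
      linarith
    · rw [(H.critical_of_isParallel hγ hpar hβ hδ).1 x hx] at h
      linarith
  have hconst : ∀ p, ξ p 1 * ξ p 1 = ξ p₀ 1 * ξ p₀ 1 := fun p =>
    H.eq_of_dirDeriv_eq_zero ((H.smV 1).mul (H.smV 1)) (fun p x hx => by
      rw [dirDeriv_mul p x (H.smV 1) (H.smV 1)]
      linear_combination 2 * hββ p x hx) p p₀
  by_cases hβ : ξ p₀ 1 = 0
  · have hβ' : ∀ p, ξ p 1 = 0 := fun p => by simpa [hβ] using hconst p
    refine Or.inl fun p => ⟨hβ' p, hγ p, ?_⟩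
    have h := hunit p
    rw [hβ' p] at h
    linear_combination h
  have hβ' : ∀ p, ξ p 1 ≠ 0 := fun p h0 => by
    have h := hconst p
    rw [h0, zero_mul] at h
    exact mul_self_ne_zero.2 hβ h.symm
  have hδconst : ∀ p, ξ p 3 * ξ p 3 = ξ p₀ 3 * ξ p₀ 3 := fun p => by
    apply mul_left_cancel₀ hd
    linear_combination hunit p - hunit p₀ - hconst p
  by_cases hδ : ξ p₀ 3 = 0
  · have hδ' : ∀ p, ξ p 3 = 0 := fun p => by simpa [hδ] using hδconst p
    have hsq : ∀ p, ξ p 1 ^ 2 = ε := fun p => by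
      have h := hunit p
      rw [hδ' p] at h
      linear_combination h
    refine Or.inr (Or.inl ⟨?_, fun p => ⟨hγ p, hδ' p, hsq p⟩⟩)
    rcases H.sign with h | h
    · exact h
    · have h1 := hsq p₀
      have h2 := sq_nonneg (ξ p₀ 1)
      rw [h] at h1
      linarith
  · have hδ' : ∀ p, ξ p 3 ≠ 0 := fun p h0 => by
      have h := hδconst p
      rw [h0, zero_mul] at h
      exact mul_self_ne_zero.2 hδ h.symm
    exact Or.inr (Or.inr ⟨H.kappa_eq_two hpar hβ hδ, fun p => ⟨hγ p, hβ' p, hδ' p, by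
      linear_combination hunit p⟩⟩)

end IsHypersurface

end ThirdFamily
end A2

theorem mainTheorem2
    -- the parameters of the ambient space: brackets with parameter `κ`, metric with parameter `d`
    (κ d ε : ℝ) (hd : d ≠ 0) (hε : ε = 1 ∨ ε = -1)
    {G : Type*} [TopologicalSpace G] [ChartedSpace (EuclideanSpace ℝ (Fin 4)) G] [Group G]
    [LieGroup (𝓡 4) ∞ G]
    (u : Module.Basis (Fin 4) ℝ (GroupLieAlgebra (𝓡 4) G)) (hu : A2.IsBasisA2 κ u)
    -- a connected immersed hypersurface `F : N → G`
    {N : Type*} [TopologicalSpace N] [ChartedSpace (EuclideanSpace ℝ (Fin 3)) N]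
    [IsManifold (𝓡 3) ∞ N] [ConnectedSpace N]
    (F : N → G) (hF : ContMDiff (𝓡 3) (𝓡 4) ∞ F)
    (hF' : ∀ p, Function.Injective (mfderiv (𝓡 3) (𝓡 4) F p))
    -- the unit normal `ξ = α u₁ + β u₂ + γ u₃ + δ u₄`
    (α β γ δ : N → ℝ) (ξ : N → A2.Vec) (hξ : ξ = fun p => ![α p, β p, γ p, δ p])
    (hN : A2.IsUnitNormal u F d ε ξ) :
    (A2.IsParallel u F κ d ξ ↔
      A2.Case1 u F κ d ε α β γ δ ∨ A2.Case2a u F ε α β γ δ ∨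
      A2.Case2b u F κ ε α β γ δ ∨ A2.Case3 u F κ d ε α β γ δ) ∧
    (A2.Algebraic1 d ε β γ δ →
      (A2.IsTotallyGeodesic u F κ d ξ ↔
        (∀ p, A2.derivAlong u F A2.V₁ α p = 0 ∧ A2.derivAlong u F A2.V₂i α p = 0) ∧
        κ = 0 ∧ ∀ p, A2.phi u F d ε α δ p = 0)) ∧
    (A2.Case2a u F ε α β γ δ → A2.IsTotallyGeodesic u F κ d ξ) ∧
    (A2.Case2b u F κ ε α β γ δ → ¬ A2.IsTotallyGeodesic u F κ d ξ) ∧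
    (A2.Case3 u F κ d ε α β γ δ →
      ¬ A2.IsTotallyGeodesic u F κ d ξ ∧
      ∀ X : N → A2.Vec, A2.IsTangentField u F X →
        ∀ p, A2.shape u F κ d ξ X p = (-2 * δ p) • X p) := by
  subst hξ
  have H : A2.IsHypersurface κ d ε u F fun p => ![α p, β p, γ p, δ p] :=
    ⟨hd, hε, hu, hF, hF', hN⟩
  refine ⟨⟨fun hpar => ?_, ?_⟩, fun h1 => ?_, fun h => ?_, fun h => ?_, fun h => ?_⟩
  · rcases H.algebraic_of_isParallel hpar with h | h | h
    · exact Or.inl ⟨h, fun p => ⟨H.V₁_alpha_of_algebraic1 h p, H.V₂_alpha_of_algebraic1 h p,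
        (H.isParallel_iff_of_algebraic1 h).1 hpar p⟩⟩
    · rcases (H.isParallel_iff_of_algebraic2 h).1 hpar with h' | h'
      · exact Or.inr (Or.inl h')
      · exact Or.inr (Or.inr (Or.inl h'))
    · exact Or.inr (Or.inr (Or.inr ((H.isParallel_iff_of_algebraic3 h).1 hpar)))
  · rintro (h | h | h | h)
    · exact (H.isParallel_iff_of_algebraic1 h.1).2 fun p => (h.2 p).2.2
    · exact (H.isParallel_iff_of_algebraic2 h.1).2 (Or.inl h)
    · exact (H.isParallel_iff_of_algebraic2 h.1).2 (Or.inr h)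
    · exact (H.isParallel_iff_of_algebraic3 h.1).2 h
  · have hα := fun p => And.intro (H.V₁_alpha_of_algebraic1 h1 p) (H.V₂_alpha_of_algebraic1 h1 p)
    exact (H.isTotallyGeodesic_iff_of_algebraic1 h1).trans ⟨fun h => ⟨hα, h⟩, fun h => h.2⟩
  · exact H.isTotallyGeodesic_of_case2a h.1 fun p => (h.2 p).2.2
  · exact H.not_isTotallyGeodesic_of_case2b h.1 fun p => (h.2.2 p).2.2.2
  · exact ⟨H.not_isTotallyGeodesic_of_case3 h, fun X hX p => H.shape_of_case3 h hX p⟩
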